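/- **Conventions.** Let $k$ be an algebraically closed field. An *exact category* $\mathcal{E}$ is an additive category with a class of *conflations* $X\to Y\to Z$ satisfying Quillen's axioms; in a conflation the morphism $X\to Y$ is called an *inflation*. $\mathrm{Ext}^1(Z,X)$ is the group of Yoneda classes of conflations $X\to Y\to Z$. A *fully exact* subcategory is a full subcategory that contains the zero objects and is closed under extensions; its conflations are the conflations of $\mathcal{E}$ with all terms in the subcategory. For a class $\mathcal{P}$ of objects, $\mathcal{P}^\perp=\{E\in\mathcal{E} : \mathrm{Hom}(X,E)=0=\mathrm{Ext}^1(X,E)\ \text{for all } X\in\mathcal{P}\}$. A fully exact subcategory $\mathcal{T}\subset\mathcal{E}$ is *right admissible* if $(\mathcal{T},\mathcal{T}^\perp)$ is a torsion pair of fully exact subcategories, i.e. there are no nonzero morphisms from $\mathcal{T}$ to $\mathcal{T}^\perp$ and every $E\in\mathcal{E}$ fits into a conflation $T\to E\to F$ with $T\in\mathcal{T}$, $F\in\mathcal{T}^\perp$. A *thin category* is a $k$-linear exact category $\mathcal{E}$ with finite dimensional $\mathrm{Hom}$ and $\mathrm{Ext}^1$ spaces that admits a finite filtration $0=\mathcal{T}_0\subset\mathcal{T}_1\subset\dots\subset\mathcal{T}_n=\mathcal{E}$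 by right admissible subcategories whose graded factors $\mathcal{T}_{i-1}^\perp\cap\mathcal{T}_i$ are $k$-linearly equivalent to the category of finite dimensional $k$-vector spaces. A nonzero object $E\in\mathcal{E}$ is *irreducible* if every inflation $A\to E$ is zero or an isomorphism. Let $\Lambda$ be the set of isomorphism classes of irreducible objects, $E(\lambda)$ an object in the class $\lambda$, and let $\preceq$ be the smallest reflexive and transitive relation on $\Lambda$ such that $\lambda\preceq\mu$ whenever $E(\lambda)\notin E(\mu)^\perp$. For $\lambda\in\Lambda$ let $\iota_\lambda\colon\mathcal{T}_\lambda\hookrightarrow\mathcal{E}$ be the smallest fully exact subcategory containing all $E(\mu)$ with $\lambda\not\preceq\mu$. An additive functor $F$ from an exact category to an abelian category is *right exact* if $F(X)\to F(Y)\to F(Z)\to 0$ is exact for every conflation $X\to Y\to Z$. A *right abelian envelope* of an exact category $\mathcal{E}$ is an abelian category $\mathcal{A}_r(\mathcal{E})$ with a right exact functor $i_R\colon\mathcal{E}\to\mathcal{A}_r(\mathcal{E})$ such that, for every abelian category $\mathcal{B}$, composition with $i_R$ is an equivalence $\mathrm{Rex}(\mathcal{A}_r(\mathcal{E}),\mathcal{B})\simeq\mathrm{Rex}(\mathcal{E},\mathcal{B})$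 of the categories of right exact functors. **Theorem.** Let $\mathcal{E}$ be a thin category. Then $\preceq$ is a partial order on $\Lambda$ (so that $\Lambda$ is the *canonical poset* of $\mathcal{E}$), all $\mathcal{T}_\lambda$ are right admissible in $\mathcal{E}$, and the right abelian envelopes of $\mathcal{E}$ and of all $\mathcal{T}_\lambda$ exist. The functor $i_R\colon\mathcal{E}\to\mathcal{A}_r(\mathcal{E})$ is fully faithful, so that we may view $\mathcal{E}$ as a full subcategory of $\mathcal{A}_r(\mathcal{E})$. For $\lambda\in\Lambda$, the right exact functor $\beta_{\lambda!}\colon\mathcal{A}_r(\mathcal{T}_\lambda)\to\mathcal{A}_r(\mathcal{E})$ induced by $\iota_\lambda$ (the one that restricts to $i_R\circ\iota_\lambda$ on $\mathcal{T}_\lambda$, up to isomorphism) has a right adjoint $\beta_\lambda^*$. Moreover, an object $A\in\mathcal{A}_r(\mathcal{E})$ lies in $\mathcal{E}$ (that is, $A\simeq i_R(E)$ for some $E\in\mathcal{E}$) if and only if, for every $\lambda\in\Lambda$, the adjunction counit $\beta_{\lambda!}\beta_\lambda^*A\to A$ is a monomorphism. -/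

import Mathlib

open CategoryTheory CategoryTheory.Limits

universe w v' u' v u

/-! ### Exact categories -/

section

variable {C : Type u} [Category.{v} C] [Preadditive C]

/-- Given a class of conflations `X ⟶ Y ⟶ Z`, a deflation is the second morphism of a conflation. -/
def IsDeflationFor (conf : ObjectProperty (ShortComplex C)) {Y Z : C} (d : Y ⟶ Z) : Prop :=
  ∃ (X : C) (i : X ⟶ Y) (w : i ≫ d = 0), conf (ShortComplex.mk i d w)

/-- Given a class of conflations `X ⟶ Y ⟶ Z`, an inflation is the first morphism of a conflation. -/
def IsInflationFor (conf : ObjectProperty (ShortComplex C)) {X Y : C} (i : X ⟶ Y) : Prop :=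
  ∃ (Z : C) (d : Y ⟶ Z) (w : i ≫ d = 0), conf (ShortComplex.mk i d w)

variable (C) in
/-- An exact structure (in the sense of Quillen, with the axioms of Keller) on a category `C`.
Together with the first two fields, `C` is an additive category. -/
structure ExactStructure where
  hasZeroObject : HasZeroObject C
  hasBinaryBiproducts : HasBinaryBiproducts C
  /-- the class of conflations -/
  conf : ObjectProperty (ShortComplex C)
  isoClosed : conf.IsClosedUnderIsomorphisms
  isKernel : ∀ K : ShortComplex C, conf K → Nonempty (IsLimit (KernelFork.ofι K.f K.zero))
  isCokernel : ∀ K : ShortComplex C, conf K → Nonempty (IsColimit (CokernelCofork.ofπ K.g K.zero))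
  conf_id : ∀ Z X : C, IsZero Z →
    conf (ShortComplex.mk (0 : Z ⟶ X) (𝟙 X) (Category.comp_id _))
  deflation_comp : ∀ {X Y Z : C} (d : X ⟶ Y) (d' : Y ⟶ Z),
    IsDeflationFor conf d → IsDeflationFor conf d' → IsDeflationFor conf (d ≫ d')
  deflation_pullback : ∀ {Y Z W : C} (d : Y ⟶ Z) (h : W ⟶ Z), IsDeflationFor conf d →
    ∃ (P : C) (p : P ⟶ Y) (q : P ⟶ W), IsPullback p q d h ∧ IsDeflationFor conf q
  inflation_pushout : ∀ {X Y W : C} (i : X ⟶ Y) (h : X ⟶ W), IsInflationFor conf i →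
    ∃ (P : C) (p : Y ⟶ P) (q : W ⟶ P), IsPushout i h p q ∧ IsInflationFor conf q

namespace ExactStructure

/-- An abelian category, with all short exact sequences as conflations. -/
def ofAbelian (A : Type u') [Category.{v'} A] [Abelian A] : ExactStructure A where
  hasZeroObject := inferInstance
  hasBinaryBiproducts := inferInstance
  conf := fun K => K.ShortExact
  isoClosed := ⟨fun e h => ShortComplex.shortExact_of_iso e h⟩
  isKernel _ h := ⟨h.fIsKernel⟩
  isCokernel _ h := ⟨h.gIsCokernel⟩
  conf_id Z X hZ :=
    { exact := (ShortComplex.exact_iff_mono _ (hZ.eq_of_src _ _)).2 inferInstance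
      mono_f := ⟨fun _ _ _ => hZ.eq_of_tgt _ _⟩
      epi_g := inferInstance }
  deflation_comp := by
    rintro X Y Z d d' ⟨_, _, _, h⟩ ⟨_, _, _, h'⟩
    have := h.epi_g
    have := h'.epi_g
    dsimp at *
    exact ⟨kernel (d ≫ d'), kernel.ι _, kernel.condition _,
      { exact := ShortComplex.exact_of_f_is_kernel _ (kernelIsKernel _)
        mono_f := inferInstanceAs (Mono (kernel.ι _))
        epi_g := inferInstanceAs (Epi (d ≫ d')) }⟩
  deflation_pullback := by
    rintro Y Z W d g ⟨_, _, _, h⟩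
    have := h.epi_g
    dsimp at *
    refine ⟨pullback d g, pullback.fst _ _, pullback.snd _ _, IsPullback.of_hasPullback _ _,
      kernel (pullback.snd d g), kernel.ι _, kernel.condition _,
      { exact := ShortComplex.exact_of_f_is_kernel _ (kernelIsKernel _)
        mono_f := inferInstanceAs (Mono (kernel.ι _))
        epi_g := inferInstanceAs (Epi (pullback.snd d g)) }⟩
  inflation_pushout := by
    rintro X Y W i g ⟨_, _, _, h⟩
    have := h.mono_f
    dsimp at *
    refine ⟨pushout i g, pushout.inl _ _, pushout.inr _ _, IsPushout.of_hasPushout _ _,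
      cokernel (pushout.inr i g), cokernel.π _, cokernel.condition _,
      { exact := ShortComplex.exact_of_g_is_cokernel _ (cokernelIsCokernel _)
        mono_f := inferInstanceAs (Mono (pushout.inr i g))
        epi_g := inferInstanceAs (Epi (cokernel.π _)) }⟩

variable (S : ExactStructure C)

abbrev IsDeflation {Y Z : C} (d : Y ⟶ Z) : Prop := IsDeflationFor S.conf d

abbrev IsInflation {X Y : C} (i : X ⟶ Y) : Prop := IsInflationFor S.conf i

section

variable {S} {X Y Z : C} {i : X ⟶ Y} {d : Y ⟶ Z} {w : i ≫ d = 0}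

lemma conf.mono (h : S.conf (ShortComplex.mk i d w)) : Mono i := by
  obtain ⟨hl⟩ := S.isKernel _ h
  exact mono_of_isLimit_fork hl

lemma conf.epi (h : S.conf (ShortComplex.mk i d w)) : Epi d := by
  obtain ⟨hl⟩ := S.isCokernel _ h
  exact epi_of_isColimit_cofork hl

lemma conf.lift (h : S.conf (ShortComplex.mk i d w)) {T : C} (t : T ⟶ Y) (ht : t ≫ d = 0) :
    ∃ s : T ⟶ X, s ≫ i = t := by
  obtain ⟨hl⟩ := S.isKernel _ h
  obtain ⟨s, hs⟩ := KernelFork.IsLimit.lift' hl t ht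
  exact ⟨s, hs⟩

lemma conf.desc (h : S.conf (ShortComplex.mk i d w)) {T : C} (t : Y ⟶ T) (ht : i ≫ t = 0) :
    ∃ s : Z ⟶ T, d ≫ s = t := by
  obtain ⟨hl⟩ := S.isCokernel _ h
  obtain ⟨s, hs⟩ := CokernelCofork.IsColimit.desc' hl t ht
  exact ⟨s, hs⟩

lemma conf_of_iso (h : S.conf (ShortComplex.mk i d w)) {X' Y' Z' : C} {i' : X' ⟶ Y'} {d' : Y' ⟶ Z'}
    (w' : i' ≫ d' = 0) (a : X ≅ X') (b : Y ≅ Y') (c : Z ≅ Z')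
    (h₁ : a.hom ≫ i' = i ≫ b.hom) (h₂ : b.hom ≫ d' = d ≫ c.hom) :
    S.conf (ShortComplex.mk i' d' w') := by
  have := S.isoClosed
  exact S.conf.prop_of_iso (ShortComplex.isoMk (S₁ := ShortComplex.mk i d w)
    (S₂ := ShortComplex.mk i' d' w') a b c h₁ h₂) h

/-- A deflation together with any of its kernels is a conflation. -/
lemma conf_of_deflation (hd : S.IsDeflation d) (hi : Mono i)
    (hl : ∀ (T : C) (t : T ⟶ Y), t ≫ d = 0 → ∃ s : T ⟶ X, s ≫ i = t) :
    S.conf (ShortComplex.mk i d w) := by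
  obtain ⟨X', i', w', h⟩ := hd
  have := conf.mono h
  obtain ⟨a, ha⟩ := conf.lift h i w
  obtain ⟨b, hb⟩ := hl _ i' w'
  refine conf_of_iso h w ⟨b, a, ?_, ?_⟩ (Iso.refl _) (Iso.refl _) ?_ ?_
  · rw [← cancel_mono i', Category.assoc, ha, hb, Category.id_comp]
  · rw [← cancel_mono i, Category.assoc, hb, ha, Category.id_comp]
  · simp [hb]
  · simp

/-- An inflation together with any of its cokernels is a conflation. -/
lemma conf_of_inflation (hi : S.IsInflation i) (hd : Epi d)
    (hl : ∀ (T : C) (t : Y ⟶ T), i ≫ t = 0 → ∃ s : Z ⟶ T, d ≫ s = t) :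
    S.conf (ShortComplex.mk i d w) := by
  obtain ⟨Z', d', w', h⟩ := hi
  have := conf.epi h
  obtain ⟨a, ha⟩ := conf.desc h d w
  obtain ⟨b, hb⟩ := hl _ d' w'
  refine conf_of_iso h w (Iso.refl _) (Iso.refl _) ⟨a, b, ?_, ?_⟩ ?_ ?_
  · rw [← cancel_epi d', ← Category.assoc, ha, hb, Category.comp_id]
  · rw [← cancel_epi d, ← Category.assoc, hb, ha, Category.comp_id]
  · simp
  · simp [ha]

/-- The pullback of a conflation `X ⟶ Y ⟶ Z` along `h : W ⟶ Z` is a conflation `X ⟶ P ⟶ W`. -/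
lemma exists_pullback_conf (hc : S.conf (ShortComplex.mk i d w)) {W : C} (h : W ⟶ Z) :
    ∃ (P : C) (p : P ⟶ Y) (q : P ⟶ W) (j : X ⟶ P) (wj : j ≫ q = 0),
      IsPullback p q d h ∧ j ≫ p = i ∧ S.conf (ShortComplex.mk j q wj) := by
  obtain ⟨P, p, q, hP, hq⟩ := S.deflation_pullback d h ⟨X, i, w, hc⟩
  have hj : i ≫ d = (0 : X ⟶ W) ≫ h := by simp [w]
  have := conf.mono hc
  refine ⟨P, p, q, hP.lift i 0 hj, by simp, hP, by simp, conf_of_deflation hq ?_ ?_⟩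
  · exact mono_of_mono_fac (hP.lift_fst i 0 hj)
  · intro T t ht
    obtain ⟨s, hs⟩ := conf.lift hc (t ≫ p) (by rw [Category.assoc, hP.w, ← Category.assoc, ht,
      zero_comp])
    exact ⟨s, hP.hom_ext (by simp [hs]) (by simp [ht])⟩

/-- The pushout of a conflation `X ⟶ Y ⟶ Z` along `h : X ⟶ W` is a conflation `W ⟶ P ⟶ Z`. -/
lemma exists_pushout_conf (hc : S.conf (ShortComplex.mk i d w)) {W : C} (h : X ⟶ W) :
    ∃ (P : C) (p : Y ⟶ P) (q : W ⟶ P) (j : P ⟶ Z) (wj : q ≫ j = 0),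
      IsPushout i h p q ∧ p ≫ j = d ∧ S.conf (ShortComplex.mk q j wj) := by
  obtain ⟨P, p, q, hP, hq⟩ := S.inflation_pushout i h ⟨Z, d, w, hc⟩
  have hj : i ≫ d = h ≫ (0 : W ⟶ Z) := by simp [w]
  have := conf.epi hc
  refine ⟨P, p, q, hP.desc d 0 hj, by simp, hP, by simp, conf_of_inflation hq ?_ ?_⟩
  · exact epi_of_epi_fac (hP.inl_desc d 0 hj)
  · intro T t ht
    obtain ⟨s, hs⟩ := conf.desc hc (p ≫ t) (by rw [← Category.assoc, hP.w, Category.assoc, ht,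
      comp_zero])
    exact ⟨s, hP.hom_ext (by simp [← hs, ← Category.assoc]) (by simp [ht, ← Category.assoc])⟩

/-- A morphism of conflations which is the identity at both ends is an isomorphism. -/
lemma conf.isIso_middle (h : S.conf (ShortComplex.mk i d w)) {Y' : C} {i' : X ⟶ Y'} {d' : Y' ⟶ Z}
    {w' : i' ≫ d' = 0} (h' : S.conf (ShortComplex.mk i' d' w')) (φ : Y ⟶ Y')
    (hi : i ≫ φ = i') (hd : φ ≫ d' = d) : IsIso φ := by
  have := conf.mono h'
  have := conf.mono h
  have hmono : Mono φ := by
    refine Preadditive.mono_of_cancel_zero _ fun {T} t ht => ?_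
    obtain ⟨s, rfl⟩ := conf.lift h t (by rw [← hd, ← Category.assoc, ht, zero_comp])
    have : s ≫ i' = 0 := by rw [← hi, ← Category.assoc, ht]
    rw [(cancel_mono i').1 (this.trans zero_comp.symm), zero_comp]
  obtain ⟨P, p, q, κ, hκ, hP, hκp, hc⟩ := exists_pullback_conf h d'
  have := conf.epi hc
  obtain ⟨s, hs⟩ := conf.lift h' (q - p ≫ φ)
    (by rw [Preadditive.sub_comp, Category.assoc, hd, hP.w, sub_self])
  have hsκ : κ ≫ s = - 𝟙 X := by
    rw [← cancel_mono i', Category.assoc, hs, Preadditive.comp_sub, hκ, ← Category.assoc, hκp, hi]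
    simp
  obtain ⟨χ, hχ⟩ := conf.desc hc (p + s ≫ i)
    (by rw [Preadditive.comp_add, hκp, ← Category.assoc, hsκ]; simp)
  have h1 : χ ≫ φ = 𝟙 Y' := by
    rw [← cancel_epi q, ← Category.assoc, hχ, Preadditive.add_comp, Category.assoc, hi, hs]
    simp
  exact ⟨χ, by rw [← cancel_mono φ, Category.assoc, h1]; simp, h1⟩

end

variable {S} in
lemma conf_zero (X Z : C) (hZ : IsZero Z) :
    S.conf (ShortComplex.mk (𝟙 X) (0 : X ⟶ Z) comp_zero) := by
  obtain ⟨P, p, q, j, wj, hP, hpj, hc⟩ := exists_pushout_conf (S.conf_id Z Z hZ) (0 : Z ⟶ X)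
  have hj : j = 0 := hZ.eq_of_tgt _ _
  have hp : p = 0 := hZ.eq_of_src _ _
  have := conf.mono hc
  obtain ⟨s, hs⟩ := conf.lift hc (𝟙 P) (by simp [hj])
  refine conf_of_iso hc comp_zero (Iso.refl _) ⟨s, q, hs, ?_⟩ (Iso.refl _) ?_ ?_
  · rw [← cancel_mono q, Category.assoc, hs]; simp
  · dsimp
    rw [← cancel_mono q]; simp [hs]
  · exact hZ.eq_of_tgt _ _

variable {S} in
/-- A split short complex is a conflation. -/
lemma conf_of_split {X Y Z : C} (i : X ⟶ Y) (d : Y ⟶ Z) (r : Y ⟶ X) (s : Z ⟶ Y) (w : i ≫ d = 0)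
    (hir : i ≫ r = 𝟙 X) (hsd : s ≫ d = 𝟙 Z) (hid : r ≫ i + d ≫ s = 𝟙 Y) (hsr : s ≫ r = 0) :
    S.conf (ShortComplex.mk i d w) := by
  have := S.hasZeroObject
  obtain ⟨O, hO⟩ := HasZeroObject.zero (C := C)
  obtain ⟨P, p, q, j, wj, hP, hjp, hc⟩ :=
    exists_pullback_conf (conf_zero (S := S) X O hO) (0 : Z ⟶ O)
  refine conf_of_iso hc w (Iso.refl _)
    ⟨p ≫ i + q ≫ s, hP.lift r d (by simp), ?_, ?_⟩ (Iso.refl _) ?_ ?_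
  · apply hP.hom_ext
    · simp [hir, hsr]
    · simp [w, hsd]
  · simpa using hid
  · dsimp
    rw [Preadditive.comp_add, ← Category.assoc, hjp, ← Category.assoc, wj]; simp
  · dsimp
    simp [w, hsd]

/-! ### The group `Ext¹` -/

/-- Conflations `X ⟶ Y ⟶ Z` with fixed ends. -/
structure Extension (Z X : C) where
  Y : C
  i : X ⟶ Y
  d : Y ⟶ Z
  w : i ≫ d = 0
  conf : S.conf (ShortComplex.mk i d w)

namespace Extension

variable {S} {X X' X'' Z : C}

/-- Two conflations with the same ends are equivalent if they are isomorphic through an isomorphism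
which is the identity at both ends. -/
instance setoid (Z X : C) : Setoid (S.Extension Z X) where
  r ξ η := ∃ e : ξ.Y ≅ η.Y, ξ.i ≫ e.hom = η.i ∧ e.hom ≫ η.d = ξ.d
  iseqv :=
    { refl := fun ξ => ⟨Iso.refl _, by simp, by simp⟩
      symm := by
        rintro ξ η ⟨e, h₁, h₂⟩
        exact ⟨e.symm, by simp [← h₁], by simp [← h₂]⟩
      trans := by
        rintro ξ η ζ ⟨e, h₁, h₂⟩ ⟨e', h₁', h₂'⟩
        exact ⟨e ≪≫ e', by simp [← h₁', ← h₁], by simp [← h₂, ← h₂']⟩ }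

/-- There is a morphism of conflations from `ξ` to `η` which is `f` on the left end and the identity
on the right end; equivalently, `η` is equivalent to the pushout of `ξ` along `f`. -/
def Over (f : X ⟶ X') (ξ : S.Extension Z X) (η : S.Extension Z X') : Prop :=
  ∃ φ : ξ.Y ⟶ η.Y, ξ.i ≫ φ = f ≫ η.i ∧ φ ≫ η.d = ξ.d

lemma Over.comp {f : X ⟶ X'} {g : X' ⟶ X''} {ξ : S.Extension Z X} {η : S.Extension Z X'}
    {ζ : S.Extension Z X''} (h : Over f ξ η) (h' : Over g η ζ) : Over (f ≫ g) ξ ζ := by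
  obtain ⟨φ, h₁, h₂⟩ := h
  obtain ⟨ψ, h₁', h₂'⟩ := h'
  exact ⟨φ ≫ ψ, by rw [← Category.assoc, h₁, Category.assoc, h₁', Category.assoc],
    by rw [Category.assoc, h₂', h₂]⟩

lemma Over.of_equiv {ξ η : S.Extension Z X} (h : ξ ≈ η) : Over (𝟙 X) ξ η := by
  obtain ⟨e, h₁, h₂⟩ := h
  exact ⟨e.hom, by simp [h₁], h₂⟩

lemma Over.equiv {ξ η : S.Extension Z X} (h : Over (𝟙 X) ξ η) : ξ ≈ η := by
  obtain ⟨φ, h₁, h₂⟩ := h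
  rw [Category.id_comp] at h₁
  have := conf.isIso_middle ξ.conf η.conf φ h₁ h₂
  exact ⟨asIso φ, h₁, h₂⟩

lemma Over.exists (f : X ⟶ X') (ξ : S.Extension Z X) : ∃ η : S.Extension Z X', Over f ξ η := by
  obtain ⟨P, p, q, j, wj, hP, hpj, hc⟩ := exists_pushout_conf ξ.conf f
  exact ⟨⟨P, q, j, wj, hc⟩, p, hP.w, hpj⟩

lemma Over.unique {f : X ⟶ X'} {ξ : S.Extension Z X} {η η' : S.Extension Z X'}
    (h : Over f ξ η) (h' : Over f ξ η') : η ≈ η' := by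
  obtain ⟨P, p, q, j, wj, hP, hpj, hc⟩ := exists_pushout_conf ξ.conf f
  have key : ∀ ζ : S.Extension Z X', Over f ξ ζ → (⟨P, q, j, wj, hc⟩ : S.Extension Z X') ≈ ζ := by
    rintro ζ ⟨φ, h₁, h₂⟩
    refine Over.equiv ⟨hP.desc φ ζ.i h₁, by simp, ?_⟩
    apply hP.hom_ext
    · simp [h₂, hpj]
    · simp [ζ.w, wj]
  exact Setoid.trans (Setoid.symm (key η h)) (key η' h')

/-- The pushout of a conflation along `f`. -/
noncomputable def push (f : X ⟶ X') (ξ : S.Extension Z X) : S.Extension Z X' :=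
  (Over.exists f ξ).choose

lemma over_push (f : X ⟶ X') (ξ : S.Extension Z X) : Over f ξ (ξ.push f) :=
  (Over.exists f ξ).choose_spec

/-- Two conflations with the same right end have a fibre product over it. -/
lemma exists_pair [HasBinaryBiproducts C] (ξ : S.Extension Z X) (η : S.Extension Z X') :
    ∃ ω : S.Extension Z (X ⊞ X'), Over biprod.fst ω ξ ∧ Over biprod.snd ω η ∧
      ∀ τ : S.Extension Z (X ⊞ X'), Over biprod.fst τ ξ → Over biprod.snd τ η → τ ≈ ω := by
  obtain ⟨P, p, q, j, wj, hP, hjp, hc⟩ := exists_pullback_conf ξ.conf η.d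
  have hd : S.IsDeflation (q ≫ η.d) := S.deflation_comp _ _ ⟨_, _, _, hc⟩ ⟨_, _, _, η.conf⟩
  have hw : (biprod.fst ≫ ξ.i : X ⊞ X' ⟶ _) ≫ ξ.d = (biprod.snd ≫ η.i) ≫ η.d := by
    simp [ξ.w, η.w]
  have hw' : hP.lift _ _ hw ≫ q ≫ η.d = 0 := by simp [η.w]
  have := conf.mono ξ.conf
  have := conf.mono η.conf
  refine ⟨⟨P, hP.lift _ _ hw, q ≫ η.d, hw', conf_of_deflation hd ?_ ?_⟩,
    ⟨p, by simp, hP.w⟩, ⟨q, by simp, rfl⟩, ?_⟩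
  · refine Preadditive.mono_of_cancel_zero _ fun {T} t ht => ?_
    have h₁ : (t ≫ biprod.fst) ≫ ξ.i = 0 := by
      have := ht =≫ p
      simpa using this
    have h₂ : (t ≫ biprod.snd) ≫ η.i = 0 := by
      have := ht =≫ q
      simpa using this
    apply biprod.hom_ext
    · rw [(cancel_mono ξ.i).1 (h₁.trans zero_comp.symm), zero_comp]
    · rw [(cancel_mono η.i).1 (h₂.trans zero_comp.symm), zero_comp]
  · intro T t ht
    obtain ⟨a, ha⟩ := conf.lift ξ.conf (t ≫ p) (by rw [Category.assoc, hP.w, ht])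
    obtain ⟨b, hb⟩ := conf.lift η.conf (t ≫ q) (by rw [Category.assoc, ht])
    refine ⟨biprod.lift a b, hP.hom_ext ?_ ?_⟩
    · simp [ha]
    · simp [hb]
  · rintro τ ⟨φ, hφ₁, hφ₂⟩ ⟨ψ, hψ₁, hψ₂⟩
    refine Over.equiv ⟨hP.lift φ ψ (by rw [hφ₂, hψ₂]), ?_, by simp [hψ₂]⟩
    apply hP.hom_ext
    · simp [hφ₁]
    · simp [hψ₁]

lemma pair_unique [HasBinaryBiproducts C] {ω ω' : S.Extension Z (X ⊞ X')} {ξ : S.Extension Z X}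
    {η : S.Extension Z X'} (h₁ : Over biprod.fst ω ξ) (h₂ : Over biprod.snd ω η)
    (h₁' : Over biprod.fst ω' ξ) (h₂' : Over biprod.snd ω' η) : ω ≈ ω' := by
  obtain ⟨τ, -, -, hτ⟩ := exists_pair ξ η
  exact Setoid.trans (hτ ω h₁ h₂) (Setoid.symm (hτ ω' h₁' h₂'))

end Extension

/-- `Ext¹(Z, X)`: equivalence classes of conflations `X ⟶ Y ⟶ Z`. -/
def Ext (Z X : C) := Quotient (Extension.setoid (S := S) Z X)

namespace Ext

variable {S} {X X' X'' Z : C}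

/-- The map `Ext¹(Z, X) → Ext¹(Z, X')` induced by `f : X ⟶ X'` by pushout of conflations. -/
noncomputable def push (f : X ⟶ X') : S.Ext Z X → S.Ext Z X' :=
  Quotient.map (Extension.push f) fun ξ η h =>
    Extension.Over.unique (ξ.over_push f) (by
      have := (Extension.Over.of_equiv h).comp (η.over_push f)
      rwa [Category.id_comp] at this)

lemma push_mk (f : X ⟶ X') {ξ : S.Extension Z X} {η : S.Extension Z X'}
    (h : Extension.Over f ξ η) : push f (⟦ξ⟧ : S.Ext Z X) = ⟦η⟧ :=
  Quotient.sound (Extension.Over.unique (ξ.over_push f) h)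

lemma over_of_push_eq (f : X ⟶ X') {ξ : S.Extension Z X} {η : S.Extension Z X'}
    (h : push f (⟦ξ⟧ : S.Ext Z X) = ⟦η⟧) : Extension.Over f ξ η := by
  have := (ξ.over_push f).comp (Extension.Over.of_equiv (Quotient.exact h))
  rwa [Category.comp_id] at this

lemma push_id (x : S.Ext Z X) : push (𝟙 X) x = x := by
  induction x using Quotient.inductionOn with
  | h ξ => exact push_mk _ (Extension.Over.of_equiv (Setoid.refl _))

lemma push_push (f : X ⟶ X') (g : X' ⟶ X'') (x : S.Ext Z X) :
    push g (push f x) = push (f ≫ g) x := by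
  induction x using Quotient.inductionOn with
  | h ξ =>
    rw [push_mk f (ξ.over_push f), push_mk g ((ξ.push f).over_push g)]
    exact (push_mk _ ((ξ.over_push f).comp ((ξ.push f).over_push g))).symm

variable [HasBinaryBiproducts C]

lemma exists_pair (x : S.Ext Z X) (y : S.Ext Z X') :
    ∃ z : S.Ext Z (X ⊞ X'), push biprod.fst z = x ∧ push biprod.snd z = y := by
  induction x using Quotient.inductionOn with
  | h ξ =>
    induction y using Quotient.inductionOn with
    | h η =>
      obtain ⟨ω, h₁, h₂, -⟩ := Extension.exists_pair ξ η
      exact ⟨⟦ω⟧, push_mk _ h₁, push_mk _ h₂⟩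

lemma pair_ext {z z' : S.Ext Z (X ⊞ X')} (h₁ : push biprod.fst z = push biprod.fst z')
    (h₂ : push biprod.snd z = push biprod.snd z') : z = z' := by
  induction z using Quotient.inductionOn with
  | h ω =>
    induction z' using Quotient.inductionOn with
    | h ω' =>
      rw [push_mk _ (ω'.over_push _)] at h₁ h₂
      exact Quotient.sound (Extension.pair_unique (over_of_push_eq _ h₁) (over_of_push_eq _ h₂)
        (ω'.over_push _) (ω'.over_push _))

/-- The class in `Ext¹(Z, X ⊞ X')` of the fibre product over `Z` of two conflations, i.e. of the
pullback of their direct sum along the diagonal of `Z`. -/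
noncomputable def pair (x : S.Ext Z X) (y : S.Ext Z X') : S.Ext Z (X ⊞ X') :=
  (exists_pair x y).choose

@[simp]
lemma push_fst_pair (x : S.Ext Z X) (y : S.Ext Z X') : push biprod.fst (pair x y) = x :=
  (exists_pair x y).choose_spec.1

@[simp]
lemma push_snd_pair (x : S.Ext Z X) (y : S.Ext Z X') : push biprod.snd (pair x y) = y :=
  (exists_pair x y).choose_spec.2

lemma pair_push_push (f : X ⟶ X') (g : X ⟶ X'') (x : S.Ext Z X) :
    pair (push f x) (push g x) = push (biprod.lift f g) x :=
  pair_ext (by simp [push_push]) (by simp [push_push])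

/-- The split extension `X ⟶ X ⊞ Z ⟶ Z`. -/
noncomputable def split (S : ExactStructure C) (Z X : C) : S.Extension Z X where
  Y := X ⊞ Z
  i := biprod.inl
  d := biprod.snd
  w := biprod.inl_snd
  conf := conf_of_split _ _ biprod.fst biprod.inr _ biprod.inl_fst biprod.inr_snd biprod.total
    biprod.inr_fst

noncomputable instance : Zero (S.Ext Z X) := ⟨⟦split S Z X⟧⟩

/-- The Baer sum: the push-out of the fibre product over `Z` along the codiagonal of `X`. -/
noncomputable instance : Add (S.Ext Z X) := ⟨fun x y => push (biprod.fst + biprod.snd) (pair x y)⟩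

lemma push_zero (x : S.Ext Z X) : push (0 : X ⟶ X') x = 0 := by
  induction x using Quotient.inductionOn with
  | h ξ =>
    refine push_mk (η := split S Z X') _ ⟨biprod.lift 0 ξ.d, ?_, by simp [split]⟩
    apply biprod.hom_ext <;> simp [split, ξ.w]

lemma push_add_left (f g : X ⟶ X') (x : S.Ext Z X) : push (f + g) x = push f x + push g x := by
  change _ = push _ (pair _ _)
  rw [pair_push_push, push_push]
  simp

lemma push_add_right (f : X ⟶ X') (x y : S.Ext Z X) : push f (x + y) = push f x + push f y := by
  change push f (push _ (pair _ _)) = push _ (pair _ _)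
  have : pair (push f x) (push f y) = push (biprod.map f f) (pair x y) := by
    apply pair_ext
    · rw [push_fst_pair, push_push, biprod.map_fst, ← push_push, push_fst_pair]
    · rw [push_snd_pair, push_push, biprod.map_snd, ← push_push, push_snd_pair]
  rw [this, push_push, push_push]
  simp

noncomputable instance : Neg (S.Ext Z X) := ⟨push (-𝟙 X)⟩

noncomputable instance : AddCommGroup (S.Ext Z X) where
  add_assoc x y z := by
    obtain ⟨W, a, b, c, ω, rfl, rfl, rfl⟩ : ∃ (W : C) (a b c : W ⟶ X) (ω : S.Ext Z W),
        push a ω = x ∧ push b ω = y ∧ push c ω = z :=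
      ⟨_, biprod.fst ≫ biprod.fst, biprod.fst ≫ biprod.snd, biprod.snd, pair (pair x y) z,
        by rw [← push_push, push_fst_pair, push_fst_pair],
        by rw [← push_push, push_fst_pair, push_snd_pair], push_snd_pair _ _⟩
    simp only [← push_add_left, add_assoc]
  zero_add x := by
    have := push_add_left 0 (𝟙 X) x
    rwa [zero_add, push_zero, push_id, eq_comm] at this
  add_zero x := by
    have := push_add_left (𝟙 X) 0 x
    rwa [add_zero, push_zero, push_id, eq_comm] at this
  add_comm x y := by
    obtain ⟨W, a, b, ω, rfl, rfl⟩ : ∃ (W : C) (a b : W ⟶ X) (ω : S.Ext Z W),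
        push a ω = x ∧ push b ω = y :=
      ⟨_, biprod.fst, biprod.snd, pair x y, push_fst_pair _ _, push_snd_pair _ _⟩
    simp only [← push_add_left, add_comm]
  neg_add_cancel x := by
    change push (-𝟙 X) x + x = 0
    nth_rw 2 [← push_id x]
    rw [← push_add_left, neg_add_cancel, push_zero]
  nsmul := nsmulRec
  zsmul := zsmulRec

variable {k : Type w} [Field k] [Linear k C]

/-- Scalars act on `Ext¹(Z, X)` through the endomorphisms `c • 𝟙 X` of `X`. -/
noncomputable instance : Module k (S.Ext Z X) where
  smul c x := push (c • 𝟙 X) x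
  one_smul x := by
    change push ((1 : k) • 𝟙 X) x = x
    rw [one_smul, push_id]
  mul_smul a b x := by
    change push ((a * b) • 𝟙 X) x = push (a • 𝟙 X) (push (b • 𝟙 X) x)
    rw [push_push, Linear.smul_comp, Category.id_comp, smul_smul, mul_comm]
  smul_zero a := by
    change push (a • 𝟙 X) (0 : S.Ext Z X) = 0
    rw [← push_zero (0 : S.Ext Z X) (X' := X), push_push, zero_comp]
  smul_add a x y := push_add_right _ _ _
  add_smul a b x := by
    change push ((a + b) • 𝟙 X) x = push (a • 𝟙 X) x + push (b • 𝟙 X) x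
    rw [add_smul, push_add_left]
  zero_smul x := by
    change push ((0 : k) • 𝟙 X) x = 0
    rw [zero_smul, push_zero]

end Ext

/-! ### Fully exact and admissible subcategories -/

/-- A full subcategory is fully exact if it contains the zero objects and is closed under extensions.
(It is then closed under isomorphisms and finite direct sums.) -/
structure IsFullyExact (T : ObjectProperty C) : Prop where
  zero : ∀ X : C, IsZero X → T X
  extension : ∀ K : ShortComplex C, S.conf K → T K.X₁ → T K.X₃ → T K.X₂

section

variable {S} {T : ObjectProperty C}

lemma IsFullyExact.of_iso (hT : S.IsFullyExact T) {X Y : C} (e : X ≅ Y) (hX : T X) : T Y := by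
  have := S.hasZeroObject
  obtain ⟨O, hO⟩ := HasZeroObject.zero (C := C)
  exact hT.extension _ (conf_of_iso (conf_zero (S := S) X O hO) (i' := e.hom) (d' := (0 : Y ⟶ O))
    comp_zero (Iso.refl _) e (Iso.refl _) (by simp) (by simp)) hX (hT.zero _ hO)

lemma IsFullyExact.biprod (hT : S.IsFullyExact T) [HasBinaryBiproducts C] {X Y : C}
    (hX : T X) (hY : T Y) : T (X ⊞ Y) :=
  hT.extension _ (conf_of_split (S := S) (biprod.inl : X ⟶ X ⊞ Y) biprod.snd biprod.fst biprod.inr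
    biprod.inl_snd biprod.inl_fst biprod.inr_snd biprod.total biprod.inr_fst) hX hY

end

/-- The exact structure induced on a fully exact subcategory: its conflations are those of the
ambient category with all three terms in the subcategory. -/
def induced (T : ObjectProperty C) (hT : S.IsFullyExact T) : ExactStructure T.FullSubcategory where
  hasZeroObject := by
    have := S.hasZeroObject
    obtain ⟨O, hO⟩ := HasZeroObject.zero (C := C)
    refine ⟨⟨O, hT.zero O hO⟩, ?_⟩
    rw [IsZero.iff_id_eq_zero]
    exact T.hom_ext (hO.eq_of_src _ _)
  hasBinaryBiproducts := by
    have := S.hasBinaryBiproducts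
    refine ⟨fun X Y => HasBinaryBiproduct.mk ⟨{
      pt := ⟨X.obj ⊞ Y.obj, hT.biprod X.property Y.property⟩
      fst := T.homMk biprod.fst
      snd := T.homMk biprod.snd
      inl := T.homMk biprod.inl
      inr := T.homMk biprod.inr
      inl_fst := T.hom_ext biprod.inl_fst
      inl_snd := T.hom_ext biprod.inl_snd
      inr_fst := T.hom_ext biprod.inr_fst
      inr_snd := T.hom_ext biprod.inr_snd }, isBinaryBilimitOfTotal _ (T.hom_ext biprod.total)⟩⟩
  conf := fun K => S.conf (K.map T.ι)
  isoClosed := ⟨fun e h => by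
    have := S.isoClosed
    exact S.conf.prop_of_iso (T.ι.mapShortComplex.mapIso e) h⟩
  isKernel K h := by
    have h' : S.conf (ShortComplex.mk K.f.hom K.g.hom (congrArg (·.hom) K.zero)) := h
    have := conf.mono h'
    have : Mono K.f := T.ι.mono_of_mono_map (inferInstanceAs (Mono K.f.hom))
    refine ⟨KernelFork.IsLimit.ofι' _ _ fun {A} t ht => Classical.choice ?_⟩
    obtain ⟨s, hs⟩ := conf.lift h' t.hom (congrArg (·.hom) ht)
    exact ⟨⟨T.homMk s, T.hom_ext hs⟩⟩
  isCokernel K h := by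
    have h' : S.conf (ShortComplex.mk K.f.hom K.g.hom (congrArg (·.hom) K.zero)) := h
    have := conf.epi h'
    have : Epi K.g := T.ι.epi_of_epi_map (inferInstanceAs (Epi K.g.hom))
    refine ⟨CokernelCofork.IsColimit.ofπ' _ _ fun {A} t ht => Classical.choice ?_⟩
    obtain ⟨s, hs⟩ := conf.desc h' t.hom (congrArg (·.hom) ht)
    exact ⟨⟨T.homMk s, T.hom_ext hs⟩⟩
  conf_id Z X hZ := S.conf_id Z.obj X.obj (by
    rw [IsZero.iff_id_eq_zero] at hZ ⊢
    exact congrArg (·.hom) hZ)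
  deflation_comp := by
    rintro X Y Z d d' ⟨K, i, w, h⟩ ⟨K', i', w', h'⟩
    have h₁ : S.conf (ShortComplex.mk i.hom d.hom (congrArg (·.hom) w)) := h
    have h₂ : S.conf (ShortComplex.mk i'.hom d'.hom (congrArg (·.hom) w')) := h'
    obtain ⟨P, p, q, j, wj, hP, hjp, hc⟩ := exists_pullback_conf h₁ i'.hom
    have hPT : T P := hT.extension _ hc K.property K'.property
    have hw : p ≫ d.hom ≫ d'.hom = 0 := by
      rw [← Category.assoc, hP.w, Category.assoc,
        show i'.hom ≫ d'.hom = 0 from congrArg (·.hom) w', comp_zero]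
    have := conf.mono h₂
    refine ⟨⟨P, hPT⟩, T.homMk p, T.hom_ext hw, conf_of_deflation (S := S) (i := p)
      (d := d.hom ≫ d'.hom) (w := hw)
      (S.deflation_comp _ _ ⟨_, _, _, h₁⟩ ⟨_, _, _, h₂⟩) ?_ ?_⟩
    · refine ⟨fun a b hab => hP.hom_ext hab ?_⟩
      rw [← cancel_mono i'.hom, Category.assoc, Category.assoc, ← hP.w, ← Category.assoc, hab,
        Category.assoc]
    · intro A t ht
      obtain ⟨s, hs⟩ := conf.lift h₂ (t ≫ d.hom) (by rw [Category.assoc, ht])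
      exact ⟨hP.lift t s hs.symm, by simp⟩
  deflation_pullback := by
    rintro Y Z W d g ⟨K, i, w, h⟩
    have h₁ : S.conf (ShortComplex.mk i.hom d.hom (congrArg (·.hom) w)) := h
    obtain ⟨P, p, q, j, wj, hP, hjp, hc⟩ := exists_pullback_conf h₁ g.hom
    have hPT : T P := hT.extension _ hc K.property W.property
    exact ⟨⟨P, hPT⟩, T.homMk p, T.homMk q, IsPullback.of_map T.ι (T.hom_ext hP.w) hP,
      K, T.homMk j, T.hom_ext wj, hc⟩
  inflation_pushout := by
    rintro X Y W i g ⟨K, d, w, h⟩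
    have h₁ : S.conf (ShortComplex.mk i.hom d.hom (congrArg (·.hom) w)) := h
    obtain ⟨P, p, q, j, wj, hP, hpj, hc⟩ := exists_pushout_conf h₁ g.hom
    have hPT : T P := hT.extension _ hc W.property K.property
    exact ⟨⟨P, hPT⟩, T.homMk p, T.homMk q, IsPushout.of_map T.ι (T.hom_ext hP.w) hP,
      K, T.homMk j, T.hom_ext wj, hc⟩

/-- The right perpendicular subcategory `P^⊥`: the objects `E` with
`Hom(X, E) = 0 = Ext¹(X, E)` for all `X` in `P`. -/
def rightPerp (P : ObjectProperty C) : ObjectProperty C := fun E =>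
  ∀ X : C, P X → Subsingleton (X ⟶ E) ∧ Subsingleton (S.Ext X E)

/-- A torsion pair `(T, F)` of fully exact subcategories. -/
structure IsTorsionPair (T F : ObjectProperty C) : Prop where
  left : S.IsFullyExact T
  right : S.IsFullyExact F
  hom_eq_zero : ∀ {X Y : C} (f : X ⟶ Y), T X → F Y → f = 0
  exists_conf : ∀ E : C, ∃ (X Y : C) (i : X ⟶ E) (d : E ⟶ Y) (w : i ≫ d = 0),
    S.conf (ShortComplex.mk i d w) ∧ T X ∧ F Y

/-- A subcategory `T` is right admissible if `(T, T^⊥)` is a torsion pair. -/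
def IsRightAdmissible (T : ObjectProperty C) : Prop := S.IsTorsionPair T (S.rightPerp T)

/-- The smallest fully exact subcategory containing `P`. -/
def extClosure (P : ObjectProperty C) : ObjectProperty C := fun X =>
  ∀ T : ObjectProperty C, S.IsFullyExact T → P ≤ T → T X

lemma isFullyExact_extClosure (P : ObjectProperty C) : S.IsFullyExact (S.extClosure P) where
  zero X hX _ hT _ := hT.zero X hX
  extension K hK h₁ h₃ T hT hP := hT.extension K hK (h₁ T hT hP) (h₃ T hT hP)

/-! ### Thin categories and their canonical posets -/

section

variable (k : Type w) [Field k] [Linear k C]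

/-- A right admissible filtration `0 = T₀ ⊂ T₁ ⊂ ⋯ ⊂ Tₙ = C` whose graded factors
`Tᵢ₋₁^⊥ ∩ Tᵢ` are `k`-linearly equivalent to the category of finite dimensional vector spaces. -/
structure IsThinFiltration {n : ℕ} (T : Fin (n + 1) → ObjectProperty C) : Prop where
  monotone : Monotone T
  admissible : ∀ i, S.IsRightAdmissible (T i)
  bot : ∀ X : C, T 0 X ↔ IsZero X
  top : ∀ X : C, T (Fin.last n) X
  graded : ∀ i : Fin n,
    ∃ e : (S.rightPerp (T i.castSucc) ⊓ T i.succ).FullSubcategory ≌ FGModuleCat.{w} k,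
      e.functor.Additive ∧ e.functor.Linear k

/-- A thin category: a `k`-linear exact category, `Hom`-finite and `Ext¹`-finite, which admits a
thin filtration. -/
structure IsThin : Prop where
  hom_finite : ∀ X Y : C, Module.Finite k (X ⟶ Y)
  ext_finite : haveI := S.hasBinaryBiproducts
    ∀ X Y : C, Module.Finite k (S.Ext X Y)
  exists_filtration : ∃ (n : ℕ) (T : Fin (n + 1) → ObjectProperty C), S.IsThinFiltration k T

end

/-- A nonzero object `E` is irreducible if any inflation `A ⟶ E` is zero or an isomorphism. -/
def irreducible : ObjectProperty C := fun E =>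
  ¬ IsZero E ∧ ∀ (A : C) (f : A ⟶ E), S.IsInflation f → f = 0 ∨ IsIso f

/-- The set `Λ` of isomorphism classes of irreducible objects. -/
def Irr : Type u := Quotient (isIsomorphicSetoid S.irreducible.FullSubcategory)

/-- The isomorphism class of an irreducible object. -/
def irrClass (E : C) (h : S.irreducible E) : S.Irr :=
  Quotient.mk (isIsomorphicSetoid S.irreducible.FullSubcategory) ⟨E, h⟩

/-- The canonical order `i ≼ j` on `Λ`: the smallest reflexive and transitive relation such that
`i ≼ j` whenever `Eᵢ ∉ Eⱼ^⊥`, where `Eᵢ` and `Eⱼ` are irreducible objects in the classes `i`, `j`. -/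
def canonicalLE : S.Irr → S.Irr → Prop :=
  Relation.ReflTransGen fun i j => ∃ (E E' : C) (h : S.irreducible E) (h' : S.irreducible E'),
    S.irrClass E h = i ∧ S.irrClass E' h' = j ∧ ¬ S.rightPerp (ObjectProperty.singleton E') E

/-- The fully exact subcategory generated by the irreducible objects with class in `I`. -/
def generatedBy (I : Set S.Irr) : ObjectProperty C :=
  S.extClosure fun E => ∃ h : S.irreducible E, S.irrClass E h ∈ I

/-- The subcategory `T_l`, generated by the irreducible objects whose class `m` does not satisfy
`l ≼ m` (these classes form a lower ideal of `Λ`). -/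
def torsion (l : S.Irr) : ObjectProperty C := S.generatedBy {m | ¬ S.canonicalLE l m}

lemma isFullyExact_torsion (l : S.Irr) : S.IsFullyExact (S.torsion l) :=
  S.isFullyExact_extClosure _

/-! ### Right abelian envelopes -/

/-- An additive functor `F` to an abelian category is right exact if
`F X ⟶ F Y ⟶ F Z ⟶ 0` is exact for all conflations `X ⟶ Y ⟶ Z`. -/
def rightExact (B : Type u') [Category.{v'} B] [Abelian B] : ObjectProperty (C ⥤ B) := fun F =>
  ∃ _ : F.Additive, ∀ K : ShortComplex C, S.conf K → (K.map F).Exact ∧ Epi (F.map K.g)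

lemma rightExact_comp {A : Type u'} [Category.{v'} A] [Abelian A] {B : Type w} [Category.{v'} B]
    [Abelian B] {i : C ⥤ A} (hi : S.rightExact A i) {G : A ⥤ B}
    (hG : (ofAbelian A).rightExact B G) : S.rightExact B (i ⋙ G) := by
  obtain ⟨_, hi⟩ := hi
  obtain ⟨_, hG⟩ := hG
  refine ⟨inferInstance, fun K hK => ?_⟩
  have h := (Functor.preservesFiniteColimits_tfae G).out 0 1
  exact h.1 hG (K.map i) (hi K hK)

/-- The functor `Rex(A, B) ⥤ Rex(C, B)` of composition with a right exact functor `i : C ⥤ A`. -/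
def precomp {A : Type u'} [Category.{v'} A] [Abelian A] (i : C ⥤ A) (hi : S.rightExact A i)
    (B : Type w) [Category.{v'} B] [Abelian B] :
    ((ofAbelian A).rightExact B).FullSubcategory ⥤ (S.rightExact B).FullSubcategory :=
  (S.rightExact B).lift
    (((ofAbelian A).rightExact B).ι ⋙ (Functor.whiskeringLeft C A B).obj i)
    fun G => S.rightExact_comp hi G.property

/-- A right exact functor `i : C ⥤ A` to an abelian category is a right abelian envelope of `C` if
composition with `i` is an equivalence `Rex(A, B) ⥤ Rex(C, B)` for all abelian categories `B`. -/
structure IsRightEnvelope {A : Type u'} [Category.{v'} A] [Abelian A] (i : C ⥤ A) : Prop where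
  rightExact : S.rightExact A i
  isEquivalence : ∀ (B : Type u') [Category.{v'} B] [Abelian B],
    (S.precomp i rightExact B).IsEquivalence

/-- The category `C` has a right abelian envelope. -/
def HasRightEnvelope : Prop :=
  ∃ (A : Type u') (_ : Category.{v'} A) (_ : Abelian A) (i : C ⥤ A), S.IsRightEnvelope i

end ExactStructure

end

/-!
The objects of a thin category `E` are built, by iterated extensions, from the irreducible objects
`D l`, which behave like the standard objects of a highest weight category (`IsExceptional`): `D l` has
scalar endomorphisms and no self-extensions, and `Hom(D l, D m)` and `Ext¹(D l, D m)` vanish unless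
`m ≤ l`. The irreducible objects lie in different steps of a thin filtration, which makes the canonical
relation antisymmetric and the canonical poset finite (`IsThin.exists_rank`). If `I` is a lower set, the
objects generated by the `D l` with `l ∈ I` form a right admissible subcategory, the complementary part
being generated by the other `D l` (`IsExceptional.isRightAdmissible_filt`).

Universal extensions show that these subcategories have projective generators, which are projective in
all of `E` (`IsExceptional.exists_proj_generator`). For an exact category with a projective generator `P`
with Noetherian endomorphism ring, the functor `Hom(P, -)` to finitely generated modules over
`(End P)ᵐᵒᵖ` is a right abelian envelope, because right exact functors on either side are the same as
additive functors on the projective objects (`IsProjectiveModel.isRightEnvelope`). By uniqueness, any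
envelope is fully faithful, preserves projective objects, and is covered by their images
(`IsProjGenerator.isProjectiveModel_of_isRightEnvelope`).

Therefore the envelope of the subcategory generated by a lower set `I` embeds into the envelope `A` of
`E` as the category of objects presented by the projective objects generated by `I`, and the right adjoint
exists and is the coreflection to these objects (`IsProjectiveModel.isLeftAdjoint`,
`IsProjectiveModel.isCoref_counit`). If `X` is an object of `E`, its coreflection is the inflation of its
torsion part, and in particular a monomorphism. Conversely, let `X_I ⟶ X` be the coreflection of an object
`X` of `A` along `I`. If `l` is minimal in the complement of `I`, and `J` is `I` together with `l`, then
the cokernel of `X_I ⟶ X_J` is a sum of copies of `D l`, and its kernel is a quotient of such a sum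
(`exists_iso_cokernel`, `exists_epi_kernel`; Schanuel's lemma is used for both). Assume that `X_I ⟶ X` is
a monomorphism for all sets `I` of the form `{m | ¬ l ≤ m}`. Then it is so for all lower sets `I`, by
descending induction: if the complement of `I` has only one minimal element, `I` is of this form, and
otherwise the kernel of `X_I ⟶ X` is a quotient of sums of copies of both `D l` and `D m` for two
incomparable elements `l` and `m`, hence zero (`mono_of_isCoref`). So `X` is an iterated extension of sums
of copies of the `D l`, and `E` is closed under extensions in `A` (`essImage_of_isCoref`).
-/

namespace ExactStructure

/-! ### Conflations -/

section

variable {C : Type u} [Category.{v} C] [Preadditive C] (S : ExactStructure C)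

/-- The pair of morphisms `i : X ⟶ Y`, `d : Y ⟶ Z` is a conflation; the equation `i ≫ d = 0` is
part of the property. -/
def IsConf {X Y Z : C} (i : X ⟶ Y) (d : Y ⟶ Z) : Prop :=
  ∃ w : i ≫ d = 0, S.conf (ShortComplex.mk i d w)

variable {S} {X Y Z : C} {i : X ⟶ Y} {d : Y ⟶ Z}

lemma IsConf.w (h : S.IsConf i d) : i ≫ d = 0 := h.1

lemma IsConf.mono (h : S.IsConf i d) : Mono i := conf.mono h.2

lemma IsConf.epi (h : S.IsConf i d) : Epi d := conf.epi h.2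

lemma IsConf.lift (h : S.IsConf i d) {T : C} (t : T ⟶ Y) (ht : t ≫ d = 0) :
    ∃ s : T ⟶ X, s ≫ i = t := conf.lift h.2 t ht

lemma IsConf.desc (h : S.IsConf i d) {T : C} (t : Y ⟶ T) (ht : i ≫ t = 0) :
    ∃ s : Z ⟶ T, d ≫ s = t := conf.desc h.2 t ht

lemma IsConf.inflation (h : S.IsConf i d) : S.IsInflation i := ⟨_, _, _, h.2⟩

lemma IsConf.deflation (h : S.IsConf i d) : S.IsDeflation d := ⟨_, _, _, h.2⟩

lemma IsInflation.exists_isConf (h : S.IsInflation i) : ∃ (Z : C) (d : Y ⟶ Z), S.IsConf i d := by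
  obtain ⟨Z, d, w, h⟩ := h
  exact ⟨Z, d, w, h⟩

lemma IsDeflation.exists_isConf (h : S.IsDeflation d) : ∃ (X : C) (i : X ⟶ Y), S.IsConf i d := by
  obtain ⟨Z, d, w, h⟩ := h
  exact ⟨Z, d, w, h⟩

lemma IsConf.pullback (h : S.IsConf i d) {W : C} (f : W ⟶ Z) :
    ∃ (P : C) (p : P ⟶ Y) (q : P ⟶ W) (j : X ⟶ P),
      IsPullback p q d f ∧ j ≫ p = i ∧ S.IsConf j q := by
  obtain ⟨P, p, q, j, w, h₁, h₂, h₃⟩ := exists_pullback_conf h.2 f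
  exact ⟨P, p, q, j, h₁, h₂, w, h₃⟩

lemma IsConf.pushout (h : S.IsConf i d) {W : C} (f : X ⟶ W) :
    ∃ (P : C) (p : Y ⟶ P) (q : W ⟶ P) (j : P ⟶ Z),
      IsPushout i f p q ∧ p ≫ j = d ∧ S.IsConf q j := by
  obtain ⟨P, p, q, j, w, h₁, h₂, h₃⟩ := exists_pushout_conf h.2 f
  exact ⟨P, p, q, j, h₁, h₂, w, h₃⟩

lemma IsConf.of_iso (h : S.IsConf i d) {X' Y' Z' : C} {i' : X' ⟶ Y'} {d' : Y' ⟶ Z'}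
    (a : X ≅ X') (b : Y ≅ Y') (c : Z ≅ Z')
    (h₁ : a.hom ≫ i' = i ≫ b.hom) (h₂ : b.hom ≫ d' = d ≫ c.hom) : S.IsConf i' d' := by
  have w' : i' ≫ d' = 0 := by
    rw [← cancel_epi a.hom, ← Category.assoc, h₁, Category.assoc, h₂, ← Category.assoc, h.w]
    simp
  exact ⟨w', conf_of_iso h.2 w' a b c h₁ h₂⟩

lemma isConf_of_deflation (hd : S.IsDeflation d) (w : i ≫ d = 0) (hi : Mono i)
    (hl : ∀ (T : C) (t : T ⟶ Y), t ≫ d = 0 → ∃ s : T ⟶ X, s ≫ i = t) : S.IsConf i d :=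
  ⟨w, conf_of_deflation hd hi hl⟩

lemma isConf_of_inflation (hi : S.IsInflation i) (w : i ≫ d = 0) (hd : Epi d)
    (hl : ∀ (T : C) (t : Y ⟶ T), i ≫ t = 0 → ∃ s : Z ⟶ T, d ≫ s = t) : S.IsConf i d :=
  ⟨w, conf_of_inflation hi hd hl⟩

lemma isConf_of_split (r : Y ⟶ X) (s : Z ⟶ Y) (w : i ≫ d = 0)
    (hir : i ≫ r = 𝟙 X) (hsd : s ≫ d = 𝟙 Z) (hid : r ≫ i + d ≫ s = 𝟙 Y) (hsr : s ≫ r = 0) :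
    S.IsConf i d :=
  ⟨w, conf_of_split i d r s w hir hsd hid hsr⟩

lemma isConf_id_zero (X Z : C) (hZ : IsZero Z) : S.IsConf (𝟙 X) (0 : X ⟶ Z) :=
  ⟨_, conf_zero X Z hZ⟩

lemma isConf_zero_id (Z X : C) (hZ : IsZero Z) : S.IsConf (0 : Z ⟶ X) (𝟙 X) :=
  ⟨_, S.conf_id Z X hZ⟩

lemma isConf_inl_snd (S : ExactStructure C) [HasBinaryBiproducts C] (X Z : C) :
    S.IsConf (biprod.inl : X ⟶ X ⊞ Z) biprod.snd :=
  isConf_of_split biprod.fst biprod.inr biprod.inl_snd biprod.inl_fst biprod.inr_snd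
    biprod.total biprod.inr_fst

/-- A retraction of the inflation of a conflation is the deflation of a conflation in the other
direction. -/
lemma IsConf.swap (h : S.IsConf i d) (r : Y ⟶ X) (hr : i ≫ r = 𝟙 X) :
    ∃ s : Z ⟶ Y, s ≫ d = 𝟙 Z ∧ S.IsConf s r := by
  have := h.epi
  have := h.mono
  obtain ⟨s, hs⟩ := h.desc (𝟙 Y - r ≫ i) (by
    rw [Preadditive.comp_sub, Category.comp_id, ← Category.assoc, hr, Category.id_comp, sub_self])
  have hsd : s ≫ d = 𝟙 Z := by
    rw [← cancel_epi d, ← Category.assoc, hs, Preadditive.sub_comp, Category.assoc, h.w]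
    simp
  have hsr : s ≫ r = 0 := by
    rw [← cancel_epi d, ← Category.assoc, hs, Preadditive.sub_comp, Category.assoc, hr]
    simp
  exact ⟨s, hsd, isConf_of_split d i hsr hsd hr (by rw [hs]; abel) h.w⟩

lemma IsConf.exists_retraction (h : S.IsConf i d) (s : Z ⟶ Y) (hs : s ≫ d = 𝟙 Z) :
    ∃ r : Y ⟶ X, i ≫ r = 𝟙 X ∧ s ≫ r = 0 := by
  have := h.mono
  obtain ⟨r, hr⟩ := h.lift (𝟙 Y - d ≫ s) (by
    rw [Preadditive.sub_comp, Category.assoc, hs]; simp)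
  refine ⟨r, ?_, ?_⟩
  · rw [← cancel_mono i, Category.assoc, hr, Preadditive.comp_sub, ← Category.assoc, h.w]
    simp
  · rw [← cancel_mono i, Category.assoc, hr, Preadditive.comp_sub, ← Category.assoc, hs]
    simp

lemma isDeflation_of_iso_comp {Y' : C} (e : Y' ⟶ Y) [IsIso e] (hd : S.IsDeflation d) :
    S.IsDeflation (e ≫ d) := by
  obtain ⟨X, i, h⟩ := IsDeflation.exists_isConf hd
  exact IsConf.deflation (h.of_iso (i' := i ≫ inv e) (Iso.refl _) (asIso e).symm (Iso.refl _)
    (by simp) (by simp))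

lemma isDeflation_of_isPullback {P W : C} {p : P ⟶ Y} {q : P ⟶ W} {f : W ⟶ Z}
    (hP : IsPullback p q d f) (hd : S.IsDeflation d) : S.IsDeflation q := by
  obtain ⟨P', p', q', hP', hq'⟩ := S.deflation_pullback d f hd
  have := isDeflation_of_iso_comp (hP.isoIsPullback _ _ hP').hom hq'
  rwa [IsPullback.isoIsPullback_hom_snd] at this

lemma isInflation_of_isPushout {P W : C} {p : Y ⟶ P} {q : W ⟶ P} {f : X ⟶ W}
    (hP : IsPushout i f p q) (hi : S.IsInflation i) : S.IsInflation q := by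
  obtain ⟨P', p', q', hP', hq'⟩ := S.inflation_pushout i f hi
  obtain ⟨Z, d, h⟩ := IsInflation.exists_isConf hq'
  exact IsConf.inflation (h.of_iso (d' := (hP'.isoIsPushout _ _ hP).inv ≫ d) (Iso.refl _)
    (hP'.isoIsPushout _ _ hP) (Iso.refl _) (by simp) (by simp))

/-- Composites of inflations are inflations: if `i` and `j` are composable inflations, then the
pushout of `j` along the cokernel `d` of `i` gives a cokernel of `i ≫ j`. Keller's axioms only state
the dual fact. -/
lemma IsConf.comp_inflation (h : S.IsConf i d) {V B : C} {j : Y ⟶ B} {e : B ⟶ V}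
    (h' : S.IsConf j e) :
    ∃ (B' : C) (p : B ⟶ B') (j' : Z ⟶ B') (e' : B' ⟶ V),
      S.IsConf (i ≫ j) p ∧ S.IsConf j' e' ∧ j ≫ p = d ≫ j' ∧ p ≫ e' = e := by
  have := S.hasBinaryBiproducts
  have := h.epi
  have := h.mono
  have := h'.mono
  obtain ⟨P, p, j', e', hP, hpe, hc⟩ := h'.pushout d
  have hjp : j ≫ p = d ≫ j' := hP.w
  have hepi : Epi p := by
    refine Preadditive.epi_of_cancel_zero _ fun {T} t ht => hP.hom_ext (by simp [ht]) ?_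
    rw [← cancel_epi d, ← Category.assoc, ← hjp, Category.assoc, ht]
    simp
  have hdesc : ∀ (T : C) (t : B ⟶ T), (i ≫ j) ≫ t = 0 → ∃ s : P ⟶ T, p ≫ s = t := by
    intro T t ht
    obtain ⟨a, ha⟩ := h.desc (j ≫ t) (by rw [← Category.assoc, ht])
    exact ⟨hP.desc t a ha.symm, by simp⟩
  have hlift : ∀ (T : C) (t : T ⟶ B), t ≫ p = 0 → ∃ s : T ⟶ X, s ≫ i ≫ j = t := by
    intro T t ht
    have := hc.mono
    obtain ⟨s, rfl⟩ := h'.lift t (by rw [← hpe, ← Category.assoc, ht, zero_comp])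
    obtain ⟨r, rfl⟩ := h.lift s (by
      rw [← cancel_mono j', Category.assoc, ← hjp, ← Category.assoc, ht, zero_comp])
    exact ⟨r, by simp⟩
  -- `desc j' p : Z ⊞ B ⟶ P` is a deflation: it is the pullback of `e` along `e'`, up to an
  -- isomorphism.
  have hdefl : S.IsDeflation (biprod.desc j' p : Z ⊞ B ⟶ P) := by
    have hpb : IsPullback (biprod.snd : Z ⊞ B ⟶ B) (biprod.desc j' p) e e' := by
      have := hc.mono
      have hu (s : PullbackCone e e') : ∃ u : s.pt ⟶ Z, u ≫ j' = s.snd - s.fst ≫ p :=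
        hc.lift _ (by rw [Preadditive.sub_comp, Category.assoc, hpe, s.condition, sub_self])
      choose u hu using hu
      refine ⟨⟨by ext <;> simp [hc.w, hpe]⟩, ⟨PullbackCone.IsLimit.mk _
        (fun s => biprod.lift (u s) s.fst)
        (fun s => by simp) (fun s => ?_) (fun s m h₁ h₂ => ?_)⟩⟩
      · rw [biprod.lift_desc, hu]
        abel
      · refine biprod.hom_ext _ _ ?_ (by simp [h₁])
        rw [biprod.lift_fst, ← cancel_mono j', hu, ← h₁, ← h₂, biprod.desc_eq]
        simp
    exact isDeflation_of_isPullback hpb h'.deflation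
  have hmap : S.IsDeflation (biprod.map d (𝟙 B)) := by
    refine isDeflation_of_isPullback (p := (biprod.fst : Y ⊞ B ⟶ Y)) (f := biprod.fst) ?_
      h.deflation
    refine ⟨⟨by simp⟩, ⟨PullbackCone.IsLimit.mk _
      (fun s => biprod.lift s.fst (s.snd ≫ biprod.snd)) (fun s => by simp) (fun s => ?_)
      (fun s m h₁ h₂ => ?_)⟩⟩
    · ext
      · simp [s.condition]
      · simp
    · ext
      · simp [h₁]
      · simp [← h₂]
  -- Composing and shearing, `snd ≫ p : Y ⊞ B ⟶ P` is a deflation.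
  have hsnd : S.IsDeflation ((biprod.snd : Y ⊞ B ⟶ B) ≫ p) := by
    have hσ : IsIso (biprod.desc (biprod.lift (𝟙 Y) (-j)) biprod.inr : Y ⊞ B ⟶ Y ⊞ B) :=
      ⟨biprod.desc (biprod.lift (𝟙 Y) j) biprod.inr,
        by ext <;> simp, by ext <;> simp⟩
    have := isDeflation_of_iso_comp (biprod.desc (biprod.lift (𝟙 Y) (-j)) biprod.inr)
      (S.deflation_comp _ _ hmap hdefl)
    convert this using 1
    ext
    · simp [biprod.lift_eq, hjp]
    · simp
  have hk : S.IsConf (biprod.map (𝟙 Y) (i ≫ j)) ((biprod.snd : Y ⊞ B ⟶ B) ≫ p) := by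
    refine isConf_of_deflation hsnd ?_ ⟨fun a b hab => ?_⟩ ?_
    · ext
      · simp
      · simp [hjp, reassoc_of% h.w]
    · have h₁ := hab =≫ biprod.fst
      have h₂ := hab =≫ biprod.snd
      simp only [Category.assoc, biprod.map_fst, biprod.map_snd, Category.comp_id] at h₁ h₂
      refine biprod.hom_ext _ _ h₁ ?_
      rw [← cancel_mono (i ≫ j)]
      simpa using h₂
    · intro T t ht
      obtain ⟨s, hs⟩ := hlift T (t ≫ biprod.snd) (by simpa using ht)
      exact ⟨biprod.lift (t ≫ biprod.fst) s, by ext <;> simp [hs]⟩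
  -- `i ≫ j` is the pushout along `snd` of the kernel of this deflation
  have hpo : IsPushout (biprod.map (𝟙 Y) (i ≫ j)) (biprod.snd : Y ⊞ X ⟶ X)
      (biprod.snd : Y ⊞ B ⟶ B) (i ≫ j) := by
    refine ⟨⟨by simp⟩, ⟨PushoutCocone.IsColimit.mk _ (fun s => biprod.inr ≫ s.inl)
      (fun s => ?_) (fun s => ?_) (fun s m h₁ h₂ => ?_)⟩⟩
    · ext
      · have := biprod.inl ≫= s.condition
        simp at this
        simp [this]
      · simp
    · have := biprod.inr ≫= s.condition
      simpa using this
    · simp [← h₁]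
  refine ⟨P, p, j', e', isConf_of_inflation (isInflation_of_isPushout hpo hk.inflation) ?_ hepi
    hdesc, hc, hjp, hpe⟩
  rw [Category.assoc, hjp, ← Category.assoc, h.w, zero_comp]

/-- The pullback `N` of a conflation along an inflation `j` is the kernel of the composite with the
cokernel `g` of `j`. -/
lemma IsConf.comp_deflation (h : S.IsConf i d) {X₁ X₃ : C} {j : X₁ ⟶ Z} {g : Z ⟶ X₃}
    (h' : S.IsConf j g) :
    ∃ (N : C) (a : X ⟶ N) (n : N ⟶ Y) (q : N ⟶ X₁),
      S.IsConf a q ∧ S.IsConf n (d ≫ g) ∧ a ≫ n = i ∧ n ≫ d = q ≫ j := by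
  obtain ⟨N, n, q, a, hP, han, hc⟩ := h.pullback j
  have := h'.mono
  refine ⟨N, a, n, q, hc, isConf_of_deflation (S.deflation_comp _ _ h.deflation h'.deflation)
    ?_ ⟨fun s t hst => hP.hom_ext hst ?_⟩ ?_, han, hP.w⟩
  · rw [← Category.assoc, hP.w, Category.assoc, h'.w, comp_zero]
  · rw [← cancel_mono j, Category.assoc, Category.assoc, ← hP.w, ← Category.assoc, hst,
      Category.assoc]
  · intro T t ht
    obtain ⟨s, hs⟩ := h'.lift (t ≫ d) (by rw [Category.assoc, ht])
    exact ⟨hP.lift t s hs.symm, by simp⟩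

end

/-! ### Orthogonality -/

section

variable {C : Type u} [Category.{v} C] [Preadditive C] (S : ExactStructure C)

/-- `Ext¹(Z, X) = 0`, in the form: morphisms to `X` extend along inflations with cokernel `Z`. -/
def ExtZero (Z X : C) : Prop :=
  ∀ ⦃A B : C⦄ (i : A ⟶ B) (d : B ⟶ Z), S.IsConf i d → ∀ f : A ⟶ X, ∃ g : B ⟶ X, i ≫ g = f

/-- `Hom(X, Y) = 0 = Ext¹(X, Y)`. -/
def Perp (X Y : C) : Prop := (∀ f : X ⟶ Y, f = 0) ∧ S.ExtZero X Y

variable {S}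

lemma extZero_iff_retraction {Z X : C} : S.ExtZero Z X ↔
    ∀ ⦃B : C⦄ (i : X ⟶ B) (d : B ⟶ Z), S.IsConf i d → ∃ r : B ⟶ X, i ≫ r = 𝟙 X := by
  refine ⟨fun h B i d hc => h i d hc (𝟙 X), fun h A B i d hc f => ?_⟩
  obtain ⟨P, p, q, j, hP, -, hc'⟩ := hc.pushout f
  obtain ⟨r, hr⟩ := h _ _ hc'
  exact ⟨p ≫ r, by rw [← Category.assoc, hP.w, Category.assoc, hr, Category.comp_id]⟩

lemma extZero_iff_section {Z X : C} : S.ExtZero Z X ↔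
    ∀ ⦃B : C⦄ (i : X ⟶ B) (d : B ⟶ Z), S.IsConf i d → ∃ s : Z ⟶ B, s ≫ d = 𝟙 Z := by
  rw [extZero_iff_retraction]
  refine ⟨fun h B i d hc => ?_, fun h B i d hc => ?_⟩
  · obtain ⟨r, hr⟩ := h i d hc
    obtain ⟨s, hs, -⟩ := hc.swap r hr
    exact ⟨s, hs⟩
  · obtain ⟨s, hs⟩ := h i d hc
    obtain ⟨r, hr, -⟩ := hc.exists_retraction s hs
    exact ⟨r, hr⟩

lemma extZero_iff_lift {Z X : C} : S.ExtZero Z X ↔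
    ∀ ⦃B V : C⦄ (i : X ⟶ B) (d : B ⟶ V), S.IsConf i d → ∀ f : Z ⟶ V, ∃ g : Z ⟶ B, g ≫ d = f := by
  rw [extZero_iff_section]
  refine ⟨fun h B V i d hc f => ?_, fun h B i d hc => h i d hc (𝟙 Z)⟩
  obtain ⟨P, p, q, j, hP, -, hc'⟩ := hc.pullback f
  obtain ⟨s, hs⟩ := h _ _ hc'
  exact ⟨s ≫ p, by rw [Category.assoc, hP.w, ← Category.assoc, hs, Category.id_comp]⟩

lemma extZero_iff_subsingleton {Z X : C} : S.ExtZero Z X ↔ Subsingleton (S.Ext Z X) := by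
  have := S.hasBinaryBiproducts
  rw [extZero_iff_section]
  refine ⟨fun h => ⟨?_⟩, fun h B i d hc => ?_⟩
  · have key (x : S.Ext Z X) : x = 0 := by
      induction x using Quotient.inductionOn with
      | h ξ =>
        obtain ⟨s, hs⟩ := h ξ.i ξ.d ⟨ξ.w, ξ.conf⟩
        refine (Quotient.sound (Extension.Over.equiv (ξ := Ext.split S Z X)
          ⟨biprod.desc ξ.i s, ?_, ?_⟩)).symm
        · simp [Ext.split]
        · refine biprod.hom_ext' _ _ ?_ ?_ <;> simp [Ext.split, ξ.w, hs]
    intro x y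
    rw [key x, key y]
  · obtain ⟨e, -, he⟩ := Quotient.exact (h.elim
      (⟦Ext.split S Z X⟧ : S.Ext Z X) ⟦⟨B, i, d, hc.1, hc.2⟩⟧)
    let f : X ⊞ Z ⟶ B := e.hom
    have hf : f ≫ d = biprod.snd := he
    exact ⟨biprod.inr ≫ f, by rw [Category.assoc, hf, biprod.inr_snd]⟩

lemma ExtZero.of_isZero_left {Z X : C} (hZ : IsZero Z) : S.ExtZero Z X :=
  extZero_iff_section.2 fun _ _ _ _ => ⟨0, hZ.eq_of_src _ _⟩

lemma ExtZero.of_isZero_right {Z X : C} (hX : IsZero X) : S.ExtZero Z X :=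
  extZero_iff_retraction.2 fun _ _ _ _ => ⟨0, hX.eq_of_src _ _⟩

lemma ExtZero.extension_left {X₁ X₂ X₃ Y : C} {i : X₁ ⟶ X₂} {d : X₂ ⟶ X₃} (h : S.IsConf i d)
    (h₁ : S.ExtZero X₁ Y) (h₃ : S.ExtZero X₃ Y) : S.ExtZero X₂ Y := by
  intro A B j e hc f
  obtain ⟨N, a, n, q, haq, hn, han, -⟩ := hc.comp_deflation h
  obtain ⟨g, hg⟩ := h₁ a q haq f
  obtain ⟨g', hg'⟩ := h₃ n _ hn g
  exact ⟨g', by rw [← han, Category.assoc, hg', hg]⟩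

lemma ExtZero.extension_right {Z Y₁ Y₂ Y₃ : C} {i : Y₁ ⟶ Y₂} {d : Y₂ ⟶ Y₃} (h : S.IsConf i d)
    (h₁ : S.ExtZero Z Y₁) (h₃ : S.ExtZero Z Y₃) : S.ExtZero Z Y₂ := by
  rw [extZero_iff_lift] at *
  intro B V j e hc f
  obtain ⟨B', p, j', e', hp, hj', -, hpe⟩ := h.comp_inflation hc
  obtain ⟨g, hg⟩ := h₃ j' e' hj' f
  obtain ⟨g', hg'⟩ := h₁ _ p hp g
  exact ⟨g', by rw [← hpe, ← Category.assoc, hg', hg]⟩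

lemma rightPerp_iff {P : ObjectProperty C} {Y : C} :
    S.rightPerp P Y ↔ ∀ X, P X → S.Perp X Y := by
  refine forall₂_congr fun X _ => ?_
  rw [← extZero_iff_subsingleton]
  exact and_congr_left fun _ => ⟨fun h f => Subsingleton.elim _ _,
    fun h => ⟨fun f g => (h f).trans (h g).symm⟩⟩

lemma isFullyExact_perp_left (Y : C) : S.IsFullyExact fun X => S.Perp X Y where
  zero X hX := ⟨fun _ => hX.eq_of_src _ _, .of_isZero_left hX⟩
  extension K hK h₁ h₃ := by
    have hc : S.IsConf K.f K.g := ⟨K.zero, hK⟩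
    refine ⟨fun f => ?_, .extension_left hc h₁.2 h₃.2⟩
    obtain ⟨g, rfl⟩ := hc.desc f (h₁.1 _)
    rw [h₃.1 g, comp_zero]

lemma isFullyExact_perp_right (X : C) : S.IsFullyExact fun Y => S.Perp X Y where
  zero Y hY := ⟨fun _ => hY.eq_of_tgt _ _, .of_isZero_right hY⟩
  extension K hK h₁ h₃ := by
    have hc : S.IsConf K.f K.g := ⟨K.zero, hK⟩
    refine ⟨fun f => ?_, .extension_right hc h₁.2 h₃.2⟩
    obtain ⟨g, rfl⟩ := hc.lift f (h₃.1 _)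
    rw [h₁.1 g, zero_comp]

lemma isFullyExact_extZero_left (Y : C) : S.IsFullyExact fun X => S.ExtZero X Y where
  zero _ hX := .of_isZero_left hX
  extension K hK h₁ h₃ := .extension_left ⟨K.zero, hK⟩ h₁ h₃

lemma isFullyExact_extZero_right (X : C) : S.IsFullyExact fun Y => S.ExtZero X Y where
  zero _ hY := .of_isZero_right hY
  extension K hK h₁ h₃ := .extension_right ⟨K.zero, hK⟩ h₁ h₃

lemma isFullyExact_rightPerp (P : ObjectProperty C) : S.IsFullyExact (S.rightPerp P) where
  zero Y hY := rightPerp_iff.2 fun X _ => (isFullyExact_perp_right X).zero Y hY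
  extension K hK h₁ h₃ := rightPerp_iff.2 fun X hX => (isFullyExact_perp_right X).extension K hK
    (rightPerp_iff.1 h₁ X hX) (rightPerp_iff.1 h₃ X hX)

lemma IsFullyExact.of_isConf {T : ObjectProperty C} (hT : S.IsFullyExact T) {X Y Z : C} {i : X ⟶ Y}
    {d : Y ⟶ Z} (h : S.IsConf i d) (hX : T X) (hZ : T Z) : T Y :=
  hT.extension _ h.2 hX hZ

lemma le_extClosure (P : ObjectProperty C) : P ≤ S.extClosure P := fun _ hX _ _ hP => hP _ hX

lemma extClosure_mono {P Q : ObjectProperty C} (h : P ≤ Q) : S.extClosure P ≤ S.extClosure Q :=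
  fun _ hX T hT hQ => hX T hT (h.trans hQ)

lemma extClosure_perp {P Q : ObjectProperty C} (h : ∀ X Y, P X → Q Y → S.Perp X Y) {X Y : C}
    (hX : S.extClosure P X) (hY : S.extClosure Q Y) : S.Perp X Y :=
  hX _ (isFullyExact_perp_left Y) fun X hX =>
    hY _ (isFullyExact_perp_right X) fun Y hY => h X Y hX hY

/-! ### Torsion pairs from orthogonal generators -/

variable (S) in
/-- The objects `E` with a conflation `X ⟶ E ⟶ Y` such that `X` is in `T` and `Y` is in `F`. -/
def star (T F : ObjectProperty C) : ObjectProperty C := fun E =>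
  ∃ (X Y : C) (i : X ⟶ E) (d : E ⟶ Y), S.IsConf i d ∧ T X ∧ F Y

/-- If `Ext¹(T, F) = 0`, then the objects which are extensions of an object of `F` by an object of
`T` are closed under extensions. -/
lemma isFullyExact_star {T F : ObjectProperty C} (hT : S.IsFullyExact T) (hF : S.IsFullyExact F)
    (h : ∀ X Y, T X → F Y → S.ExtZero X Y) : S.IsFullyExact (S.star T F) where
  zero X hX := ⟨X, X, 𝟙 X, 0, isConf_id_zero X X hX, hT.zero _ hX, hF.zero _ hX⟩
  extension K hK := by
    rintro ⟨A₁, B₁, i₁, d₁, h₁, hA₁, hB₁⟩ ⟨A₂, B₂, i₂, d₂, h₂, hA₂, hB₂⟩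
    have hc : S.IsConf K.f K.g := ⟨K.zero, hK⟩
    obtain ⟨N, a, n, q, haq, hn, -, -⟩ := hc.comp_deflation h₂
    obtain ⟨N', p, j, e, hp, hj, -, -⟩ := h₁.comp_inflation haq
    -- the extension `N'` of `A₂` by `B₁` splits
    obtain ⟨r, hr⟩ := extZero_iff_retraction.1 (h _ _ hA₂ hB₁) j e hj
    obtain ⟨s, -, hs⟩ := hj.swap r hr
    -- so that the two middle pieces of the filtration with quotients `A₁, B₁, A₂, B₂` can be swapped
    obtain ⟨M, b, m, t, hbt, hm, -, -⟩ := hp.comp_deflation hs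
    obtain ⟨Y', p', j', e', hp', hj', -, -⟩ := hm.comp_inflation hn
    exact ⟨M, Y', _, p', hp', hT.of_isConf hbt hA₁ hA₂, hF.of_isConf hj' hB₁ hB₂⟩

/-- Orthogonal subcategories which generate the exact category form a torsion pair. -/
lemma isRightAdmissible_of_star {T F : ObjectProperty C} (hT : S.IsFullyExact T)
    (h : ∀ X Y, T X → F Y → S.Perp X Y) (hE : ∀ E, S.star T F E) : S.IsRightAdmissible T where
  left := hT
  right := isFullyExact_rightPerp T
  hom_eq_zero f hX hY := (rightPerp_iff.1 hY _ hX).1 f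
  exists_conf E := by
    obtain ⟨X, Y, i, d, hc, hX, hY⟩ := hE E
    exact ⟨X, Y, i, d, hc.1, hc.2, hX, rightPerp_iff.2 fun X hX => h X Y hX hY⟩

lemma IsZero.of_isConf_left {X Y Z : C} {i : X ⟶ Y} {d : Y ⟶ Z} (h : S.IsConf i d) (hi : i = 0) :
    IsZero X := by
  have := h.mono
  rw [IsZero.iff_id_eq_zero, ← cancel_mono i, hi, comp_zero, comp_zero]

lemma IsZero.of_isConf_right {X Y Z : C} {i : X ⟶ Y} {d : Y ⟶ Z} (h : S.IsConf i d) (hd : d = 0) :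
    IsZero Z := by
  have := h.epi
  rw [IsZero.iff_id_eq_zero, ← cancel_epi d, hd, zero_comp, zero_comp]

lemma IsConf.isIso_of_isZero_right {X Y Z : C} {i : X ⟶ Y} {d : Y ⟶ Z} (h : S.IsConf i d)
    (hZ : IsZero Z) : IsIso i := by
  have := h.mono
  obtain ⟨s, hs⟩ := h.lift (𝟙 Y) (hZ.eq_of_tgt _ _)
  exact ⟨s, by rw [← cancel_mono i, Category.assoc, hs]; simp, hs⟩

lemma IsConf.isIso_of_isZero_left {X Y Z : C} {i : X ⟶ Y} {d : Y ⟶ Z} (h : S.IsConf i d)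
    (hX : IsZero X) : IsIso d := by
  have := h.epi
  obtain ⟨s, hs⟩ := h.desc (𝟙 Y) (hX.eq_of_src _ _)
  exact ⟨s, hs, by rw [← cancel_epi d, ← Category.assoc, hs]; simp⟩

/-! ### Universal extensions -/

/-- If `Ext¹(X, D)` is finite dimensional and `Ext¹(D, D) = 0`, then `X` has a universal extension by
sums of copies of `D`, which has no more extensions by `D`. -/
lemma exists_universal_extension (k : Type w) [Field k] [Linear k C] [HasBinaryBiproducts C]
    (X D : C) [hfin : Module.Finite k (S.Ext X D)] (hD : S.ExtZero D D) :
    ∃ (W Y : C) (i : W ⟶ Y) (d : Y ⟶ X), S.IsConf i d ∧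
      S.extClosure (ObjectProperty.singleton D) W ∧ S.ExtZero Y D := by
  -- a single extension `ω` of `X` by `W` of which all extensions of `X` by `D` are pushouts
  have key : ∀ N : Submodule k (S.Ext X D), N.FG → ∃ (W : C) (ω : S.Ext X W),
      S.extClosure (ObjectProperty.singleton D) W ∧ ∀ ξ ∈ N, ∃ f : W ⟶ D, Ext.push f ω = ξ := by
    intro N hN
    induction N, hN using Submodule.fg_induction with
    | singleton x =>
      refine ⟨D, x, le_extClosure _ _ (by simp), fun ξ hξ => ?_⟩
      obtain ⟨c, rfl⟩ := Submodule.mem_span_singleton.1 hξ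
      exact ⟨c • 𝟙 D, rfl⟩
    | sup N₁ N₂ _ _ h₁ h₂ =>
      obtain ⟨W₁, ω₁, hW₁, h₁⟩ := h₁
      obtain ⟨W₂, ω₂, hW₂, h₂⟩ := h₂
      refine ⟨W₁ ⊞ W₂, Ext.pair ω₁ ω₂, (S.isFullyExact_extClosure _).biprod hW₁ hW₂,
        fun ξ hξ => ?_⟩
      obtain ⟨a, ha, b, hb, rfl⟩ := Submodule.mem_sup.1 hξ
      obtain ⟨f, rfl⟩ := h₁ a ha
      obtain ⟨g, rfl⟩ := h₂ b hb
      exact ⟨biprod.fst ≫ f + biprod.snd ≫ g, by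
        rw [Ext.push_add_left, ← Ext.push_push, ← Ext.push_push, Ext.push_fst_pair,
          Ext.push_snd_pair]⟩
  obtain ⟨W, ω, hW, hω⟩ := key ⊤ hfin.fg_top
  induction ω using Quotient.inductionOn with
  | h ω =>
    have hc : S.IsConf ω.i ω.d := ⟨ω.w, ω.conf⟩
    refine ⟨W, ω.Y, ω.i, ω.d, hc, hW, extZero_iff_section.2 fun B j e he => ?_⟩
    -- restricted to `W`, the extension `B` of `ω.Y` by `D` splits, so that `B` comes from an
    -- extension of `X`
    obtain ⟨N, a, n, q, haq, hn, han, hne⟩ := he.comp_deflation hc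
    have hWD : S.ExtZero W D := hW (fun X => S.ExtZero X D) (isFullyExact_extZero_left D)
      (ObjectProperty.singleton_le_iff.2 hD)
    obtain ⟨r, hr⟩ := extZero_iff_retraction.1 hWD a q haq
    obtain ⟨s, hsq, hs⟩ := haq.swap r hr
    obtain ⟨B', p, j', e', hp, hj', hpj, hpe⟩ := hs.comp_inflation hn
    -- the extension `B'` of `X` is a pushout of `ω`, and therefore splits over `ω.Y`
    obtain ⟨f, hf⟩ := hω ⟦⟨B', j', e', hj'.1, hj'.2⟩⟧ trivial
    obtain ⟨φ, -, hφ⟩ := Ext.over_of_push_eq f hf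
    dsimp at φ hφ
    -- `B` is the pullback of `B'`
    have hjp : j ≫ p = j' := by
      rw [← han, Category.assoc, hpj, ← Category.assoc, hr, Category.id_comp]
    obtain ⟨P, p₁, p₂, l, hP, hl, hlc⟩ := hj'.pullback ω.d
    have hw : p ≫ e' = e ≫ ω.d := hpe
    have : IsIso (hP.lift p e hw) := by
      refine conf.isIso_middle he.2 hlc.2 _ ?_ (by simp)
      apply hP.hom_ext
      · simp [hjp, hl]
      · simp [he.w, hlc.w]
    refine ⟨hP.lift φ (𝟙 _) (by simp [hφ]) ≫ inv (hP.lift p e hw), ?_⟩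
    have h2 : inv (hP.lift p e hw) ≫ e = p₂ := by
      rw [IsIso.inv_comp_eq, IsPullback.lift_snd]
    rw [Category.assoc, h2, IsPullback.lift_snd]

end

/-! ### Projective objects and additive hulls -/

section

variable {C : Type u} [Category.{v} C] [Preadditive C]

/-- `X` is a direct summand of a finite sum of copies of `P`: the identity of `X` is a sum of
endomorphisms which factor through `P`. -/
def InAdd (P X : C) : Prop :=
  ∃ (J : Type) (_ : Fintype J) (p : J → (X ⟶ P)) (q : J → (P ⟶ X)), ∑ a, p a ≫ q a = 𝟙 X

lemma InAdd.refl (P : C) : InAdd P P := ⟨Unit, inferInstance, fun _ => 𝟙 P, fun _ => 𝟙 P, by simp⟩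

lemma InAdd.trans {P Q X : C} (h : InAdd P Q) (h' : InAdd Q X) : InAdd P X := by
  obtain ⟨J, _, p, q, hpq⟩ := h
  obtain ⟨J', _, p', q', hpq'⟩ := h'
  refine ⟨J' × J, inferInstance, fun a => p' a.1 ≫ p a.2, fun a => q a.2 ≫ q' a.1, ?_⟩
  rw [← hpq', Fintype.sum_prod_type]
  refine Finset.sum_congr rfl fun a _ => ?_
  calc ∑ b, (p' a ≫ p b) ≫ q b ≫ q' a = p' a ≫ (∑ b, p b ≫ q b) ≫ q' a := by
        simp [Preadditive.sum_comp, Preadditive.comp_sum]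
    _ = p' a ≫ q' a := by rw [hpq, Category.id_comp]

lemma InAdd.of_retract {X Y : C} (i : X ⟶ Y) (r : Y ⟶ X) (h : i ≫ r = 𝟙 X) : InAdd Y X :=
  ⟨Unit, inferInstance, fun _ => i, fun _ => r, by simpa⟩

lemma InAdd.of_total {P X Y Z : C} {i : X ⟶ Y} {d : Y ⟶ Z} {r : Y ⟶ X} {s : Z ⟶ Y}
    (h : r ≫ i + d ≫ s = 𝟙 Y) (hX : InAdd P X) (hZ : InAdd P Z) : InAdd P Y := by
  obtain ⟨J, _, p, q, hpq⟩ := hX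
  obtain ⟨J', _, p', q', hpq'⟩ := hZ
  refine ⟨J ⊕ J', inferInstance, Sum.elim (fun a => r ≫ p a) (fun a => d ≫ p' a),
    Sum.elim (fun a => q a ≫ i) (fun a => q' a ≫ s), ?_⟩
  rw [Fintype.sum_sum_type, ← h]
  congr 1
  · calc _ = r ≫ (∑ a, p a ≫ q a) ≫ i := by simp [Preadditive.sum_comp, Preadditive.comp_sum]
      _ = _ := by rw [hpq, Category.id_comp]
  · calc _ = d ≫ (∑ a, p' a ≫ q' a) ≫ s := by simp [Preadditive.sum_comp, Preadditive.comp_sum]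
      _ = _ := by rw [hpq', Category.id_comp]

variable (S : ExactStructure C)

/-- An object `P` of an exact category is projective if `Ext¹(P, Y) = 0` for all `Y`. -/
def IsProj (P : C) : Prop := ∀ Y, S.ExtZero P Y

variable {S}

lemma IsProj.exists_lift {P : C} (hP : S.IsProj P) {Y Z : C} {d : Y ⟶ Z} (hd : S.IsDeflation d)
    (f : P ⟶ Z) : ∃ g : P ⟶ Y, g ≫ d = f := by
  obtain ⟨X, i, h⟩ := IsDeflation.exists_isConf hd
  exact extZero_iff_lift.1 (hP X) i d h f

lemma ExtZero.of_inAdd {P Q Y : C} (hP : S.ExtZero P Y) (h : InAdd P Q) : S.ExtZero Q Y := by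
  rw [extZero_iff_lift] at hP ⊢
  intro B V i d hc f
  obtain ⟨J, _, p, q, hpq⟩ := h
  choose g hg using fun a => hP i d hc (q a ≫ f)
  refine ⟨∑ a, p a ≫ g a, ?_⟩
  simp only [Preadditive.sum_comp, Category.assoc, hg]
  simp only [← Category.assoc]
  rw [← Preadditive.sum_comp, hpq, Category.id_comp]

lemma IsProj.of_inAdd {P Q : C} (hP : S.IsProj P) (h : InAdd P Q) : S.IsProj Q :=
  fun Y => (hP Y).of_inAdd h

lemma IsProj.biprod [HasBinaryBiproducts C] {P Q : C} (hP : S.IsProj P) (hQ : S.IsProj Q) :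
    S.IsProj (P ⊞ Q) :=
  fun _ => .extension_left (isConf_inl_snd S P Q) (hP _) (hQ _)

/-- An extension of quotients of projectives in `add P` is a quotient of a projective in `add P`. All
kernels stay in a given fully exact subcategory. -/
lemma isFullyExact_coveredBy {T : ObjectProperty C} (hT : S.IsFullyExact T) {P : C}
    (hP : S.IsProj P) : S.IsFullyExact fun X =>
      ∃ (K Y : C) (i : K ⟶ Y) (d : Y ⟶ X), S.IsConf i d ∧ T K ∧ T Y ∧ InAdd P Y where
  zero X hX := ⟨X, X, 𝟙 X, 0, isConf_id_zero X X hX, hT.zero X hX, hT.zero X hX,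
    ⟨Empty, inferInstance, fun a => a.elim, fun a => a.elim, hX.eq_of_src _ _⟩⟩
  extension K hK := by
    rintro ⟨K₁, Y₁, i₁, d₁, h₁, hK₁, hY₁, hPY₁⟩ ⟨K₃, Y₃, i₃, d₃, h₃, hK₃, hY₃, hPY₃⟩
    have hc : S.IsConf K.f K.g := ⟨K.zero, hK⟩
    have hPr₁ := hP.of_inAdd hPY₁
    have hPr₃ := hP.of_inAdd hPY₃
    -- `N` is the pullback of `X₂` and `Y₃` over `X₃`
    obtain ⟨N, n, q, a, hN, -, haq⟩ := hc.pullback d₃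
    obtain ⟨t, ht⟩ := extZero_iff_section.1 (hPr₃ _) a q haq
    obtain ⟨r, hr, htr⟩ := haq.exists_retraction t ht
    obtain ⟨t', ht', hr'⟩ := haq.swap r hr
    have hn : S.IsDeflation n := isDeflation_of_isPullback hN.flip h₃.deflation
    have hb : S.IsConf (hN.lift 0 i₃ (by simp [h₃.w])) n := by
      refine isConf_of_deflation hn (by simp) ?_ fun T u hu => ?_
      · have := h₃.mono
        exact mono_of_mono_fac (hN.lift_snd 0 i₃ (by simp [h₃.w]))
      · obtain ⟨s, hs⟩ := h₃.lift (u ≫ q) (by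
          rw [Category.assoc, ← hN.w, ← Category.assoc, hu, zero_comp])
        exact ⟨s, hN.hom_ext (by simp [hu]) (by simp [hs])⟩
    -- `M` is the pullback of `N` and `Y₁` over `X₁`, which is an extension of `Y₁` by `Y₃`
    obtain ⟨M, m, m', b, hM, -, hbm⟩ := h₁.pullback r
    obtain ⟨L, c, l, e, hce, hl, -, -⟩ := hbm.comp_deflation hb
    have hsec : ∃ x : Y₃ ⟶ M, x ≫ m' = t' ∧ x ≫ m = 0 :=
      ⟨hM.lift 0 t' (by simp [hr'.w]), by simp, by simp⟩
    obtain ⟨x, hx, hx'⟩ := hsec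
    have hxm : S.IsConf x m := by
      refine isConf_of_deflation (isDeflation_of_isPullback hM.flip hr'.deflation) hx' ?_
        fun T u hu => ?_
      · have := hr'.mono
        exact mono_of_mono_fac hx
      · obtain ⟨s, hs⟩ := hr'.lift (u ≫ m') (by
          rw [Category.assoc, ← hM.w, ← Category.assoc, hu, zero_comp])
        exact ⟨s, hM.hom_ext (by simp [hx', hu]) (by simp [hx, hs])⟩
    obtain ⟨y, hy⟩ := extZero_iff_section.1 (hPr₁ _) x m hxm
    obtain ⟨z, hz, hyz⟩ := hxm.exists_retraction y hy
    have := hxm.mono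
    refine ⟨L, M, l, _, hl, hT.of_isConf hce hK₁ hK₃, hT.of_isConf hxm hY₃ hY₁,
      .of_total (i := x) (d := m) (r := z) (s := y) ?_ hPY₃ hPY₁⟩
    obtain ⟨g, hg⟩ := hxm.lift (𝟙 M - m ≫ y) (by
      rw [Preadditive.sub_comp, Category.assoc, hy]; simp)
    have : g = z := by
      have := hg =≫ z
      simpa [hz, hyz] using this
    rw [← this, hg]
    abel

end

/-! ### Exceptional collections -/

section

variable {C : Type u} [Category.{v} C] [Preadditive C]

/-- A collection of objects, indexed by a partial order, with the properties of the standard objects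
of a highest weight category: they generate the exact category, their endomorphisms are scalars, they
have no self-extensions, and there are neither morphisms nor extensions from `D i` to `D j` unless
`j ≤ i`. -/
structure IsExceptional (S : ExactStructure C) (k : Type w) [Field k] [Linear k C] {L : Type u'}
    [PartialOrder L] (D : L → C) : Prop where
  perp : ∀ i j, ¬ j ≤ i → S.Perp (D i) (D j)
  ext_self : ∀ i, S.ExtZero (D i) (D i)
  endo : ∀ i (f : D i ⟶ D i), ∃ c : k, f = c • 𝟙 (D i)
  generates : ∀ X, S.extClosure (fun Y => ∃ i, Y = D i) X
  hom_finite : ∀ X Y : C, Module.Finite k (X ⟶ Y)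
  ext_finite : haveI := S.hasBinaryBiproducts
    ∀ X Y : C, Module.Finite k (S.Ext X Y)

variable (S : ExactStructure C)

/-- The fully exact subcategory generated by the objects `D i` with `i` in `I`. -/
def filt {L : Type u'} (D : L → C) (I : Set L) : ObjectProperty C :=
  S.extClosure fun Y => ∃ i ∈ I, Y = D i

variable {S} {L : Type u'} {D : L → C}

lemma isFullyExact_filt (I : Set L) : S.IsFullyExact (S.filt D I) := S.isFullyExact_extClosure _

lemma filt_mono {I J : Set L} (h : I ⊆ J) : S.filt D I ≤ S.filt D J :=
  extClosure_mono fun _ ⟨i, hi, e⟩ => ⟨i, h hi, e⟩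

lemma filt_of_mem {I : Set L} {i : L} (hi : i ∈ I) : S.filt D I (D i) :=
  le_extClosure _ _ ⟨i, hi, rfl⟩

lemma filt_empty {X : C} (hX : S.filt D ∅ X) : IsZero X :=
  hX (fun X => IsZero X) ⟨fun _ h => h, fun K hK h₁ h₃ => by
    have hc : S.IsConf K.f K.g := ⟨K.zero, hK⟩
    have := hc.isIso_of_isZero_left h₁
    exact h₃.of_iso (asIso K.g)⟩ (by rintro _ ⟨i, ⟨⟩, -⟩)

namespace IsExceptional

variable {k : Type w} [Field k] [Linear k C] [PartialOrder L] (h : S.IsExceptional k D)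
include h

lemma filt_univ (X : C) : S.filt D Set.univ X :=
  extClosure_mono (by rintro _ ⟨i, rfl⟩; exact ⟨i, trivial, rfl⟩) _ (h.generates X)

lemma perp_filt {I J : Set L} (hIJ : ∀ i ∈ I, ∀ j ∈ J, ¬ j ≤ i) {X Y : C} (hX : S.filt D I X)
    (hY : S.filt D J Y) : S.Perp X Y :=
  extClosure_perp (by rintro _ _ ⟨i, hi, rfl⟩ ⟨j, hj, rfl⟩; exact h.perp i j (hIJ i hi j hj)) hX hY

lemma star_filt {I J : Set L} (hIJ : ∀ i ∈ I, ∀ j ∈ J, ¬ j ≤ i) {X : C}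
    (hX : S.filt D (I ∪ J) X) : S.star (S.filt D I) (S.filt D J) X := by
  have := S.hasZeroObject
  obtain ⟨O, hO⟩ := HasZeroObject.zero (C := C)
  refine hX _ (isFullyExact_star (isFullyExact_filt I) (isFullyExact_filt J)
    fun X Y hX hY => (h.perp_filt hIJ hX hY).2) ?_
  rintro _ ⟨i, hi | hi, rfl⟩
  · exact ⟨_, O, _, _, isConf_id_zero _ O hO, filt_of_mem hi, (isFullyExact_filt J).zero _ hO⟩
  · exact ⟨O, _, _, _, isConf_zero_id O _ hO, (isFullyExact_filt I).zero _ hO, filt_of_mem hi⟩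

/-- The subcategory generated by a lower set of an exceptional collection is right admissible. -/
lemma isRightAdmissible_filt {I : Set L} (hI : IsLowerSet I) : S.IsRightAdmissible (S.filt D I) := by
  have hIc : ∀ i ∈ I, ∀ j ∈ Iᶜ, ¬ j ≤ i := fun i hi j hj hji => hj (hI hji hi)
  refine isRightAdmissible_of_star (F := S.filt D Iᶜ) (isFullyExact_filt I)
    (fun X Y hX hY => h.perp_filt hIc hX hY) fun E => h.star_filt hIc ?_
  rw [Set.union_compl_self]
  exact h.filt_univ E

/-- The objects generated by `D i` are sums of copies of `D i`, as there are no extensions between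
such sums. -/
lemma inAdd_of_filt_singleton {i : L} {X : C} (hX : S.filt D {i} X) : InAdd (D i) X := by
  have key : S.IsFullyExact fun X => S.ExtZero X (D i) ∧ S.ExtZero (D i) X ∧ InAdd (D i) X := by
    refine ⟨fun X hX => ⟨.of_isZero_left hX, .of_isZero_right hX, Empty, inferInstance,
      fun a => a.elim, fun a => a.elim, hX.eq_of_src _ _⟩, fun K hK h₁ h₃ => ?_⟩
    have hc : S.IsConf K.f K.g := ⟨K.zero, hK⟩
    refine ⟨.extension_left hc h₁.1 h₃.1, .extension_right hc h₁.2.1 h₃.2.1, ?_⟩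
    obtain ⟨s, hs⟩ := extZero_iff_section.1 (h₁.2.1.of_inAdd h₃.2.2) _ _ hc
    obtain ⟨g, hg⟩ := hc.lift (𝟙 _ - K.g ≫ s) (by
      rw [Preadditive.sub_comp, Category.assoc, hs]; simp)
    exact .of_total (i := K.f) (d := K.g) (r := g) (s := s) (by rw [hg]; abel) h₁.2.2 h₃.2.2
  refine (hX _ key ?_).2.2
  rintro _ ⟨j, hj, rfl⟩
  obtain rfl : j = i := hj
  exact ⟨h.ext_self _, h.ext_self _, .refl _⟩

/-- Any object of the subcategory generated by a lower set is a quotient of a projective object, with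
the projective and the kernel in the subcategory: extensions by the `D u` are killed one after the
other, from large to small `u`. -/
lemma exists_proj [Finite L] {I : Set L} (hI : IsLowerSet I) {X : C} (hX : S.filt D I X) :
    ∃ (K P : C) (i : K ⟶ P) (d : P ⟶ X), S.IsConf i d ∧ S.filt D I K ∧ S.filt D I P ∧
      S.IsProj P := by
  have := S.hasZeroObject
  have := S.hasBinaryBiproducts
  obtain ⟨O, hO⟩ := HasZeroObject.zero (C := C)
  have := h.ext_finite
  have key : ∀ U : Finset L, IsUpperSet (U : Set L) → ∃ (K P : C) (i : K ⟶ P) (d : P ⟶ X),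
      S.IsConf i d ∧ S.filt D I K ∧ S.filt D I P ∧ ∀ u ∈ U, S.ExtZero P (D u) := by
    intro U
    classical
    induction U using Finset.strongInduction with
    | H U ih =>
      intro hU
      rcases U.eq_empty_or_nonempty with rfl | hne
      · exact ⟨O, X, 0, 𝟙 X, isConf_zero_id O X hO, (isFullyExact_filt I).zero _ hO, hX, by simp⟩
      obtain ⟨j, hj⟩ := U.exists_minimal hne
      have hjU : j ∈ U := hj.1
      have hmin : ∀ u ∈ U, u ≤ j → u = j := fun u hu huj => le_antisymm huj (hj.2 hu huj)
      obtain ⟨K, P, i, d, hc, hK, hP, hPU⟩ := ih (U.erase j) (Finset.erase_ssubset hjU) (by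
        intro a b hab ha
        simp only [Finset.coe_erase, Set.mem_sdiff, Finset.mem_coe, Set.mem_singleton_iff] at ha ⊢
        refine ⟨hU hab ha.1, ?_⟩
        rintro rfl
        exact ha.2 (hmin a ha.1 hab))
      by_cases hjI : j ∈ I
      · obtain ⟨W, Y, a, b, hab, hW, hY⟩ := exists_universal_extension k P (D j) (h.ext_self j)
        have hWI : S.filt D I W := hW _ (isFullyExact_filt I)
          (ObjectProperty.singleton_le_iff.2 (filt_of_mem hjI))
        obtain ⟨N, a', n, q, haq, hn, -, -⟩ := hab.comp_deflation hc
        refine ⟨N, Y, n, _, hn, (isFullyExact_filt I).of_isConf haq hWI hK,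
          (isFullyExact_filt I).of_isConf hab hWI hP, fun u hu => ?_⟩
        by_cases huj : u = j
        · exact huj ▸ hY
        · have hWu : S.ExtZero W (D u) := hW (fun W => S.ExtZero W (D u))
            (isFullyExact_extZero_left _) (ObjectProperty.singleton_le_iff.2
              (h.perp _ _ fun huj' => huj (hmin u hu huj')).2)
          exact .extension_left hab hWu (hPU u (Finset.mem_erase.2 ⟨huj, hu⟩))
      · refine ⟨K, P, i, d, hc, hK, hP, fun u hu => ?_⟩
        by_cases huj : u = j
        · subst huj
          refine (h.perp_filt (J := {u}) (fun a ha b hb hba => ?_) hP (filt_of_mem rfl)).2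
          obtain rfl : b = u := hb
          exact hjI (hI hba ha)
        · exact hPU u (Finset.mem_erase.2 ⟨huj, hu⟩)
  have := Fintype.ofFinite L
  obtain ⟨K, P, i, d, hc, hK, hP, hPU⟩ := key Finset.univ (by simp [isUpperSet_univ])
  refine ⟨K, P, i, d, hc, hK, hP, fun Y => h.generates Y _ (isFullyExact_extZero_right P) ?_⟩
  rintro _ ⟨u, rfl⟩
  exact hPU u (Finset.mem_univ u)

/-- The subcategory generated by a lower set has a projective generator, which is projective in the
whole category. -/
lemma exists_proj_generator [Finite L] {I : Set L} (hI : IsLowerSet I) :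
    ∃ P : C, S.filt D I P ∧ S.IsProj P ∧ ∀ X, S.filt D I X →
      ∃ (K Y : C) (i : K ⟶ Y) (d : Y ⟶ X), S.IsConf i d ∧ S.filt D I K ∧ S.filt D I Y ∧
        InAdd P Y := by
  have := S.hasZeroObject
  have := S.hasBinaryBiproducts
  obtain ⟨O, hO⟩ := HasZeroObject.zero (C := C)
  have hT := isFullyExact_filt (S := S) (D := D) I
  have key : ∀ U : Finset L, ∃ P : C, S.filt D I P ∧ S.IsProj P ∧ ∀ j ∈ U, j ∈ I →
      ∃ (K Y : C) (i : K ⟶ Y) (d : Y ⟶ D j), S.IsConf i d ∧ S.filt D I K ∧ S.filt D I Y ∧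
        InAdd P Y := by
    intro U
    classical
    induction U using Finset.induction_on with
    | empty => exact ⟨O, hT.zero _ hO, fun _ => .of_isZero_left hO, by simp⟩
    | insert j U _ ih =>
      obtain ⟨P, hP, hP', hPU⟩ := ih
      by_cases hj : j ∈ I
      · obtain ⟨K, Q, i, d, hc, hK, hQ, hQ'⟩ := h.exists_proj hI (filt_of_mem hj)
        refine ⟨P ⊞ Q, hT.biprod hP hQ, hP'.biprod hQ', fun j' hj' hjI => ?_⟩
        rcases Finset.mem_insert.1 hj' with rfl | hj'
        · exact ⟨K, Q, i, d, hc, hK, hQ, .of_retract biprod.inr biprod.snd biprod.inr_snd⟩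
        · obtain ⟨K, Y, i, d, hc, hK, hY, hPY⟩ := hPU j' hj' hjI
          exact ⟨K, Y, i, d, hc, hK, hY,
            .trans (.of_retract biprod.inl biprod.fst biprod.inl_fst) hPY⟩
      · refine ⟨P, hP, hP', fun j' hj' hjI => ?_⟩
        rcases Finset.mem_insert.1 hj' with rfl | hj'
        · exact absurd hjI hj
        · exact hPU j' hj' hjI
  have := Fintype.ofFinite L
  obtain ⟨P, hP, hP', hPU⟩ := key Finset.univ
  refine ⟨P, hP, hP', fun X hX => hX _ (isFullyExact_coveredBy hT hP') ?_⟩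
  rintro _ ⟨j, hj, rfl⟩
  exact hPU j (Finset.mem_univ j) hj

end IsExceptional

end

/-! ### Thin categories are generated by exceptional collections -/

section

variable {C : Type u} [Category.{v} C] [Preadditive C]

/-- `X` is a sum of `n` copies of `D`. -/
def HasCoords (D X : C) (n : ℕ) : Prop :=
  ∃ (p : Fin n → (X ⟶ D)) (q : Fin n → (D ⟶ X)),
    (∀ a b, q a ≫ p b = if a = b then 𝟙 D else 0) ∧ ∑ a, p a ≫ q a = 𝟙 X

lemma HasCoords.map {C' : Type u'} [Category.{v'} C'] [Preadditive C'] (F : C ⥤ C') [F.Additive]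
    {D X : C} {n : ℕ} (h : HasCoords D X n) : HasCoords (F.obj D) (F.obj X) n := by
  obtain ⟨p, q, h₁, h₂⟩ := h
  refine ⟨fun a => F.map (p a), fun a => F.map (q a), fun a b => ?_, ?_⟩
  · rw [← F.map_comp, h₁]
    split_ifs <;> simp
  · rw [← F.map_id, ← h₂, F.map_sum]
    simp

lemma HasCoords.of_iso {D X Y : C} {n : ℕ} (e : X ≅ Y) (h : HasCoords D X n) : HasCoords D Y n := by
  obtain ⟨p, q, h₁, h₂⟩ := h
  refine ⟨fun a => e.inv ≫ p a, fun a => q a ≫ e.hom, fun a b => by simp [h₁], ?_⟩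
  calc _ = e.inv ≫ (∑ a, p a ≫ q a) ≫ e.hom := by
        simp [Preadditive.sum_comp, Preadditive.comp_sum]
    _ = _ := by rw [h₂]; simp

end

section

variable (k : Type w) [Field k]

lemma hasCoords_fgModuleCat (M : FGModuleCat.{w} k) :
    HasCoords (FGModuleCat.of k k) M (Module.finrank k M) := by
  let b := Module.finBasis k M
  refine ⟨fun a => FGModuleCat.ofHom (b.coord a : M →ₗ[k] k),
    fun a => FGModuleCat.ofHom (LinearMap.toSpanSingleton k M (b a)), fun a a' => ?_, ?_⟩
  · apply FGModuleCat.hom_ext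
    refine LinearMap.ext_ring ?_
    change b.coord a' (LinearMap.toSpanSingleton k M (b a) 1) = _
    rw [LinearMap.toSpanSingleton_apply, one_smul, Module.Basis.coord_apply, b.repr_self,
      Finsupp.single_apply]
    split_ifs <;> rfl
  · apply FGModuleCat.hom_ext
    refine LinearMap.ext fun x => ?_
    let ev : (M ⟶ M) →+ M := ⟨⟨fun f => f.hom.hom x, rfl⟩, fun _ _ => rfl⟩
    exact (map_sum ev _ _).trans (b.sum_repr x)

variable {k} {C : Type u} [Category.{v} C]

lemma isIdempotentComplete_of_equivalence (e : C ≌ FGModuleCat.{w} k) :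
    IsIdempotentComplete C :=
  (Idempotents.isIdempotentComplete_iff_of_equivalence e).2 inferInstance

variable [Preadditive C]

/-- The standard object of a category equivalent to finite dimensional vector spaces. -/
noncomputable def lineObj (e : C ≌ FGModuleCat.{w} k) : C := e.inverse.obj (FGModuleCat.of k k)

variable (e : C ≌ FGModuleCat.{w} k)

lemma not_isZero_lineObj [e.functor.Additive] : ¬ IsZero (lineObj e) := by
  intro h
  have h' : IsZero (FGModuleCat.of k k) :=
    (e.functor.map_isZero h).of_iso (e.counitIso.app (FGModuleCat.of k k)).symm
  have := congrArg (fun f => f.hom.hom (1 : k)) (h'.eq_of_src (𝟙 _) 0)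
  exact one_ne_zero this

lemma endo_lineObj [Linear k C] [e.functor.Additive] [e.functor.Linear k]
    (f : lineObj e ⟶ lineObj e) :
    ∃ c : k, f = c • 𝟙 (lineObj e) := by
  let ε : e.functor.obj (lineObj e) ≅ FGModuleCat.of k k := e.counitIso.app (FGModuleCat.of k k)
  obtain ⟨c, hc⟩ : ∃ c : k, ε.inv ≫ e.functor.map f ≫ ε.hom = c • 𝟙 _ := by
    refine ⟨(ε.inv ≫ e.functor.map f ≫ ε.hom).hom.hom (1 : k), ?_⟩
    apply FGModuleCat.hom_ext
    refine LinearMap.ext_ring ?_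
    exact (mul_one _).symm
  refine ⟨c, e.functor.map_injective ?_⟩
  have := ε.hom ≫= hc =≫ ε.inv
  rw [e.functor.map_smul, e.functor.map_id]
  simpa using this

lemma exists_hasCoords_lineObj [e.functor.Additive] (X : C) : ∃ n, HasCoords (lineObj e) X n :=
  ⟨_, ((hasCoords_fgModuleCat k (e.functor.obj X)).map e.inverse).of_iso (e.unitIso.app X).symm⟩

end

section

variable {C : Type u} [Category.{v} C] [Preadditive C] {k : Type w} [Field k] [Linear k C]

/-- The nonzero object `D` has only scalar endomorphisms, all objects of the full subcategory `G` are
finite sums of copies of `D`, and idempotents split in `G`. -/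
structure IsLine (k : Type w) [Field k] [Linear k C] (G : ObjectProperty C) (D : C) : Prop where
  mem : G D
  not_isZero : ¬ IsZero D
  endo : ∀ f : D ⟶ D, ∃ c : k, f = c • 𝟙 D
  hasCoords : ∀ X, G X → ∃ n, HasCoords D X n
  split : ∀ (X : C) (p : X ⟶ X), G X → p ≫ p = p →
    ∃ (Y : C) (i : Y ⟶ X) (r : X ⟶ Y), G Y ∧ i ≫ r = 𝟙 Y ∧ r ≫ i = p

lemma isLine_of_equivalence {G : ObjectProperty C} (e : G.FullSubcategory ≌ FGModuleCat.{w} k)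
    [e.functor.Additive] [e.functor.Linear k] : IsLine k G (lineObj e).obj where
  mem := (lineObj e).property
  not_isZero h := not_isZero_lineObj e (by
    rw [IsZero.iff_id_eq_zero]
    exact G.hom_ext (h.eq_of_src _ _))
  endo f := by
    obtain ⟨c, hc⟩ := endo_lineObj e (G.homMk f)
    exact ⟨c, congrArg (·.hom) hc⟩
  hasCoords X hX := by
    obtain ⟨n, hn⟩ := exists_hasCoords_lineObj e ⟨X, hX⟩
    exact ⟨n, hn.map G.ι⟩
  split X p hX hp := by
    have := isIdempotentComplete_of_equivalence e
    obtain ⟨Y, i, r, h₁, h₂⟩ := IsIdempotentComplete.idempotents_split (⟨X, hX⟩ : G.FullSubcategory)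
      (G.homMk p) (G.hom_ext hp)
    exact ⟨Y.obj, i.hom, r.hom, Y.property, congrArg (·.hom) h₁, congrArg (·.hom) h₂⟩

namespace IsLine

variable {G : ObjectProperty C} {D : C} (h : IsLine k G D)
include h

lemma isIso_of_ne_zero (f : D ⟶ D) (hf : f ≠ 0) : IsIso f := by
  obtain ⟨c, rfl⟩ := h.endo f
  have hc : c ≠ 0 := by rintro rfl; simp at hf
  exact ⟨c⁻¹ • 𝟙 D, by simp [smul_smul, hc], by simp [smul_smul, hc]⟩

lemma exists_section {X : C} (hX : G X) (f : X ⟶ D) (hf : f ≠ 0) : ∃ q : D ⟶ X, q ≫ f = 𝟙 D := by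
  obtain ⟨n, p, q, -, hpq⟩ := h.hasCoords X hX
  obtain ⟨a, ha⟩ : ∃ a, q a ≫ f ≠ 0 := by
    by_contra! hc
    apply hf
    rw [← Category.id_comp f, ← hpq, Preadditive.sum_comp]
    exact Finset.sum_eq_zero fun a _ => by rw [Category.assoc, hc, comp_zero]
  have := h.isIso_of_ne_zero _ ha
  exact ⟨inv (q a ≫ f) ≫ q a, by rw [Category.assoc, IsIso.inv_hom_id]⟩

variable {S : ExactStructure C}

/-- A direct summand `D` of an object of `G` has a complement in `G`. -/
lemma exists_isConf {X : C} (hX : G X) (q : D ⟶ X) (p : X ⟶ D) (hqp : q ≫ p = 𝟙 D) :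
    ∃ (K : C) (r : X ⟶ K) (i : K ⟶ X), G K ∧ S.IsConf q r ∧ i ≫ r = 𝟙 K ∧ r ≫ i = 𝟙 X - p ≫ q := by
  have hqp' : p ≫ q ≫ p ≫ q = p ≫ q := by rw [reassoc_of% hqp]
  obtain ⟨K, i, r, hK, hir, hri⟩ := h.split X (𝟙 X - p ≫ q) hX (by simp [hqp'])
  have hr : Epi r := epi_of_epi_fac hir
  have hi : Mono i := mono_of_mono_fac hir
  refine ⟨K, r, i, hK, isConf_of_split p i ?_ hqp hir (by rw [hri]; abel) ?_, hir, hri⟩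
  · rw [← cancel_mono i, Category.assoc, hri, Preadditive.comp_sub, reassoc_of% hqp]
    simp
  · rw [← cancel_epi r, ← Category.assoc, hri, Preadditive.sub_comp, Category.assoc, hqp]
    simp

lemma prop_of_isFullyExact {T : ObjectProperty C} (hT : S.IsFullyExact T) (hD : T D) {X : C}
    (hX : G X) : T X := by
  obtain ⟨n, hn⟩ := h.hasCoords X hX
  induction n generalizing X with
  | zero =>
    obtain ⟨p, q, -, h₂⟩ := hn
    exact hT.zero X ((IsZero.iff_id_eq_zero X).2 (by rw [← h₂]; simp))
  | succ n ih =>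
    obtain ⟨p, q, h₁, h₂⟩ := hn
    obtain ⟨K, r, i, hK, hc, hir, hri⟩ := h.exists_isConf (S := S) hX (q 0) (p 0) (by simp [h₁])
    refine hT.of_isConf hc hD (ih hK ⟨fun a => i ≫ p a.succ, fun a => q a.succ ≫ r, ?_, ?_⟩)
    · intro a b
      calc _ = q a.succ ≫ (r ≫ i) ≫ p b.succ := by simp
        _ = _ := by
          rw [hri, Preadditive.sub_comp, Preadditive.comp_sub, Category.assoc,
            reassoc_of% (h₁ a.succ 0)]
          simp [h₁]
    · have h₃ : r ≫ i = ∑ a : Fin n, p a.succ ≫ q a.succ := by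
        rw [hri, ← h₂, Fin.sum_univ_succ]
        abel
      calc _ = i ≫ (∑ a : Fin n, p a.succ ≫ q a.succ) ≫ r := by
            simp [Preadditive.sum_comp, Preadditive.comp_sum]
        _ = _ := by rw [← h₃]; simp [hir]

lemma isIso_of_mono {X : C} (hX : G X) (f : X ⟶ D) [Mono f] (hf : f ≠ 0) : IsIso f := by
  obtain ⟨q, hq⟩ := h.exists_section hX f hf
  exact ⟨q, by rw [← cancel_mono f, Category.assoc, hq]; simp, hq⟩

lemma extZero (hG : S.IsFullyExact G) : S.ExtZero D D := by
  refine extZero_iff_section.2 fun B i d hc => ?_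
  refine h.exists_section (hG.of_isConf hc h.mem h.mem) d ?_
  rintro rfl
  exact h.not_isZero (IsZero.of_isConf_right hc rfl)

/-- An irreducible object of `G` is isomorphic to `D`. -/
lemma nonempty_iso_of_irreducible {X : C} (hX : G X) (hX' : S.irreducible X) : Nonempty (D ≅ X) := by
  obtain ⟨n, hn⟩ := h.hasCoords X hX
  obtain ⟨p, q, h₁, h₂⟩ := hn
  cases n with
  | zero => exact absurd ((IsZero.iff_id_eq_zero X).2 (by rw [← h₂]; simp)) hX'.1
  | succ n =>
    obtain ⟨K, r, i, hK, hc, -, -⟩ := h.exists_isConf (S := S) hX (q 0) (p 0) (by simp [h₁])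
    rcases hX'.2 _ _ hc.inflation with h0 | h0
    · exact absurd (IsZero.of_isConf_left hc h0) h.not_isZero
    · exact ⟨asIso (q 0)⟩

end IsLine

end

/-! ### Right admissible filtrations -/

section

variable {C : Type u} [Category.{v} C] [Preadditive C] {S : ExactStructure C}

lemma IsRightAdmissible.exists_isConf {T : ObjectProperty C} (hT : S.IsRightAdmissible T) (E : C) :
    ∃ (X Y : C) (i : X ⟶ E) (d : E ⟶ Y), S.IsConf i d ∧ T X ∧ S.rightPerp T Y := by
  obtain ⟨X, Y, i, d, w, h, hX, hY⟩ := hT.exists_conf E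
  exact ⟨X, Y, i, d, ⟨w, h⟩, hX, hY⟩

/-- Right admissible subcategories are closed under quotients. -/
lemma IsRightAdmissible.of_epi {T : ObjectProperty C} (hT : S.IsRightAdmissible T) {X Y : C}
    (f : X ⟶ Y) [Epi f] (hX : T X) : T Y := by
  obtain ⟨A, B, i, d, hc, hA, hB⟩ := hT.exists_isConf Y
  have hd : d = 0 := by
    rw [← cancel_epi f, comp_zero]
    exact hT.hom_eq_zero _ hX hB
  have := hc.isIso_of_isZero_right (IsZero.of_isConf_right hc hd)
  exact hT.left.of_iso (asIso i) hA

namespace IsThinFiltration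

variable {k : Type w} [Field k] [Linear k C] {n : ℕ} {T : Fin (n + 1) → ObjectProperty C}
  (h : S.IsThinFiltration k T)
include h

lemma isFullyExact_graded (i : Fin n) :
    S.IsFullyExact (S.rightPerp (T i.castSucc) ⊓ T i.succ) where
  zero X hX := ⟨(isFullyExact_rightPerp _).zero X hX, (h.admissible _).left.zero X hX⟩
  extension K hK h₁ h₃ := ⟨(isFullyExact_rightPerp _).extension K hK h₁.1 h₃.1,
    (h.admissible _).left.extension K hK h₁.2 h₃.2⟩

lemma exists_isLine (i : Fin n) : ∃ D, IsLine k (S.rightPerp (T i.castSucc) ⊓ T i.succ) D := by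
  obtain ⟨e, _, _⟩ := h.graded i
  exact ⟨_, isLine_of_equivalence e⟩

lemma perp_of_lt {i j : Fin n} (hij : i < j) {X Y : C}
    (hX : (S.rightPerp (T i.castSucc) ⊓ T i.succ) X)
    (hY : (S.rightPerp (T j.castSucc) ⊓ T j.succ) Y) : S.Perp X Y :=
  rightPerp_iff.1 hY.1 X (h.monotone (by simpa [Fin.le_def] using hij) X hX.2)

lemma exists_graded {i : Fin n} {X : C} (hX : T i.succ X) : ∃ (A F : C) (a : A ⟶ X) (f : X ⟶ F),
    S.IsConf a f ∧ T i.castSucc A ∧ (S.rightPerp (T i.castSucc) ⊓ T i.succ) F := by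
  obtain ⟨A, F, a, f, hc, hA, hF⟩ := (h.admissible i.castSucc).exists_isConf X
  have := hc.epi
  exact ⟨A, F, a, f, hc, hA, hF, (h.admissible i.succ).of_epi f hX⟩

lemma generates {D : Fin n → C}
    (hD : ∀ i, IsLine k (S.rightPerp (T i.castSucc) ⊓ T i.succ) (D i)) (X : C) :
    S.extClosure (fun Y => ∃ i, Y = D i) X := by
  suffices ∀ i X, T i X → S.extClosure (fun Y => ∃ i, Y = D i) X from this _ X (h.top X)
  have hE := S.isFullyExact_extClosure (fun Y => ∃ i, Y = D i)
  intro i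
  induction i using Fin.induction with
  | zero => exact fun X hX => hE.zero X ((h.bot X).1 hX)
  | succ i ih =>
    intro X hX
    obtain ⟨A, F, a, f, hc, hA, hF⟩ := h.exists_graded hX
    exact hE.of_isConf hc (ih A hA)
      ((hD i).prop_of_isFullyExact hE (le_extClosure _ _ ⟨i, rfl⟩) hF)

/-- The standard object of a graded factor is irreducible: both ends of a conflation with middle term
in a graded factor lie in this graded factor. -/
lemma irreducible {i : Fin n} {D : C}
    (hD : IsLine k (S.rightPerp (T i.castSucc) ⊓ T i.succ) D) : S.irreducible D := by
  refine ⟨hD.not_isZero, fun A f hf => ?_⟩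
  obtain ⟨B, d, hc⟩ := IsInflation.exists_isConf hf
  have := hc.mono
  have := hc.epi
  have hA : S.rightPerp (T i.castSucc) A := by
    obtain ⟨X, Y, a, b, hab, hX, hY⟩ := (h.admissible i.castSucc).exists_isConf A
    have h0 : a = 0 := by
      rw [← cancel_mono f, zero_comp]
      exact (rightPerp_iff.1 hD.mem.1 X hX).1 _
    have := hab.isIso_of_isZero_left (IsZero.of_isConf_left hab h0)
    exact (isFullyExact_rightPerp _).of_iso (asIso b).symm hY
  have hA' : T i.succ A := by
    have hB : T i.succ B := (h.admissible i.succ).of_epi d hD.mem.2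
    obtain ⟨X, Y, a, b, hab, hX, hY⟩ := (h.admissible i.succ).exists_isConf A
    obtain ⟨g, hg⟩ := (rightPerp_iff.1 hY B hB).2 f d hc b
    have h0 : b = 0 := by rw [← hg, (rightPerp_iff.1 hY D hD.mem.2).1 g, comp_zero]
    have := hab.isIso_of_isZero_right (IsZero.of_isConf_right hab h0)
    exact (h.admissible i.succ).left.of_iso (asIso a) hX
  exact or_iff_not_imp_left.2 (hD.isIso_of_mono ⟨hA, hA'⟩ f)

/-- An irreducible object lies in a graded factor: in the smallest `Tᵢ` which contains it, its
torsion part with respect to `Tᵢ₋₁` has to be zero. -/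
lemma exists_graded_of_irreducible {E : C} (hE : S.irreducible E) :
    ∃ i : Fin n, (S.rightPerp (T i.castSucc) ⊓ T i.succ) E := by
  by_contra! hc
  suffices ∀ i, ¬ T i E from this _ (h.top E)
  intro i
  induction i using Fin.induction with
  | zero => exact fun h0 => hE.1 ((h.bot E).1 h0)
  | succ i ih =>
    intro hi
    obtain ⟨A, F, a, f, haf, hA, hF⟩ := h.exists_graded hi
    rcases hE.2 A a haf.inflation with h0 | h0
    · have := haf.isIso_of_isZero_left (IsZero.of_isConf_left haf h0)
      exact hc i ((h.isFullyExact_graded i).of_iso (asIso f).symm hF)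
    · exact ih ((h.admissible _).left.of_iso (asIso a) hA)

end IsThinFiltration

lemma irrClass_eq_iff {E E' : C} {h : S.irreducible E} {h' : S.irreducible E'} :
    S.irrClass E h = S.irrClass E' h' ↔ Nonempty (E ≅ E') := by
  refine Quotient.eq.trans ⟨fun ⟨e⟩ => ⟨(S.irreducible.ι).mapIso e⟩,
    fun ⟨e⟩ => ⟨ObjectProperty.isoMk _ e⟩⟩

variable (S) in
/-- A representative of a class of irreducible objects. -/
noncomputable def irrObj (l : S.Irr) : C := (Quotient.out l).obj

lemma irreducible_irrObj (l : S.Irr) : S.irreducible (S.irrObj l) := (Quotient.out l).property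

lemma irrClass_irrObj (l : S.Irr) : S.irrClass (S.irrObj l) (irreducible_irrObj l) = l :=
  Quotient.out_eq l

lemma Perp.of_iso {X Y X' Y' : C} (h : S.Perp X Y) (e : X ≅ X') (e' : Y ≅ Y') : S.Perp X' Y' :=
  (isFullyExact_perp_left Y').of_iso e ((isFullyExact_perp_right X).of_iso e' h)

/-- The canonical relation of a thin category is antisymmetric, and the set of classes of irreducible
objects is finite: there is an injective monotone map to a finite chain. -/
lemma IsThinFiltration.exists_rank {k : Type w} [Field k] [Linear k C] {n : ℕ}
    {T : Fin (n + 1) → ObjectProperty C} (h : S.IsThinFiltration k T) :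
    ∃ r : S.Irr → Fin n, Function.Injective r ∧ (∀ l m, S.canonicalLE l m → r l ≤ r m) := by
  choose r hr using fun l => h.exists_graded_of_irreducible (irreducible_irrObj (S := S) l)
  choose D hD using h.exists_isLine
  refine ⟨r, fun l m hlm => ?_, fun l m hlm => ?_⟩
  · obtain ⟨a⟩ := (hD (r l)).nonempty_iso_of_irreducible (hr l) (irreducible_irrObj l)
    obtain ⟨b⟩ := (hD (r l)).nonempty_iso_of_irreducible (hlm ▸ hr m) (irreducible_irrObj m)
    rw [← irrClass_irrObj l, ← irrClass_irrObj m, irrClass_eq_iff]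
    exact ⟨a.symm ≪≫ b⟩
  · induction hlm with
    | refl => exact le_rfl
    | tail _ hbc ih =>
      refine ih.trans ?_
      obtain ⟨E, E', hE, hE', rfl, rfl, hEE⟩ := hbc
      by_contra! hlt
      obtain ⟨e⟩ := irrClass_eq_iff.1 (irrClass_irrObj (S.irrClass E hE))
      obtain ⟨e'⟩ := irrClass_eq_iff.1 (irrClass_irrObj (S.irrClass E' hE'))
      refine hEE (rightPerp_iff.2 fun X hX => ?_)
      obtain rfl := (ObjectProperty.singleton_iff _ _).1 hX
      exact (h.perp_of_lt hlt (hr _) (hr _)).of_iso e' e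

/-- The canonical poset, given that the canonical relation is antisymmetric. -/
abbrev canonicalPartialOrder (h : ∀ l m : S.Irr, S.canonicalLE l m → S.canonicalLE m l → l = m) :
    PartialOrder S.Irr where
  le := S.canonicalLE
  le_refl _ := .refl
  le_trans _ _ _ := .trans
  le_antisymm := h

/-- The irreducible objects of a thin category form an exceptional collection. -/
lemma IsThin.isExceptional {k : Type w} [Field k] [Linear k C] (hS : S.IsThin k)
    (h : ∀ l m : S.Irr, S.canonicalLE l m → S.canonicalLE m l → l = m) :
    letI := canonicalPartialOrder h
    S.IsExceptional k S.irrObj := by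
  let := canonicalPartialOrder h
  obtain ⟨n, T, hT⟩ := hS.exists_filtration
  choose D hD using hT.exists_isLine
  have key (l : S.Irr) : ∃ i, Nonempty (D i ≅ S.irrObj l) := by
    obtain ⟨i, hi⟩ := hT.exists_graded_of_irreducible (irreducible_irrObj l)
    exact ⟨i, (hD i).nonempty_iso_of_irreducible hi (irreducible_irrObj l)⟩
  refine ⟨fun l m hlm => ?_, fun l => ?_, fun l f => ?_,
    fun X => ?_, hS.hom_finite, hS.ext_finite⟩
  · by_contra hP
    refine hlm (.single ⟨_, _, _, _, irrClass_irrObj m, irrClass_irrObj l, fun hP' => hP ?_⟩)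
    exact rightPerp_iff.1 hP' _ ((ObjectProperty.singleton_iff _ _).2 rfl)
  · obtain ⟨i, ⟨e⟩⟩ := key l
    exact (isFullyExact_extZero_left _).of_iso e ((isFullyExact_extZero_right _).of_iso e
      ((hD i).extZero (hT.isFullyExact_graded i)))
  · obtain ⟨i, ⟨e⟩⟩ := key l
    obtain ⟨c, hc⟩ := (hD i).endo (e.hom ≫ f ≫ e.inv)
    refine ⟨c, ?_⟩
    have := e.inv ≫= hc =≫ e.hom
    simpa using this
  · refine hT.generates hD X _ (S.isFullyExact_extClosure _) ?_
    rintro _ ⟨i, rfl⟩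
    have hi := hT.irreducible (hD i)
    obtain ⟨e⟩ := irrClass_eq_iff.1 (irrClass_irrObj (S.irrClass (D i) hi))
    exact (S.isFullyExact_extClosure _).of_iso e (le_extClosure _ _ ⟨_, rfl⟩)

lemma IsThin.exists_rank {k : Type w} [Field k] [Linear k C] (hS : S.IsThin k) :
    ∃ (n : ℕ) (r : S.Irr → Fin n), Function.Injective r ∧
      (∀ l m, S.canonicalLE l m → r l ≤ r m) := by
  obtain ⟨n, T, hT⟩ := hS.exists_filtration
  exact ⟨n, hT.exists_rank⟩

lemma generatedBy_eq_filt (I : Set S.Irr) : S.generatedBy I = S.filt S.irrObj I := by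
  refine le_antisymm ?_ ?_
  · intro X hX
    refine hX _ (isFullyExact_filt I) ?_
    rintro E ⟨hE, hEI⟩
    obtain ⟨e⟩ := irrClass_eq_iff.1 (irrClass_irrObj (S.irrClass E hE))
    exact (isFullyExact_filt I).of_iso e (filt_of_mem hEI)
  · refine extClosure_mono ?_
    rintro _ ⟨l, hl, rfl⟩
    exact ⟨irreducible_irrObj l, by rwa [irrClass_irrObj]⟩

end

/-! ### Extension of functors from projective objects -/

section

variable {C : Type u} [Category.{v} C] [Preadditive C] {S : ExactStructure C}
  {B : Type u'} [Category.{v'} B] [Abelian B]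

lemma rightExact.map_epi {F : C ⥤ B} (hF : S.rightExact B F) {Y Z : C} {d : Y ⟶ Z}
    (hd : S.IsDeflation d) : Epi (F.map d) := by
  obtain ⟨X, i, w, h⟩ := hd
  exact (hF.2 _ h).2

lemma rightExact.exists_desc {F : C ⥤ B} (hF : S.rightExact B F) {X Y Z : C} {i : X ⟶ Y}
    {d : Y ⟶ Z} (h : S.IsConf i d) {T : B} (t : F.obj Y ⟶ T) (ht : F.map i ≫ t = 0) :
    ∃ s : F.obj Z ⟶ T, F.map d ≫ s = t := by
  obtain ⟨_, hF⟩ := hF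
  obtain ⟨h₁, h₂⟩ := hF _ h.2
  have : Epi ((ShortComplex.mk i d h.1).map F).g := h₂
  exact ⟨h₁.desc t ht, h₁.g_desc t ht⟩

variable {D : Type*} [Category* D]

/-- A natural transformation between restrictions of right exact functors to projective objects
extends uniquely, if there are enough projective objects. -/
lemma existsUnique_natTrans (Q : D ⥤ C) [Q.Full] (hQ : ∀ d, S.IsProj (Q.obj d))
    (hQ' : ∀ X, ∃ (d : D) (p : Q.obj d ⟶ X), S.IsDeflation p) {F F' : C ⥤ B}
    (hF : S.rightExact B F) (hF' : S.rightExact B F') (α : Q ⋙ F ⟶ Q ⋙ F') :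
    ∃! φ : F ⟶ F', Functor.whiskerLeft Q φ = α := by
  have hu {X : C} {T : B} (a b : F.obj X ⟶ T) (hab : ∀ (d : D) (p : Q.obj d ⟶ X),
      F.map p ≫ a = F.map p ≫ b) : a = b := by
    obtain ⟨d, p, hp⟩ := hQ' X
    have := hF.map_epi hp
    exact (cancel_epi (F.map p)).1 (hab d p)
  have key (X : C) : ∃ φ : F.obj X ⟶ F'.obj X, ∀ (d : D) (p : Q.obj d ⟶ X),
      F.map p ≫ φ = α.app d ≫ F'.map p := by
    have := hF.1
    have := hF'.1
    obtain ⟨d₀, p₀, hp₀⟩ := hQ' X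
    obtain ⟨K, i, hc⟩ := IsDeflation.exists_isConf hp₀
    obtain ⟨φ, hφ⟩ := hF.exists_desc hc (α.app d₀ ≫ F'.map p₀) (by
      refine hu _ 0 fun d p => ?_
      obtain ⟨h, hh⟩ := Q.map_surjective (p ≫ i)
      have hα : F.map (Q.map h) ≫ α.app d₀ = α.app d ≫ F'.map (Q.map h) := α.naturality h
      rw [comp_zero, ← Category.assoc, ← F.map_comp, ← hh, reassoc_of% hα,
        ← F'.map_comp, hh, Category.assoc, hc.w, comp_zero, F'.map_zero, comp_zero])
    refine ⟨φ, fun d p => ?_⟩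
    obtain ⟨g, hg⟩ := (hQ d).exists_lift hp₀ p
    obtain ⟨h, rfl⟩ := Q.map_surjective g
    have hα : F.map (Q.map h) ≫ α.app d₀ = α.app d ≫ F'.map (Q.map h) := α.naturality h
    rw [← hg, F.map_comp, Category.assoc, hφ, reassoc_of% hα, F'.map_comp]
  choose φ hφ using key
  refine ⟨⟨φ, fun X Y f => hu _ _ fun d p => ?_⟩, ?_, fun ψ hψ => ?_⟩
  · rw [← Category.assoc, ← F.map_comp, hφ, reassoc_of% hφ, F'.map_comp]
  · ext d
    have := hφ (Q.obj d) d (𝟙 _)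
    simpa using this
  · ext X
    refine hu _ _ fun d p => ?_
    rw [hφ, ← hψ]
    simp

lemma isProj_ofAbelian {A : Type*} [Category* A] [Abelian A] {P : A} (hP : Projective P) :
    (ofAbelian A).IsProj P := by
  refine fun Y => extZero_iff_section.2 fun M i d hc => ?_
  have := hc.epi
  exact ⟨Projective.factorThru (𝟙 P) d, Projective.factorThru_comp _ _⟩

lemma isConf_ofAbelian {A : Type*} [Category* A] [Abelian A] {X Y : A} (p : X ⟶ Y) [Epi p] :
    (ofAbelian A).IsConf (kernel.ι p) p :=
  ⟨kernel.condition p,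
    { exact := ShortComplex.exact_of_f_is_kernel _ (kernelIsKernel _)
      mono_f := inferInstanceAs (Mono (kernel.ι _))
      epi_g := ‹Epi p› }⟩

/-! ### Right exact extensions of additive functors on projective generators -/

section

variable {A : Type*} [Category* A] [Abelian A]

/-- A family of morphisms `F d ⟶ b` indexed by the morphisms `Q d ⟶ M`, additive and natural
in `d`. -/
structure IsFamily (Q : D ⥤ A) (F : D ⥤ B) {M : A} {b : B}
    (γ : ∀ d, (Q.obj d ⟶ M) → (F.obj d ⟶ b)) : Prop where
  map_add : ∀ {d} (p q : Q.obj d ⟶ M), γ d (p + q) = γ d p + γ d q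
  map_comp : ∀ {d d'} (h : d' ⟶ d) (p : Q.obj d ⟶ M), γ d' (Q.map h ≫ p) = F.map h ≫ γ d p

variable {Q : D ⥤ A} {F : D ⥤ B}

lemma IsFamily.map_zero {M : A} {b : B} {γ : ∀ d, (Q.obj d ⟶ M) → (F.obj d ⟶ b)}
    (hγ : IsFamily Q F γ) (d : D) : γ d 0 = 0 := by
  have := hγ.map_add (0 : Q.obj d ⟶ M) 0
  simpa using this

lemma IsFamily.map_sub {M : A} {b : B} {γ : ∀ d, (Q.obj d ⟶ M) → (F.obj d ⟶ b)}
    (hγ : IsFamily Q F γ) {d : D} (p q : Q.obj d ⟶ M) : γ d (p - q) = γ d p - γ d q := by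
  rw [eq_sub_iff_add_eq, ← hγ.map_add, sub_add_cancel]

lemma IsFamily.comp {M : A} {b b' : B} {γ : ∀ d, (Q.obj d ⟶ M) → (F.obj d ⟶ b)}
    (hγ : IsFamily Q F γ) (t : b ⟶ b') : IsFamily Q F (fun d p => γ d p ≫ t) :=
  ⟨fun p q => by rw [hγ.map_add, Preadditive.add_comp],
    fun h p => by rw [hγ.map_comp, Category.assoc]⟩

lemma IsFamily.precomp {M M' : A} {b : B} {γ : ∀ d, (Q.obj d ⟶ M) → (F.obj d ⟶ b)}
    (hγ : IsFamily Q F γ) (f : M' ⟶ M) :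
    IsFamily Q F (fun d (p : Q.obj d ⟶ M') => γ d (p ≫ f)) :=
  ⟨fun p q => by rw [Preadditive.add_comp, hγ.map_add],
    fun h p => by rw [Category.assoc, hγ.map_comp]⟩

variable [Preadditive D] [Q.Full] [Q.Faithful] [Q.Additive] (hQ : ∀ d, Projective (Q.obj d))
  (hQ' : ∀ M, ∃ (d : D) (p : Q.obj d ⟶ M), Epi p)
include hQ hQ'

/-- There is a universal family: its target is the cokernel of `F d₁ ⟶ F d₀`, for a projective
presentation `Q d₁ ⟶ Q d₀ ⟶ M`. -/
lemma exists_universal_family (F : D ⥤ B) [F.Additive] (M : A) :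
    ∃ (G : B) (γ : ∀ d, (Q.obj d ⟶ M) → (F.obj d ⟶ G)), IsFamily Q F γ ∧
      ∀ (b : B) (δ : ∀ d, (Q.obj d ⟶ M) → (F.obj d ⟶ b)), IsFamily Q F δ →
        ∃! m : G ⟶ b, ∀ d p, γ d p ≫ m = δ d p := by
  obtain ⟨d₀, p₀, _⟩ := hQ' M
  obtain ⟨d₁, p₁, _⟩ := hQ' (kernel p₀)
  obtain ⟨h, hh⟩ := Q.map_surjective (p₁ ≫ kernel.ι p₀)
  have hlift {d : D} (p : Q.obj d ⟶ M) : ∃ l : d ⟶ d₀, Q.map l ≫ p₀ = p := by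
    obtain ⟨l, hl⟩ := Q.map_surjective (Projective.factorThru p p₀)
    exact ⟨l, by rw [hl, Projective.factorThru_comp]⟩
  have hker {d : D} (l : d ⟶ d₀) (hl : Q.map l ≫ p₀ = 0) : F.map l ≫ cokernel.π (F.map h) = 0 := by
    obtain ⟨g, hg⟩ := Q.map_surjective (Projective.factorThru (kernel.lift p₀ _ hl) p₁)
    have : l = g ≫ h := Q.map_injective (by
      rw [Q.map_comp, hg, hh, Projective.factorThru_comp_assoc, kernel.lift_ι])
    rw [this, F.map_comp, Category.assoc, cokernel.condition, comp_zero]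
  choose l hl using @hlift
  have hγ {d : D} {p : Q.obj d ⟶ M} (m : d ⟶ d₀) (hm : Q.map m ≫ p₀ = p) :
      F.map (l p) ≫ cokernel.π (F.map h) = F.map m ≫ cokernel.π (F.map h) := by
    rw [← sub_eq_zero, ← Preadditive.sub_comp, ← F.map_sub]
    exact hker _ (by rw [Q.map_sub, Preadditive.sub_comp, hl, hm, sub_self])
  refine ⟨cokernel (F.map h), fun d p => F.map (l p) ≫ cokernel.π (F.map h),
    ⟨fun p q => ?_, fun f p => ?_⟩, fun b δ hδ => ?_⟩
  · rw [hγ (l p + l q) (by rw [Q.map_add, Preadditive.add_comp, hl, hl]), F.map_add,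
      Preadditive.add_comp]
  · rw [hγ (f ≫ l p) (by rw [Q.map_comp, Category.assoc, hl]), F.map_comp, Category.assoc]
  · refine ⟨cokernel.desc _ (δ d₀ p₀) ?_, fun d p => ?_, fun m hm => ?_⟩
    · rw [← hδ.map_comp, hh, Category.assoc, kernel.condition, comp_zero, hδ.map_zero]
    · rw [Category.assoc, cokernel.π_desc, ← hδ.map_comp, hl]
    · have h₁ := hm d₀ p₀
      dsimp at h₁
      rw [hγ (𝟙 d₀) (by simp), F.map_id, Category.id_comp] at h₁
      rw [← cancel_epi (cokernel.π (F.map h)), h₁, cokernel.π_desc]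

/-- An additive functor from a category of projective generators of an abelian category extends to a
right exact functor. -/
lemma exists_extension (F : D ⥤ B) [F.Additive] :
    ∃ G : A ⥤ B, (ofAbelian A).rightExact B G ∧ Nonempty (Q ⋙ G ≅ F) := by
  choose G γ hγ huniv using exists_universal_family hQ hQ' F
  have hext {M : A} {b : B} {t t' : G M ⟶ b}
      (h : ∀ d (p : Q.obj d ⟶ M), γ M d p ≫ t = γ M d p ≫ t') :
      t = t' :=
    (huniv M b _ ((hγ M).comp t')).unique h fun _ _ => rfl
  -- the extension is functorial by the universal property of the families `γ M`
  choose m hm using fun M M' (f : M ⟶ M') => (huniv M _ _ ((hγ M').precomp f)).exists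
  let G' : A ⥤ B :=
    { obj := G
      map := fun f => m _ _ f
      map_id := fun M => hext fun d p => by rw [hm]; simp
      map_comp := fun f g => hext fun d p => by rw [hm, reassoc_of% hm, hm, Category.assoc] }
  have hG' {M M' : A} (f : M ⟶ M') (d) (p : Q.obj d ⟶ M) : γ M d p ≫ G'.map f = γ M' d (p ≫ f) :=
    hm M M' f d p
  have hadd : G'.Additive := ⟨fun {M M' f g} => hext fun d p => by
    rw [hG', Preadditive.comp_add, Preadditive.comp_add, (hγ M').map_add, hG', hG']⟩
  refine ⟨G', ⟨hadd, fun K hK => ?_⟩, ⟨NatIso.ofComponents (fun d => ?_) ?_⟩⟩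
  · have hK : K.ShortExact := hK
    have := hK.epi_g
    have := hK.mono_f
    have hlift {d : D} (p : Q.obj d ⟶ K.X₃) : ∃ l : Q.obj d ⟶ K.X₂, l ≫ K.g = p :=
      ⟨Projective.factorThru p K.g, Projective.factorThru_comp _ _⟩
    have hepi : Epi (G'.map K.g) := by
      refine Preadditive.epi_of_cancel_zero _ fun {b} t ht => hext fun d p => ?_
      obtain ⟨l, rfl⟩ := hlift p
      rw [← hG', Category.assoc, ht, comp_zero, comp_zero]
    refine ⟨?_, hepi⟩
    have : Epi (K.map G').g := hepi
    have hcok {b : B} (t : G K.X₂ ⟶ b) (ht : m _ _ K.f ≫ t = 0) :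
        ∃ s : G K.X₃ ⟶ b, m _ _ K.g ≫ s = t := by
      choose l hl using @hlift
      have hwd {d : D} {p : Q.obj d ⟶ K.X₃} (l' : Q.obj d ⟶ K.X₂) (hl' : l' ≫ K.g = p) :
          γ _ d (l p) ≫ t = γ _ d l' ≫ t := by
        rw [← sub_eq_zero, ← Preadditive.sub_comp, ← (hγ _).map_sub]
        have : (l p - l') ≫ K.g = 0 := by rw [Preadditive.sub_comp, hl, hl', sub_self]
        rw [← hK.exact.lift_f _ this, ← hm, Category.assoc, ht, comp_zero]
      obtain ⟨s, hs, -⟩ := huniv K.X₃ b (fun d p => γ _ d (l p) ≫ t) ⟨fun {d} p q => by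
          rw [hwd (l p + l q) (by rw [Preadditive.add_comp, hl, hl]), (hγ _).map_add,
            Preadditive.add_comp], fun {d d'} f p => by
          rw [hwd (Q.map f ≫ l p) (by rw [Category.assoc, hl]), (hγ _).map_comp, Category.assoc]⟩
      exact ⟨s, hext fun d p => by rw [← Category.assoc, hm, hs, hwd p rfl]⟩
    refine ShortComplex.exact_of_g_is_cokernel (K.map G') ?_
    exact CokernelCofork.IsColimit.ofπ' _ _ fun {b} t ht => ⟨_, (hcok t ht).choose_spec⟩
  · have hδ : IsFamily Q F (M := Q.obj d) (b := F.obj d) (fun d' p => F.map (Q.preimage p)) :=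
      ⟨fun p q => by
        rw [← F.map_add]
        exact congrArg F.map (Q.map_injective (by simp)),
      fun f p => by
        rw [← F.map_comp]
        exact congrArg F.map (Q.map_injective (by simp))⟩
    have hex := (huniv _ _ _ hδ).exists
    refine ⟨hex.choose, γ _ d (𝟙 _), hext fun d' p => ?_, ?_⟩
    · change γ _ d' p ≫ hex.choose ≫ γ _ d (𝟙 _) = γ _ d' p ≫ 𝟙 _
      rw [← Category.assoc, hex.choose_spec, ← (hγ _).map_comp]
      simp
    · rw [hex.choose_spec]
      exact (congrArg F.map (Q.preimage_id)).trans (F.map_id d)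
  · intro d d' f
    rw [← Iso.eq_comp_inv, Category.assoc, ← Iso.inv_comp_eq]
    change γ _ d (𝟙 _) ≫ G'.map (Q.map f) = F.map f ≫ γ _ d' (𝟙 _)
    rw [hG', ← (hγ _).map_comp]
    simp

end

end

/-! ### Projective models of right abelian envelopes -/

section

variable {C : Type u} [Category.{v} C] [Preadditive C]

/-- A fully faithful right exact functor to an abelian category which sends projective objects to
projective objects, such that any object is a quotient of the image of a projective object. -/
structure IsProjectiveModel (S : ExactStructure C) {A : Type u'} [Category.{v'} A] [Abelian A]
    (i : C ⥤ A) : Prop where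
  rightExact : S.rightExact A i
  full : i.Full
  faithful : i.Faithful
  projective : ∀ P, S.IsProj P → Projective (i.obj P)
  exists_epi : ∀ M, ∃ (P : C) (_ : S.IsProj P) (p : i.obj P ⟶ M), Epi p

/-- There are enough projective objects. -/
def HasEnoughProj (S : ExactStructure C) : Prop :=
  ∀ X, ∃ (P : C) (p : P ⟶ X), S.IsProj P ∧ S.IsDeflation p

variable {S : ExactStructure C} {A : Type u'} [Category.{v'} A] [Abelian A] {i : C ⥤ A}

/-- Right exact functors on `C`, and on `A`, are determined by their restrictions to the projective
objects of `C`, which may be any additive functors. -/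
lemma IsProjectiveModel.isRightEnvelope (hi : S.IsProjectiveModel i) (hS : S.HasEnoughProj) :
    S.IsRightEnvelope i where
  rightExact := hi.rightExact
  isEquivalence B _ _ := by
    have := hi.full
    have := hi.faithful
    have := hi.rightExact.1
    let P : ObjectProperty C := S.IsProj
    have h₁ (X : C) : ∃ (d : P.FullSubcategory) (p : P.ι.obj d ⟶ X), S.IsDeflation p := by
      obtain ⟨Q, p, hQ, hp⟩ := hS X
      exact ⟨⟨Q, hQ⟩, p, hp⟩
    have h₂ (M : A) : ∃ (d : P.FullSubcategory) (p : (P.ι ⋙ i).obj d ⟶ M), Epi p := by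
      obtain ⟨Q, hQ, p, hp⟩ := hi.exists_epi M
      exact ⟨⟨Q, hQ⟩, p, hp⟩
    have h₂' (M : A) : ∃ (d : P.FullSubcategory) (p : (P.ι ⋙ i).obj d ⟶ M),
        (ofAbelian A).IsDeflation p := by
      obtain ⟨d, p, hp⟩ := h₂ M
      exact ⟨d, p, (isConf_ofAbelian p).deflation⟩
    have hproj (d : P.FullSubcategory) : Projective ((P.ι ⋙ i).obj d) :=
      hi.projective _ d.property
    -- natural transformations of functors on `C`, and on `A`, are determined on projectives
    have hC {F F' : C ⥤ B} (hF : S.rightExact B F) (hF' : S.rightExact B F') :=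
      existsUnique_natTrans (S := S) P.ι (fun d => d.property) h₁ hF hF'
    have hA {G G' : A ⥤ B} (hG : (ofAbelian A).rightExact B G)
        (hG' : (ofAbelian A).rightExact B G') :=
      existsUnique_natTrans (S := ofAbelian A) (P.ι ⋙ i) (fun d => isProj_ofAbelian (hproj d)) h₂'
        hG hG'
    refine { faithful := ⟨?_⟩, full := ⟨?_⟩, essSurj := ⟨?_⟩ }
    · intro G G' φ ψ h
      have h : Functor.whiskerLeft i φ.hom = Functor.whiskerLeft i ψ.hom := congrArg (·.hom) h
      refine ObjectProperty.hom_ext _ ((hA G.property G'.property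
        (Functor.whiskerLeft (P.ι ⋙ i) φ.hom)).unique rfl ?_)
      exact congrArg (Functor.whiskerLeft P.ι) h.symm
    · intro G G' φ
      let φ' : i ⋙ G.obj ⟶ i ⋙ G'.obj := φ.hom
      obtain ⟨ψ, hψ, -⟩ := hA G.property G'.property (Functor.whiskerLeft P.ι φ')
      refine ⟨ObjectProperty.homMk ψ, ObjectProperty.hom_ext _ ?_⟩
      exact (hC (S.rightExact_comp hi.rightExact G.property)
        (S.rightExact_comp hi.rightExact G'.property) (Functor.whiskerLeft P.ι φ')).unique hψ rfl
    · intro F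
      have := F.property.1
      obtain ⟨G, hG, ⟨e⟩⟩ := exists_extension (Q := P.ι ⋙ i) hproj h₂ (P.ι ⋙ F.obj)
      have hiG := S.rightExact_comp hi.rightExact hG
      obtain ⟨φ, hφ, -⟩ := hC hiG F.property e.hom
      obtain ⟨ψ, hψ, -⟩ := hC F.property hiG e.inv
      have hφψ : φ ≫ ψ = 𝟙 (i ⋙ G) := by
        refine (hC hiG hiG (𝟙 _)).unique ?_ (Functor.whiskerLeft_id _)
        rw [Functor.whiskerLeft_comp, hφ, hψ]
        exact e.hom_inv_id
      have hψφ : ψ ≫ φ = 𝟙 F.obj := by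
        refine (hC F.property F.property (𝟙 _)).unique ?_ (Functor.whiskerLeft_id _)
        rw [Functor.whiskerLeft_comp, hφ, hψ]
        exact e.inv_hom_id
      exact ⟨⟨G, hG⟩, ⟨ObjectProperty.isoMk _ ⟨φ, ψ, hφψ, hψφ⟩⟩⟩

end

/-! ### Finitely generated modules over a Noetherian ring -/

section

variable (R : Type v) [Ring R] [IsNoetherianRing R]

instance : (ModuleCat.isFG.{v} R).IsClosedUnderSubobjects where
  prop_of_mono {X Y} f _ hY := by
    have : Module.Finite R Y := hY
    exact Module.Finite.of_injective f.hom ((ModuleCat.mono_iff_injective f).1 inferInstance)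

instance : (ModuleCat.isFG.{v} R).IsClosedUnderQuotients where
  prop_of_epi {X Y} f _ hX := by
    have : Module.Finite R X := hX
    exact Module.Finite.of_surjective f.hom ((ModuleCat.epi_iff_surjective f).1 inferInstance)

instance : (ModuleCat.isFG.{v} R).IsClosedUnderFiniteProducts where
  isClosedUnderLimitsOfShape J _ := ⟨fun X ⟨p⟩ => by
    have (j : J) : Module.Finite R (p.diag.obj ⟨j⟩) := p.prop_diag_obj ⟨j⟩
    let f : X ⟶ ModuleCat.of R (∀ j : J, p.diag.obj ⟨j⟩) :=
      ModuleCat.ofHom (LinearMap.pi fun j => (p.π.app ⟨j⟩).hom)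
    have hf : Mono f := ⟨fun {Z} g h hgh => p.isLimit.hom_ext fun ⟨j⟩ =>
      congrArg (· ≫ ModuleCat.ofHom (LinearMap.proj j)) hgh⟩
    exact ObjectProperty.prop_of_mono _ f (inferInstanceAs (Module.Finite R (∀ j : J, _)))⟩

instance : (ModuleCat.isFG.{v} R).ContainsZero where
  exists_zero := ⟨ModuleCat.of R PUnit.{v+1}, ModuleCat.isZero_of_subsingleton _,
    inferInstanceAs (Module.Finite R PUnit.{v+1})⟩

omit [IsNoetherianRing R] in
lemma fgModuleCat_surjective_of_epi {M N : FGModuleCat.{v} R} (f : M ⟶ N) [Epi f] :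
    Function.Surjective f.hom.hom := by
  have := (ModuleCat.isFG.{v} R).preservesEpimorphisms_ι_of_isNormalMonoCategory
  exact (ModuleCat.epi_iff_surjective f.hom).1 (inferInstanceAs (Epi ((ModuleCat.isFG R).ι.map f)))

omit [IsNoetherianRing R] in
lemma fgModuleCat_epi_of_surjective {M N : FGModuleCat.{v} R} (f : M ⟶ N)
    (hf : Function.Surjective f.hom.hom) : Epi f := by
  have : Epi ((ModuleCat.isFG R).ι.map f) := (ModuleCat.epi_iff_surjective f.hom).2 hf
  exact (ModuleCat.isFG R).ι.epi_of_epi_map this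

end

/-! ### The module category of a projective generator -/

section

variable {C : Type u} [Category.{v} C] [Preadditive C]

/-- `P` is projective, and all objects are quotients of direct summands of sums of copies of `P`. -/
structure IsProjGenerator (S : ExactStructure C) (P : C) : Prop where
  isProj : S.IsProj P
  exists_deflation : ∀ X, ∃ (Y : C) (d : Y ⟶ X), S.IsDeflation d ∧ InAdd P Y

variable {S : ExactStructure C} {P : C}

lemma IsProjGenerator.hasEnoughProj (hP : S.IsProjGenerator P) : S.HasEnoughProj := fun X => by
  obtain ⟨Y, d, hd, hY⟩ := hP.exists_deflation X
  exact ⟨Y, d, hP.isProj.of_inAdd hY, hd⟩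

lemma IsProjGenerator.inAdd (hP : S.IsProjGenerator P) {Q : C} (hQ : S.IsProj Q) : InAdd P Q := by
  obtain ⟨Y, d, hd, hY⟩ := hP.exists_deflation Q
  obtain ⟨s, hs⟩ := hQ.exists_lift hd (𝟙 Q)
  exact hY.trans (.of_retract s d hs)

lemma IsProjGenerator.hom_ext (hP : S.IsProjGenerator P) {X Y : C} {f g : X ⟶ Y}
    (h : ∀ x : P ⟶ X, x ≫ f = x ≫ g) : f = g := by
  obtain ⟨Q, d, hd, J, _, p, q, hpq⟩ := hP.exists_deflation X
  obtain ⟨K, i, hc⟩ := IsDeflation.exists_isConf hd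
  have := hc.epi
  have key : (∑ a, p a ≫ q a) ≫ d ≫ f = (∑ a, p a ≫ q a) ≫ d ≫ g := by
    simp only [Preadditive.sum_comp, Category.assoc]
    refine Finset.sum_congr rfl fun a _ => ?_
    have := h (q a ≫ d)
    simp only [Category.assoc] at this
    rw [this]
  rw [hpq] at key
  simpa [cancel_epi] using key

/-- Morphisms `X ⟶ Y` are `End P`-linear maps `Hom(P, X) → Hom(P, Y)`. -/
lemma IsProjGenerator.exists_hom (hP : S.IsProjGenerator P) {X Y : C}
    (φ : (P ⟶ X) → (P ⟶ Y)) (hadd : ∀ x x', φ (x + x') = φ x + φ x')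
    (hcomp : ∀ (r : P ⟶ P) x, φ (r ≫ x) = r ≫ φ x) : ∃ f : X ⟶ Y, ∀ x, x ≫ f = φ x := by
  obtain ⟨Q, d, hd, J, _, p, q, hpq⟩ := hP.exists_deflation X
  obtain ⟨K, i, hc⟩ := IsDeflation.exists_isConf hd
  let g : Q ⟶ Y := ∑ a, p a ≫ φ (q a ≫ d)
  have hg (y : P ⟶ Q) : y ≫ g = φ (y ≫ d) := by
    let Φ : (P ⟶ X) →+ (P ⟶ Y) := AddMonoidHom.mk' φ hadd
    have h₁ : y ≫ d = ∑ a, (y ≫ p a) ≫ q a ≫ d := by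
      calc y ≫ d = y ≫ (∑ a, p a ≫ q a) ≫ d := by rw [hpq, Category.id_comp]
        _ = _ := by simp [Preadditive.sum_comp, Preadditive.comp_sum]
    rw [h₁]
    refine Eq.trans ?_ (map_sum Φ _ _).symm
    simp only [g, Preadditive.comp_sum]
    refine Finset.sum_congr rfl fun a _ => ?_
    exact (Category.assoc _ _ _).symm.trans (hcomp _ _).symm
  have hφ0 : φ 0 = 0 := by
    have := hadd 0 0
    simpa using this
  obtain ⟨f, hf⟩ := hc.desc g (hP.hom_ext fun x => by
    rw [← Category.assoc, hg, Category.assoc, hc.w, comp_zero, hφ0, comp_zero])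
  refine ⟨f, fun x => ?_⟩
  obtain ⟨y, rfl⟩ := hP.isProj.exists_lift hd x
  rw [Category.assoc, hf, hg]

/-- A linear map from `Hom(P, Q)`, for `Q` in `add P`, with prescribed values on generators. -/
lemma exists_linearMap {Q : C} {J : Type} [Fintype J] (p : J → (Q ⟶ P)) {M : Type v}
    [AddCommGroup M] [Module (End P)ᵐᵒᵖ M] (m : J → M) :
    ∃ φ : (preadditiveCoyonedaObj P).obj Q →ₗ[(End P)ᵐᵒᵖ] M,
      ∀ x : P ⟶ Q, φ x = ∑ a, @MulOpposite.op (End P) (x ≫ p a) • m a := by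
  refine ⟨⟨⟨fun x : P ⟶ Q => ∑ a, @MulOpposite.op (End P) (x ≫ p a) • m a, fun x y => ?_⟩,
    fun r x => ?_⟩, fun x => rfl⟩
  · rw [← Finset.sum_add_distrib]
    refine Finset.sum_congr rfl fun a _ => ?_
    rw [← add_smul, ← MulOpposite.op_add]
    exact congrArg (fun t : End P => MulOpposite.op t • m a) (Preadditive.add_comp _ _ _ _ _ _)
  · dsimp only [RingHom.id_apply]
    rw [Finset.smul_sum]
    refine Finset.sum_congr rfl fun a _ => ?_
    rw [smul_smul, ← MulOpposite.op_unop r, ← MulOpposite.op_mul]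
    exact congrArg (fun t : End P => MulOpposite.op t • m a) (Category.assoc _ _ _)

/-- A morphism `P ⟶ X` which factors through `Q` in `add P` is a linear combination of the images of
the generators of `Hom(P, Q)`. -/
lemma sum_smul_coyoneda {X Q : C} {J : Type} [Fintype J] (p : J → (Q ⟶ P)) (q : J → (P ⟶ Q))
    (hpq : ∑ a, p a ≫ q a = 𝟙 Q) (d : Q ⟶ X) (y : P ⟶ Q) :
    (∑ a, @MulOpposite.op (End P) (y ≫ p a) •
      (show (preadditiveCoyonedaObj P).obj X from q a ≫ d)) = y ≫ d := by
  calc _ = ∑ a, (y ≫ p a) ≫ q a ≫ d := rfl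
    _ = y ≫ (∑ a, p a ≫ q a) ≫ d := by simp [Preadditive.sum_comp, Preadditive.comp_sum]
    _ = _ := by rw [hpq, Category.id_comp]

lemma IsProjGenerator.finite (hP : S.IsProjGenerator P) (X : C) :
    ModuleCat.isFG _ ((preadditiveCoyonedaObj P).obj X) := by
  obtain ⟨Q, d, hd, J, _, p, q, hpq⟩ := hP.exists_deflation X
  refine Module.Finite.of_surjective (Fintype.linearCombination (End P)ᵐᵒᵖ
    (fun a => show (preadditiveCoyonedaObj P).obj X from q a ≫ d)) fun x => ?_
  obtain ⟨y, hy⟩ := hP.isProj.exists_lift hd x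
  refine ⟨fun a => @MulOpposite.op (End P) (y ≫ p a), ?_⟩
  exact (Fintype.linearCombination_apply _ _ _).trans ((sum_smul_coyoneda p q hpq d y).trans hy)

/-- The functor `Hom(P, -)` to finitely generated modules over `(End P)ᵐᵒᵖ`. -/
noncomputable def IsProjGenerator.functor (hP : S.IsProjGenerator P) :
    C ⥤ FGModuleCat.{v} (End P)ᵐᵒᵖ :=
  (ModuleCat.isFG _).lift (preadditiveCoyonedaObj P) hP.finite

instance (hP : S.IsProjGenerator P) : hP.functor.Additive :=
  ⟨fun {_ _ _ _} => ObjectProperty.hom_ext _ ((preadditiveCoyonedaObj P).map_add)⟩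

lemma fgModuleCat_hom_ext {R : Type v} [Ring R] {M N : FGModuleCat.{v} R} {f g : M ⟶ N}
    (h : ∀ x, f.hom.hom x = g.hom.hom x) : f = g :=
  ObjectProperty.hom_ext _ (ModuleCat.hom_ext (LinearMap.ext h))

/-- The functor `Hom(P, -)` is right exact since `P` is projective; a conflation is even sent to a
short exact sequence. -/
lemma IsProjGenerator.rightExact_functor [IsNoetherianRing (End P)ᵐᵒᵖ] (hP : S.IsProjGenerator P) :
    S.rightExact _ hP.functor := by
  refine ⟨inferInstance, fun K hK => ⟨?_, fgModuleCat_epi_of_surjective _ _ fun x => ?_⟩⟩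
  · have hc : S.IsConf K.f K.g := ⟨K.zero, hK⟩
    have := hc.mono
    have : Mono (K.map hP.functor).f := Preadditive.mono_of_cancel_zero _ fun {T} t ht =>
      fgModuleCat_hom_ext fun x => by
        have h : (t.hom.hom x : P ⟶ K.X₁) ≫ K.f = 0 := congrArg (fun g => g.hom.hom x) ht
        exact (cancel_mono K.f).1 (h.trans zero_comp.symm)
    refine ShortComplex.exact_of_f_is_kernel _ (KernelFork.IsLimit.ofι' _ _ fun {T} t ht => ?_)
    choose s hs using fun x => hc.lift (t.hom.hom x : P ⟶ K.X₂) (congrArg (fun g => g.hom.hom x) ht)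
    refine ⟨ObjectProperty.homMk (ModuleCat.ofHom ⟨⟨s, fun x y => ?_⟩, fun r x => ?_⟩),
      fgModuleCat_hom_ext hs⟩
    · refine (cancel_mono K.f).1 ((hs _).trans ?_)
      rw [map_add]
      exact Eq.trans (congrArg₂ (· + ·) (hs x).symm (hs y).symm)
        (Preadditive.add_comp _ _ _ _ _ _).symm
    · refine (cancel_mono K.f).1 ((hs _).trans ?_)
      rw [map_smul]
      exact Eq.trans (congrArg (r.unop ≫ ·) (hs x).symm) (Category.assoc _ _ _).symm
  · obtain ⟨y, hy⟩ := hP.isProj.exists_lift ⟨_, _, _, hK⟩ (x : P ⟶ K.X₃)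
    exact ⟨y, hy⟩

instance (hP : S.IsProjGenerator P) : hP.functor.Full :=
  ⟨fun {X Y} f => by
    obtain ⟨g, hg⟩ := hP.exists_hom (X := X) (Y := Y) f.hom.hom (map_add _)
      (fun r x => map_smul f.hom.hom (MulOpposite.op (show End P from r)) x)
    exact ⟨g, fgModuleCat_hom_ext hg⟩⟩

instance (hP : S.IsProjGenerator P) : hP.functor.Faithful :=
  ⟨fun h => hP.hom_ext fun x => congrArg (fun g => g.hom.hom x) h⟩

/-- The sum of copies of `P` indexed by a finite set. -/
lemma exists_finite_sum (S : ExactStructure C) (P : C) {J : Type*} [DecidableEq J] (s : Finset J) :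
    ∃ (Q : C) (p : J → (Q ⟶ P)) (q : J → (P ⟶ Q)), ∑ a ∈ s, p a ≫ q a = 𝟙 Q ∧
      (∀ a ∈ s, ∀ b ∈ s, q a ≫ p b = if a = b then 𝟙 P else 0) ∧
      ∀ T : ObjectProperty C, S.IsFullyExact T → T P → T Q := by
  have := S.hasZeroObject
  have := S.hasBinaryBiproducts
  induction s using Finset.induction_on with
  | empty =>
    obtain ⟨O, hO⟩ := HasZeroObject.zero (C := C)
    exact ⟨O, 0, 0, hO.eq_of_src _ _, by simp, fun T hT _ => hT.zero O hO⟩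
  | insert c s hc ih =>
    obtain ⟨Q, p, q, hpq, hqp, hQ⟩ := ih
    have hne {a : J} (ha : a ∈ s) : a ≠ c := fun h => hc (h ▸ ha)
    refine ⟨P ⊞ Q, fun a => if a = c then biprod.fst else biprod.snd ≫ p a,
      fun a => if a = c then biprod.inl else q a ≫ biprod.inr, ?_, fun a ha b hb => ?_,
      fun T hT hP => hT.biprod hP (hQ T hT hP)⟩
    · dsimp only
      rw [Finset.sum_insert hc, if_pos rfl, if_pos rfl, ← biprod.total]
      congr 1
      calc _ = ∑ a ∈ s, biprod.snd ≫ (p a ≫ q a) ≫ biprod.inr := by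
            refine Finset.sum_congr rfl fun a ha => ?_
            rw [if_neg (hne ha), if_neg (hne ha)]
            simp
        _ = biprod.snd ≫ (∑ a ∈ s, p a ≫ q a) ≫ biprod.inr := by
            simp [Preadditive.sum_comp, Preadditive.comp_sum]
        _ = _ := by rw [hpq, Category.id_comp]
    · rcases Finset.mem_insert.1 ha with rfl | ha' <;> rcases Finset.mem_insert.1 hb with rfl | hb'
      · simp
      · simp [hne hb', (hne hb').symm]
      · simp [hne ha']
      · simp [hne ha', hne hb', hqp a ha' b hb']

/-- Finitely generated modules over `(End P)ᵐᵒᵖ` are quotients of the free modules `Hom(P, Pⁿ)`. -/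
lemma IsProjGenerator.isProjectiveModel [IsNoetherianRing (End P)ᵐᵒᵖ] (hP : S.IsProjGenerator P) :
    S.IsProjectiveModel hP.functor where
  rightExact := hP.rightExact_functor
  full := inferInstance
  faithful := inferInstance
  projective Q hQ := by
    obtain ⟨J, _, p, q, hpq⟩ := hP.inAdd hQ
    refine ⟨fun {M N} f e _ => ?_⟩
    choose m hm using fun a => fgModuleCat_surjective_of_epi _ e (f.hom.hom (q a : P ⟶ Q))
    obtain ⟨φ, hφ⟩ := exists_linearMap p m
    refine ⟨ObjectProperty.homMk (ModuleCat.ofHom φ), fgModuleCat_hom_ext fun x => ?_⟩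
    refine (congrArg e.hom.hom (hφ x)).trans ?_
    have hx := congrArg f.hom.hom (sum_smul_coyoneda p q hpq (𝟙 Q) x)
    refine Eq.trans ?_ (hx.trans (congrArg f.hom.hom (Category.comp_id x)))
    refine (map_sum e.hom.hom _ _).trans (Eq.trans ?_ (map_sum f.hom.hom _ _).symm)
    refine Finset.sum_congr rfl fun a _ => ?_
    refine (map_smul e.hom.hom _ _).trans (Eq.trans ?_ (map_smul f.hom.hom _ _).symm)
    rw [hm]
    exact congrArg (fun y : P ⟶ Q => MulOpposite.op (show End P from x ≫ p a) • f.hom.hom y)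
      (Category.comp_id _).symm
  exists_epi M := by
    obtain ⟨n, m, hm⟩ := Module.Finite.exists_fin' (End P)ᵐᵒᵖ M
    obtain ⟨Q, p, q, hpq, hqp, -⟩ := S.exists_finite_sum P (Finset.univ : Finset (Fin n))
    have hQ : InAdd P Q := ⟨Fin n, inferInstance, p, q, hpq⟩
    obtain ⟨φ, hφ⟩ := exists_linearMap p (fun a => m (Pi.single a 1))
    refine ⟨Q, hP.isProj.of_inAdd hQ, ObjectProperty.homMk (ModuleCat.ofHom φ),
      fgModuleCat_epi_of_surjective _ _ fun x => ?_⟩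
    obtain ⟨y, rfl⟩ := hm x
    refine ⟨(∑ a, (y a).unop ≫ q a : P ⟶ Q), (hφ _).trans ?_⟩
    refine Eq.trans ?_ (congrArg m (pi_eq_sum_univ' y).symm)
    rw [map_sum]
    refine Finset.sum_congr rfl fun b _ => ?_
    have : (∑ a, (y a).unop ≫ q a : P ⟶ Q) ≫ p b = (y b).unop := by
      rw [Preadditive.sum_comp, Finset.sum_eq_single b]
      · simp [hqp]
      · intro a _ hab
        simp [hqp, hab]
      · simp
    rw [map_smul]
    exact congrArg (fun t : End P => MulOpposite.op t • m (Pi.single b 1)) this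

end

/-! ### Existence and uniqueness of envelopes -/

section

variable {C : Type u} [Category.{v} C] [Preadditive C] {S : ExactStructure C}

lemma IsProjectiveModel.comp_equivalence {A : Type*} [Category* A] [Abelian A] {i : C ⥤ A}
    (hi : S.IsProjectiveModel i) {A' : Type u'} [Category.{v'} A'] [Abelian A'] (F : A ⥤ A')
    [F.IsEquivalence] : S.IsProjectiveModel (i ⋙ F) := by
  have : F.Additive := Functor.additive_of_preserves_binary_products F
  have := hi.full
  have := hi.faithful
  have := hi.rightExact.1
  refine ⟨⟨inferInstance, fun K hK => ?_⟩, inferInstance, inferInstance, fun P hP => ?_, fun M => ?_⟩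
  · obtain ⟨h₁, h₂⟩ := hi.rightExact.2 K hK
    exact ⟨h₁.map F, inferInstanceAs (Epi (F.map (i.map K.g)))⟩
  · exact (F.asEquivalence.map_projective_iff _).2 (hi.projective P hP)
  · obtain ⟨P, hP, p, _⟩ := hi.exists_epi (F.objPreimage M)
    exact ⟨P, hP, F.map p ≫ (F.objObjPreimageIso M).hom, inferInstance⟩

lemma IsProjectiveModel.of_iso {A : Type u'} [Category.{v'} A] [Abelian A] {i j : C ⥤ A}
    (hi : S.IsProjectiveModel i) (e : i ≅ j) : S.IsProjectiveModel j := by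
  have := hi.full
  have := hi.faithful
  have := hi.rightExact.1
  have hj : j.Additive := Functor.additive_of_iso e
  refine ⟨⟨hj, fun K hK => ?_⟩, .of_iso e, .of_iso e, fun P hP => ?_, fun M => ?_⟩
  · obtain ⟨h₁, h₂⟩ := hi.rightExact.2 K hK
    refine ⟨ShortComplex.exact_of_iso (K.mapNatIso e) h₁, ?_⟩
    rw [← NatIso.naturality_1 e]
    infer_instance
  · exact Projective.of_iso (e.app P) (hi.projective P hP)
  · obtain ⟨P, hP, p, _⟩ := hi.exists_epi M
    exact ⟨P, hP, e.inv.app P ≫ p, inferInstance⟩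

/-- Two envelopes of `C` differ by an equivalence. -/
lemma IsRightEnvelope.exists_equivalence {A A' : Type u'} [Category.{v'} A] [Abelian A]
    [Category.{v'} A'] [Abelian A'] {i : C ⥤ A} {j : C ⥤ A'} (hi : S.IsRightEnvelope i)
    (hj : S.IsRightEnvelope j) : ∃ F : A ⥤ A', F.IsEquivalence ∧ Nonempty (i ⋙ F ≅ j) := by
  have key {A A' : Type u'} [Category.{v'} A] [Abelian A]
      [Category.{v'} A'] [Abelian A'] {i : C ⥤ A} {j : C ⥤ A'} (hi : S.IsRightEnvelope i)
      (hj : S.IsRightEnvelope j) :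
      ∃ F : A ⥤ A', (ofAbelian A).rightExact A' F ∧ Nonempty (i ⋙ F ≅ j) := by
    have := hi.isEquivalence A'
    let J : (S.rightExact A').FullSubcategory := ⟨j, hj.rightExact⟩
    let P := S.precomp i hi.rightExact A'
    exact ⟨(P.objPreimage J).obj, (P.objPreimage J).property,
      ⟨(S.rightExact A').ι.mapIso (P.objObjPreimageIso J)⟩⟩
  have key' {A : Type u'} [Category.{v'} A] [Abelian A] {i : C ⥤ A} (hi : S.IsRightEnvelope i)
      {H : A ⥤ A} (hH : (ofAbelian A).rightExact A H) (e : i ⋙ H ≅ i) : Nonempty (H ≅ 𝟭 A) := by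
    have := hi.isEquivalence A
    let P := S.precomp i hi.rightExact A
    have h1 : (ofAbelian A).rightExact A (𝟭 A) :=
      ⟨inferInstance, fun K hK => ⟨ShortComplex.ShortExact.exact hK,
        ShortComplex.ShortExact.epi_g hK⟩⟩
    exact ⟨((ofAbelian A).rightExact A).ι.mapIso (P.preimageIso (X := ⟨H, hH⟩) (Y := ⟨𝟭 A, h1⟩)
      (ObjectProperty.isoMk _ e))⟩
  obtain ⟨F, hF, ⟨e⟩⟩ := key hi hj
  obtain ⟨G, hG, ⟨e'⟩⟩ := key hj hi
  obtain ⟨η⟩ := key' hi ((ofAbelian A).rightExact_comp hF hG)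
    (Functor.isoWhiskerRight e G ≪≫ e')
  obtain ⟨ε⟩ := key' hj ((ofAbelian A').rightExact_comp hG hF)
    (Functor.isoWhiskerRight e' F ≪≫ e)
  exact ⟨F, (CategoryTheory.Equivalence.mk F G η.symm ε).isEquivalence_functor, ⟨e⟩⟩

variable {P : C}

/-- If there is a projective generator with Noetherian endomorphism ring, finitely generated modules
over the latter, up to isomorphism, form a projective model of size `max u v`. -/
lemma IsProjGenerator.exists_isProjectiveModel [IsNoetherianRing (End P)ᵐᵒᵖ]
    (hP : S.IsProjGenerator P) : ∃ (A : Type (max u v)) (_ : Category.{v} A) (_ : Abelian A)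
      (i : C ⥤ A), S.IsProjectiveModel i := by
  let A := ULift.{u} (FGModuleRepr (End P)ᵐᵒᵖ)
  let _ : Category.{v} A := uliftCategory _
  let F : A ⥤ FGModuleCat.{v} (End P)ᵐᵒᵖ :=
    ULift.equivalence.inverse ⋙ FGModuleRepr.embed.{v, v} (End P)ᵐᵒᵖ
  let _ : Preadditive A := .ofFullyFaithful (Functor.FullyFaithful.ofFullyFaithful F)
  have : HasFiniteProducts A := ⟨fun n => Adjunction.hasLimitsOfShape_of_equivalence F⟩
  let _ : Abelian A := abelianOfEquivalence F
  exact ⟨A, inferInstance, inferInstance, _, hP.isProjectiveModel.comp_equivalence F.inv⟩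

lemma IsProjGenerator.hasRightEnvelope [IsNoetherianRing (End P)ᵐᵒᵖ]
    (hP : S.IsProjGenerator P) : ExactStructure.HasRightEnvelope.{v, max u v} S := by
  obtain ⟨A, _, _, i, hi⟩ := hP.exists_isProjectiveModel
  exact ⟨A, _, _, i, hi.isRightEnvelope hP.hasEnoughProj⟩

/-- All envelopes are projective models. -/
lemma IsProjGenerator.isProjectiveModel_of_isRightEnvelope [IsNoetherianRing (End P)ᵐᵒᵖ]
    (hP : S.IsProjGenerator P) {A : Type (max u v)} [Category.{v} A] [Abelian A] {i : C ⥤ A}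
    (hi : S.IsRightEnvelope i) : S.IsProjectiveModel i := by
  obtain ⟨A', _, _, j, hj⟩ := hP.exists_isProjectiveModel
  obtain ⟨F, _, ⟨e⟩⟩ := (hj.isRightEnvelope hP.hasEnoughProj).exists_equivalence hi
  exact (hj.comp_equivalence F).of_iso e

lemma isNoetherianRing_end {k : Type w} [Field k] [Linear k C] (P : C) [Module.Finite k (P ⟶ P)] :
    IsNoetherianRing (End P)ᵐᵒᵖ := by
  have : Module.Finite k (End P) := inferInstanceAs (Module.Finite k (P ⟶ P))
  have : Module.Finite k (End P)ᵐᵒᵖ := Module.Finite.equiv (MulOpposite.opLinearEquiv k)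
  exact isNoetherian_of_tower k inferInstance

end

/-! ### Coreflections along a class of projective objects -/

section

variable {A : Type u} [Category.{v} A] [Abelian A]

/-- `M` is a quotient of an object of `Q`. -/
def Gen (Q : ObjectProperty A) (M : A) : Prop := ∃ (P : A) (_ : Q P) (p : P ⟶ M), Epi p

/-- `M` is a quotient of an object of `Q` by a quotient of an object of `Q`. -/
def Pres (Q : ObjectProperty A) (M : A) : Prop :=
  ∃ (P K : A) (i : K ⟶ P) (p : P ⟶ M), Q P ∧ Gen Q K ∧ (ofAbelian A).IsConf i p

/-- The morphism `ε : Y ⟶ X` exhibits `Y` as the coreflection of `X` in the category of objects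
presented by `Q`. -/
structure IsCoref (Q : ObjectProperty A) {Y X : A} (ε : Y ⟶ X) : Prop where
  pres : Pres Q Y
  eq_zero : ∀ {P : A} (f : P ⟶ Y), Q P → f ≫ ε = 0 → f = 0
  exists_fac : ∀ {P : A} (f : P ⟶ X), Q P → ∃ g : P ⟶ Y, g ≫ ε = f

/-- A class of projective objects, closed under finite sums, which is contravariantly finite: any
object `M` has an approximation `P ⟶ M`, through which all morphisms from the class factor. -/
structure IsProjClass (Q : ObjectProperty A) : Prop where
  projective : ∀ P, Q P → Projective P
  biprod : ∀ P P', Q P → Q P' → Q (P ⊞ P')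
  exists_approx : ∀ M, ∃ (P : A) (_ : Q P) (p : P ⟶ M),
    ∀ (P' : A) (f : P' ⟶ M), Q P' → ∃ g : P' ⟶ P, g ≫ p = f

variable {Q : ObjectProperty A}

omit [Abelian A] in
lemma Gen.of_epi {M N : A} (h : Gen Q M) (p : M ⟶ N) [Epi p] : Gen Q N := by
  obtain ⟨P, hP, q, _⟩ := h
  exact ⟨P, hP, q ≫ p, epi_comp q p⟩

omit [Abelian A] in
lemma Gen.mono {Q' : ObjectProperty A} (h : Q ≤ Q') {M : A} (hM : Gen Q M) : Gen Q' M := by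
  obtain ⟨P, hP, q, hq⟩ := hM
  exact ⟨P, h P hP, q, hq⟩

lemma Pres.mono {Q' : ObjectProperty A} (h : Q ≤ Q') {M : A} (hM : Pres Q M) : Pres Q' M := by
  obtain ⟨P, K, i, p, hP, hK, hc⟩ := hM
  exact ⟨P, K, i, p, h P hP, hK.mono h, hc⟩

lemma Pres.gen {M : A} (hM : Pres Q M) : Gen Q M := by
  obtain ⟨P, K, i, p, hP, hK, hc⟩ := hM
  exact ⟨P, hP, p, hc.epi⟩

lemma epi_of_forall {X Y : A} (f : X ⟶ Y) (h : ∀ {B : A} (y : B ⟶ Y),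
    ∃ (B' : A) (π : B' ⟶ B) (_ : Epi π) (x : B' ⟶ X), π ≫ y = x ≫ f) : Epi f :=
  (epi_iff_surjective_up_to_refinements f).2 fun _ y => h y

/-- A morphism to a quotient lifts after passing to an epimorphism. -/
lemma exists_refinement {X Y B : A} (p : X ⟶ Y) [Epi p] (y : B ⟶ Y) :
    ∃ (B' : A) (π : B' ⟶ B) (_ : Epi π) (x : B' ⟶ X), π ≫ y = x ≫ p :=
  (epi_iff_surjective_up_to_refinements p).1 inferInstance y

section

variable (hQ : IsProjClass Q)
include hQ

lemma IsProjClass.exists_lift {P M N : A} (hP : Q P) (p : M ⟶ N) [Epi p] (f : P ⟶ N) :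
    ∃ g : P ⟶ M, g ≫ p = f := by
  have := hQ.projective P hP
  exact ⟨Projective.factorThru f p, Projective.factorThru_comp f p⟩

/-- Lifts of generators of the quotient, together with generators of the subobject, generate an
extension. -/
lemma Gen.extension {K M N : A} {i : K ⟶ M} {p : M ⟶ N} (hc : (ofAbelian A).IsConf i p)
    (hK : Gen Q K) (hN : Gen Q N) : Gen Q M := by
  obtain ⟨P, hP, q, _⟩ := hK
  obtain ⟨P', hP', q', _⟩ := hN
  have := hc.epi
  obtain ⟨l, hl⟩ := hQ.exists_lift hP' p q'
  refine ⟨P ⊞ P', hQ.biprod _ _ hP hP', biprod.desc (q ≫ i) l, epi_of_forall _ fun {B} y => ?_⟩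
  obtain ⟨B₁, π₁, _, x₁, h₁⟩ := exists_refinement q' (y ≫ p)
  obtain ⟨z, hz⟩ := hc.lift (π₁ ≫ y - x₁ ≫ l) (by
    rw [Preadditive.sub_comp, Category.assoc, Category.assoc, hl, h₁, sub_self])
  obtain ⟨B₂, π₂, _, x₂, h₂⟩ := exists_refinement q z
  refine ⟨B₂, π₂ ≫ π₁, epi_comp _ _, biprod.lift x₂ (π₂ ≫ x₁), ?_⟩
  rw [biprod.lift_desc, ← reassoc_of% h₂, hz]
  simp

/-- A form of Schanuel's lemma: the kernel of an epimorphism from a generated to a presented object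
is generated. -/
lemma Pres.gen_kernel {K G M : A} {i : K ⟶ G} {p : G ⟶ M} (hc : (ofAbelian A).IsConf i p)
    (hG : Gen Q G) (hM : Pres Q M) : Gen Q K := by
  obtain ⟨P₀, K₀, j, π, hP₀, ⟨P₁, hP₁, r, _⟩, hc'⟩ := hM
  obtain ⟨P, hP, q, _⟩ := hG
  have := hc.epi
  have := hc.mono
  have := hc'.epi
  obtain ⟨φ, hφ⟩ := hQ.exists_lift hP₀ p π
  obtain ⟨q', hq'⟩ := hQ.exists_lift hP π (q ≫ p)
  obtain ⟨a, ha⟩ := hc.lift (q - q' ≫ φ) (by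
    rw [Preadditive.sub_comp, Category.assoc, hφ, hq', sub_self])
  obtain ⟨b, hb⟩ := hc.lift (j ≫ φ) (by rw [Category.assoc, hφ, hc'.w])
  -- an element of `K` is of the form `q y = (q y - φ q' y) + φ q' y`, with `q' y` in `K₀`
  refine ⟨P ⊞ P₁, hQ.biprod _ _ hP hP₁, biprod.desc a (r ≫ b), epi_of_forall _ fun {B} x => ?_⟩
  obtain ⟨B₁, π₁, _, y, hy⟩ := exists_refinement q (x ≫ i)
  obtain ⟨z, hz⟩ := hc'.lift (y ≫ q') (by
    rw [Category.assoc, hq', ← reassoc_of% hy, hc.w, comp_zero, comp_zero])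
  obtain ⟨B₂, π₂, _, t, ht⟩ := exists_refinement r z
  refine ⟨B₂, π₂ ≫ π₁, epi_comp _ _, biprod.lift (π₂ ≫ y) t, ?_⟩
  rw [← cancel_mono i, biprod.lift_desc, ← reassoc_of% ht, Preadditive.add_comp]
  simp only [Category.assoc, ha, hb, reassoc_of% hz, hy]
  simp

/-- The quotient of a presented object by a generated subobject is presented. -/
lemma Pres.of_conf {K M N : A} {i : K ⟶ M} {p : M ⟶ N} (hc : (ofAbelian A).IsConf i p)
    (hK : Gen Q K) (hM : Pres Q M) : Pres Q N := by
  obtain ⟨P₀, K₀, j, π, hP₀, hK₀, hc'⟩ := hM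
  obtain ⟨N', a, n, q, h₁, h₂, -, -⟩ := hc'.comp_deflation hc
  exact ⟨P₀, N', n, π ≫ p, hP₀, hK₀.extension hQ h₁ hK, h₂⟩

lemma IsProjClass.pres_cokernel {Y Z : A} (f : Y ⟶ Z) (hY : Gen Q Y) (hZ : Pres Q Z) :
    Pres Q (cokernel f) :=
  Pres.of_conf hQ (isConf_ofAbelian (cokernel.π f)) (hY.of_epi (Abelian.factorThruImage f)) hZ

/-- The coreflection is the cokernel of `P₁ ⟶ P₀`, where `P₀` approximates `X` and `P₁` approximates
the kernel of `P₀ ⟶ X`. -/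
lemma IsProjClass.exists_isCoref (X : A) : ∃ (Y : A) (ε : Y ⟶ X), IsCoref Q ε := by
  obtain ⟨P₀, hP₀, p₀, h₀⟩ := hQ.exists_approx X
  obtain ⟨P₁, hP₁, p₁, h₁⟩ := hQ.exists_approx (kernel p₀)
  let d := p₁ ≫ kernel.ι p₀
  have hd : d ≫ p₀ = 0 := by simp [d]
  refine ⟨cokernel d, cokernel.desc d p₀ hd,
    ⟨P₀, _, _, _, hP₀, ?_, isConf_ofAbelian (cokernel.π d)⟩, fun {P} f hP hf => ?_,
    fun {P} f hP => ?_⟩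
  · exact Gen.of_epi ⟨P₁, hP₁, 𝟙 _, inferInstance⟩ (Abelian.factorThruImage d)
  · obtain ⟨g, rfl⟩ := hQ.exists_lift hP (cokernel.π d) f
    rw [Category.assoc, cokernel.π_desc] at hf
    obtain ⟨h, hh⟩ := h₁ P (kernel.lift p₀ g hf) hP
    have : g = h ≫ d := by rw [← kernel.lift_ι p₀ g hf, ← hh, Category.assoc]
    rw [this, Category.assoc, cokernel.condition, comp_zero]
  · obtain ⟨g, rfl⟩ := h₀ P f hP
    exact ⟨g ≫ cokernel.π d, by rw [Category.assoc, cokernel.π_desc]⟩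

end

section

variable {X Y : A} {ε : Y ⟶ X} (hε : IsCoref Q ε)
include hε

lemma IsCoref.hom_ext {Z : A} (hZ : Gen Q Z) {f g : Z ⟶ Y} (h : f ≫ ε = g ≫ ε) : f = g := by
  obtain ⟨P, hP, p, _⟩ := hZ
  rw [← cancel_epi p, ← sub_eq_zero, ← Preadditive.comp_sub]
  exact hε.eq_zero _ hP (by
    rw [Category.assoc, Preadditive.sub_comp, h, sub_self, comp_zero])

lemma IsCoref.exists_lift {Z : A} (hZ : Pres Q Z) (f : Z ⟶ X) : ∃ g : Z ⟶ Y, g ≫ ε = f := by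
  obtain ⟨P, K, i, p, hP, hK, hc⟩ := hZ
  have := hc.epi
  obtain ⟨g, hg⟩ := hε.exists_fac (p ≫ f) hP
  obtain ⟨s, hs⟩ := hc.desc g (hε.hom_ext hK (by
    rw [Category.assoc, hg, ← Category.assoc, hc.w, zero_comp, zero_comp]))
  exact ⟨s, by rw [← cancel_epi p, ← Category.assoc, hs, hg]⟩

/-- Coreflections are unique. -/
lemma IsCoref.exists_iso {Y' : A} {ε' : Y' ⟶ X} (hε' : IsCoref Q ε') :
    ∃ e : Y' ≅ Y, e.hom ≫ ε = ε' := by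
  obtain ⟨g, hg⟩ := hε.exists_lift hε'.pres ε'
  obtain ⟨g', hg'⟩ := hε'.exists_lift hε.pres ε
  exact ⟨⟨g, g', hε'.hom_ext hε'.pres.gen (by simp [hg, hg']),
    hε.hom_ext hε.pres.gen (by simp [hg, hg'])⟩, hg⟩

lemma IsCoref.mono [Mono ε] {Y' : A} {ε' : Y' ⟶ X} (hε' : IsCoref Q ε') : Mono ε' := by
  obtain ⟨e, rfl⟩ := hε.exists_iso hε'
  infer_instance

lemma IsCoref.comp_iso {X' : A} (e : X ≅ X') : IsCoref Q (ε ≫ e.hom) where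
  pres := hε.pres
  eq_zero f hP hf := hε.eq_zero f hP ((cancel_mono e.hom).1 (by simpa using hf))
  exists_fac f hP := by
    obtain ⟨g, hg⟩ := hε.exists_fac (f ≫ e.inv) hP
    exact ⟨g, by rw [← Category.assoc, hg]; simp⟩

/-- Coreflections along a smaller class factor through those along a larger one. -/
lemma IsCoref.exists_factor {Q' : ObjectProperty A} (h : Q' ≤ Q) {Y' : A} {ε' : Y' ⟶ X}
    (hε' : IsCoref Q' ε') : ∃ f : Y' ⟶ Y, f ≫ ε = ε' ∧ IsCoref Q' f := by
  obtain ⟨f, hf⟩ := hε.exists_lift (hε'.pres.mono h) ε'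
  refine ⟨f, hf, hε'.pres, fun g hP hg => hε'.eq_zero g hP ?_, fun {P} g hP => ?_⟩
  · rw [← hf, ← Category.assoc, hg, zero_comp]
  · obtain ⟨g', hg'⟩ := hε'.exists_fac (g ≫ ε) hP
    exact ⟨g', hε.hom_ext ⟨P, h P hP, 𝟙 _, inferInstance⟩ (by rw [Category.assoc, hf, hg'])⟩

end

end

/-! ### Exactness properties of projective models -/

section

variable {C : Type u} [Category.{v} C] [Preadditive C] {S : ExactStructure C}
  {A : Type u'} [Category.{v'} A] [Abelian A] {i : C ⥤ A} (hi : S.IsProjectiveModel i)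
include hi

/-- The inflation of a conflation stays a monomorphism, since this can be tested on the images of
objects of `C`. -/
lemma IsProjectiveModel.isConf_map {X Y Z : C} {f : X ⟶ Y} {d : Y ⟶ Z} (hc : S.IsConf f d) :
    (ofAbelian A).IsConf (i.map f) (i.map d) := by
  have := hi.full
  have := hi.faithful
  obtain ⟨_, h⟩ := hi.rightExact
  obtain ⟨h₁, h₂⟩ := h _ hc.2
  have := hc.mono
  refine ⟨by rw [← i.map_comp, hc.w, i.map_zero], ShortComplex.ShortExact.mk' h₁ ?_ h₂⟩
  refine Preadditive.mono_of_cancel_zero (i.map f) fun {T} t ht => ?_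
  obtain ⟨P, -, p, _⟩ := hi.exists_epi T
  obtain ⟨g, hg⟩ := i.map_surjective (p ≫ t)
  have h0 : g ≫ f = 0 := i.map_injective (by
    rw [i.map_comp, hg, Category.assoc, ht, comp_zero, i.map_zero])
  rw [← cancel_epi p, ← hg, (cancel_mono f).1 (h0.trans zero_comp.symm), i.map_zero, comp_zero]

/-- The image of a projective model is closed under extensions. -/
lemma IsProjectiveModel.exists_extension (hS : S.HasEnoughProj) {Y V : C} {Z : A}
    {a : i.obj Y ⟶ Z} {b : Z ⟶ i.obj V} (hc : (ofAbelian A).IsConf a b) :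
    ∃ (E : C) (f : Y ⟶ E) (d : E ⟶ V), S.IsConf f d ∧ Nonempty (i.obj E ≅ Z) := by
  have := hi.full
  have := hi.faithful
  obtain ⟨P, d, hP, hd⟩ := hS V
  obtain ⟨K, j, hK⟩ := IsDeflation.exists_isConf hd
  have := hi.projective P hP
  have := hc.epi
  have hw : i.map j ≫ i.map d = 0 := (hi.isConf_map hK).w
  obtain ⟨φ, hφ⟩ := hc.lift (i.map j ≫ Projective.factorThru (i.map d) b) (by simp [hw])
  obtain ⟨φ, rfl⟩ := i.map_surjective φ
  obtain ⟨E, p, q, e, hE, hpe, hqe⟩ := hK.pushout φ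
  -- both extensions are pushouts of `K ⟶ P ⟶ V` along `φ`
  let ξ : (ofAbelian A).Extension (i.obj V) (i.obj K) := ⟨_, _, _, _, (hi.isConf_map hK).2⟩
  let η : (ofAbelian A).Extension (i.obj V) (i.obj Y) := ⟨_, _, _, _, (hi.isConf_map hqe).2⟩
  let ζ : (ofAbelian A).Extension (i.obj V) (i.obj Y) := ⟨_, _, _, _, hc.2⟩
  have h₁ : Extension.Over (i.map φ) ξ η := ⟨i.map p, by
    change i.map j ≫ i.map p = i.map φ ≫ i.map q
    rw [← i.map_comp, hE.w, i.map_comp], by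
    change i.map p ≫ i.map e = i.map d
    rw [← i.map_comp, hpe]⟩
  have h₂ : Extension.Over (i.map φ) ξ ζ := ⟨_, hφ.symm, Projective.factorThru_comp _ _⟩
  obtain ⟨e', -, -⟩ := h₁.unique h₂
  exact ⟨E, q, e, hqe, ⟨e'⟩⟩

end

/-! ### Coreflections along an exceptional collection -/

section

variable {C : Type u} [Category.{v} C] [Preadditive C] {L : Type w}

/-- The images of the projective objects in the subcategory generated by the `D j` with `j ∈ I`. -/
def projClass (S : ExactStructure C) (D : L → C) {A : Type u'} [Category.{v'} A] (i : C ⥤ A)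
    (I : Set L) : ObjectProperty A := fun M =>
  ∃ P, S.filt D I P ∧ S.IsProj P ∧ Nonempty (i.obj P ≅ M)

variable {S : ExactStructure C} {D : L → C} {A : Type u'} [Category.{v'} A] [Abelian A] {i : C ⥤ A}

omit [Abelian A] in
lemma projClass_mono {I J : Set L} (h : I ⊆ J) : projClass S D i I ≤ projClass S D i J :=
  fun _ ⟨P, hP, hP', e⟩ => ⟨P, filt_mono h _ hP, hP', e⟩

omit [Abelian A] in
lemma projClass_map {I : Set L} {P : C} (hP : S.filt D I P) (hP' : S.IsProj P) :
    projClass S D i I (i.obj P) := ⟨P, hP, hP', ⟨Iso.refl _⟩⟩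

variable {k : Type*} [Field k] [Linear k C] [PartialOrder L] [Finite L]
  (h : S.IsExceptional k D) (hi : S.IsProjectiveModel i)

include h in
lemma IsExceptional.hasEnoughProj : S.HasEnoughProj := fun X => by
  obtain ⟨K, P, f, d, hc, -, -, hP⟩ := h.exists_proj isLowerSet_univ (h.filt_univ X)
  exact ⟨P, d, hP, hc.deflation⟩

include h in
/-- All morphisms to `X` from projective objects in the subcategory generated by a lower set factor
through one of them. -/
lemma IsExceptional.exists_approx {I : Set L} (hI : IsLowerSet I) (X : C) :
    ∃ (Q : C) (u : Q ⟶ X), S.filt D I Q ∧ S.IsProj Q ∧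
      ∀ (Q' : C) (g : Q' ⟶ X), S.filt D I Q' → S.IsProj Q' → ∃ g', g' ≫ u = g := by
  obtain ⟨P, hP, hP', hgen⟩ := h.exists_proj_generator hI
  have := h.hom_finite P X
  have := S.hasZeroObject
  have := S.hasBinaryBiproducts
  have key : ∀ s : Finset (P ⟶ X), ∃ (Q : C) (u : Q ⟶ X), S.filt D I Q ∧ S.IsProj Q ∧
      ∀ g ∈ s, ∃ g', g' ≫ u = g := by
    classical
    intro s
    induction s using Finset.induction_on with
    | empty => exact ⟨P, 0, hP, hP', by simp⟩
    | insert b s _ ih =>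
      obtain ⟨Q, u, hQ, hQ', hu⟩ := ih
      refine ⟨P ⊞ Q, biprod.desc b u, (isFullyExact_filt I).biprod hP hQ, hP'.biprod hQ',
        fun g hg => ?_⟩
      rcases Finset.mem_insert.1 hg with rfl | hg
      · exact ⟨biprod.inl, by simp⟩
      · obtain ⟨g', rfl⟩ := hu g hg
        exact ⟨g' ≫ biprod.inr, by simp⟩
  obtain ⟨s, hs⟩ := (Module.Finite.fg_top : (⊤ : Submodule k (P ⟶ X)).FG)
  obtain ⟨Q, u, hQ, hQ', hu⟩ := key s
  have hPu (g : P ⟶ X) : ∃ g', g' ≫ u = g :=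
    (hs.ge.trans (Submodule.span_le.2 hu : _ ≤ LinearMap.range (Linear.rightComp k P u)))
      (trivial : g ∈ ⊤)
  refine ⟨Q, u, hQ, hQ', fun Q' g hI hQ' => ?_⟩
  obtain ⟨K, Y, f, d, hc, -, -, hY⟩ := hgen Q' hI
  obtain ⟨t, ht⟩ := hQ'.exists_lift hc.deflation (𝟙 Q')
  obtain ⟨J, _, p, q, hpq⟩ := hY.trans (.of_retract t d ht)
  choose g' hg' using fun a => hPu (q a ≫ g)
  refine ⟨∑ a, p a ≫ g' a, ?_⟩
  calc _ = (∑ a, p a ≫ q a) ≫ g := by simp [Preadditive.sum_comp, hg']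
    _ = g := by rw [hpq, Category.id_comp]

include h hi

lemma IsExceptional.isProjClass {I : Set L} (hI : IsLowerSet I) :
    IsProjClass (projClass S D i I) where
  projective := by
    rintro M ⟨P, -, hP, ⟨e⟩⟩
    exact Projective.of_iso e (hi.projective P hP)
  biprod := by
    rintro M M' ⟨P, hP, hP', ⟨e⟩⟩ ⟨Q, hQ, hQ', ⟨e'⟩⟩
    have := S.hasZeroObject
    have := S.hasBinaryBiproducts
    have := hi.rightExact.1
    have := preservesBinaryBiproducts_of_preservesBiproducts i
    exact ⟨P ⊞ Q, (isFullyExact_filt I).biprod hP hQ, hP'.biprod hQ',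
      ⟨i.mapBiprod P Q ≪≫ biprod.mapIso e e'⟩⟩
  exists_approx M := by
    obtain ⟨X, hX, p, _⟩ := hi.exists_epi M
    obtain ⟨Q, u, hQ, hQ', hu⟩ := h.exists_approx hI X
    refine ⟨i.obj Q, projClass_map hQ hQ', i.map u ≫ p, ?_⟩
    rintro P' f ⟨P, hP, hP', ⟨e⟩⟩
    have := hi.projective P hP'
    have := hi.full
    obtain ⟨g, hg⟩ := i.map_surjective (Projective.factorThru (e.hom ≫ f) p)
    obtain ⟨g', rfl⟩ := hu P g hP hP'
    refine ⟨e.inv ≫ i.map g', ?_⟩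
    rw [Category.assoc, ← Category.assoc (i.map g'), ← i.map_comp, hg, Projective.factorThru_comp,
      e.inv_hom_id_assoc]

lemma IsExceptional.pres_map {I : Set L} (hI : IsLowerSet I) {X : C} (hX : S.filt D I X) :
    Pres (projClass S D i I) (i.obj X) := by
  obtain ⟨K, P, f, d, hc, hK, hP, hP'⟩ := h.exists_proj hI hX
  obtain ⟨K', Q, f', d', hc', -, hQ, hQ'⟩ := h.exists_proj hI hK
  exact ⟨_, _, _, _, projClass_map hP hP', ⟨_, projClass_map hQ hQ', i.map d',
    (hi.isConf_map hc').epi⟩, hi.isConf_map hc⟩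

omit [Finite L] in
/-- The projective objects generated by a lower set have no morphisms to the objects generated by
its complement. -/
lemma IsExceptional.hom_eq_zero {I J : Set L} (hIJ : ∀ a ∈ I, ∀ b ∈ J, ¬ b ≤ a) {P : A} {F : C}
    (hP : projClass S D i I P) (hF : S.filt D J F) (f : P ⟶ i.obj F) : f = 0 := by
  obtain ⟨Q, hQ, -, ⟨e⟩⟩ := hP
  have := hi.full
  have := hi.rightExact.1
  obtain ⟨g, hg⟩ := i.map_surjective (e.hom ≫ f)
  rw [(h.perp_filt hIJ hQ hF).1 g, i.map_zero] at hg
  exact (cancel_epi e.hom).1 (hg.symm.trans comp_zero.symm)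

/-- The torsion part of an object of the exact category is its coreflection. -/
lemma IsExceptional.isCoref_map {I : Set L} (hI : IsLowerSet I) {T E F : C} {a : T ⟶ E} {b : E ⟶ F}
    (hc : S.IsConf a b) (hT : S.filt D I T) (hF : S.filt D Iᶜ F) :
    IsCoref (projClass S D i I) (i.map a) where
  pres := h.pres_map hi hI hT
  eq_zero f _ hf := by
    have := (hi.isConf_map hc).mono
    exact (cancel_mono _).1 (hf.trans zero_comp.symm)
  exists_fac f hP := (hi.isConf_map hc).lift f
    (h.hom_eq_zero hi (J := Iᶜ) (fun x hx y hy hyx => hy (hI hyx hx)) hP hF _)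

end

/-! ### Coreflections along adjacent lower sets -/

section

variable {C : Type u} [Category.{v} C] [Preadditive C] {L : Type w} {S : ExactStructure C}
  {D : L → C} {A : Type u'} [Category.{v'} A] [Abelian A] {i : C ⥤ A} {k : Type*} [Field k] [Linear k C]
  [PartialOrder L] [Finite L] (h : S.IsExceptional k D) (hi : S.IsProjectiveModel i)

namespace IsExceptional

section

variable {I : Set L} {l : L} (hI : IsLowerSet I) (hl : l ∉ I) (hJ : IsLowerSet (insert l I))

include hI hl in
omit [Finite L] in
lemma _root_.IsLowerSet.not_le_of_notMem : ∀ a ∈ I, ∀ b ∈ ({l} : Set L), ¬ b ≤ a := by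
  rintro a ha b rfl hba
  exact hl (hI hba ha)

include h hi hI hl

/-- An object without morphisms from the projective objects generated by `I` which is a quotient of
a projective object generated by `I` and `l` is a quotient of a sum of copies of `D l`. -/
lemma exists_epi_of_gen {M : A} (hM : Gen (projClass S D i (insert l I)) M)
    (h0 : ∀ {P : A} (f : P ⟶ M), projClass S D i I P → f = 0) :
    ∃ (V : C) (_ : S.filt D {l} V) (p : i.obj V ⟶ M), Epi p := by
  obtain ⟨P, ⟨Q, hQ, -, ⟨e⟩⟩, p, _⟩ := hM
  rw [← Set.union_singleton] at hQ
  obtain ⟨T, V, a, b, hc, hT, hV⟩ := h.star_filt (hI.not_le_of_notMem hl) hQ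
  obtain ⟨R, hR, r, _⟩ := (h.pres_map hi hI hT).gen
  obtain ⟨s, hs⟩ := (hi.isConf_map hc).desc (e.hom ≫ p) ((cancel_epi r).1 (by
    rw [h0 (r ≫ i.map a ≫ e.hom ≫ p) hR, comp_zero]))
  exact ⟨V, hV, s, epi_of_epi_fac hs⟩

include hJ

/-- An object presented by `I` and `l` without morphisms from the projective objects generated by `I`
is a sum of copies of `D l`. -/
lemma exists_iso_of_pres {M : A} (hM : Pres (projClass S D i (insert l I)) M)
    (h0 : ∀ {P : A} (f : P ⟶ M), projClass S D i I P → f = 0) :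
    ∃ V : C, S.filt D {l} V ∧ Nonempty (i.obj V ≅ M) := by
  classical
  have := hi.full
  have := hi.faithful
  have := hi.rightExact.1
  obtain ⟨V, hV, p₀, _⟩ := h.exists_epi_of_gen hi hI hl hM.gen h0
  obtain ⟨N, _, p, q, hpq⟩ := h.inAdd_of_filt_singleton hV
  let g (a : N) : i.obj (D l) ⟶ M := i.map (q a) ≫ p₀
  -- a minimal jointly epimorphic family of morphisms from `D l`
  obtain ⟨s, hs, hmin⟩ := WellFounded.has_min (wellFounded_lt (α := Finset N))
    {s | ∀ {T : A} (t : M ⟶ T), (∀ a ∈ s, g a ≫ t = 0) → t = 0} ⟨Finset.univ, fun {T} t ht => by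
      rw [← cancel_epi p₀, comp_zero, ← Category.id_comp (p₀ ≫ t), ← i.map_id, ← hpq, i.map_sum,
        Preadditive.sum_comp]
      refine Finset.sum_eq_zero fun a ha => ?_
      have := ht a ha
      simp only [g, Category.assoc] at this
      rw [i.map_comp, Category.assoc, this, comp_zero]⟩
  obtain ⟨W, p, q, hpq, hqp, hW⟩ := S.exists_finite_sum (D l) s
  have hW : S.filt D {l} W := hW _ (isFullyExact_filt _) (filt_of_mem rfl)
  let φ : i.obj W ⟶ M := ∑ a ∈ s, i.map (p a) ≫ g a
  have hφ {b : N} (hb : b ∈ s) : i.map (q b) ≫ φ = g b := by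
    simp only [φ, Preadditive.comp_sum, ← Category.assoc, ← i.map_comp]
    rw [Finset.sum_eq_single b]
    · rw [hqp b hb b hb, if_pos rfl, i.map_id, Category.id_comp]
    · intro a ha hab
      rw [hqp b hb a ha, if_neg hab.symm, i.map_zero, zero_comp]
    · exact fun hb' => absurd hb hb'
  have : Epi φ := Preadditive.epi_of_cancel_zero _ fun t ht => hs t fun a ha => by
    rw [← hφ ha, Category.assoc, ht, comp_zero]
  -- `D l` has no nonzero morphism to the kernel of `φ`; but this kernel is a quotient of a sum of
  -- copies of `D l`
  have key (x : D l ⟶ W) (hx : i.map x ≫ φ = 0) : x = 0 := by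
    choose c hc using fun a => h.endo l (x ≫ p a)
    have hc0 (b : N) (hb : b ∈ s) : c b = 0 := by
      by_contra hcb
      -- the member `g b` is a combination of the others, contradicting minimality
      refine hmin (s.erase b) (fun {T} t ht => hs t fun a ha => ?_) (Finset.erase_ssubset hb)
      by_cases hab : a = b
      · subst hab
        have : IsIso (i.map (c a • 𝟙 (D l))) := by
          have : IsIso (c a • 𝟙 (D l)) := ⟨(c a)⁻¹ • 𝟙 _, by simp [smul_smul, hcb], by
            simp [smul_smul, hcb]⟩
          infer_instance
        rw [← cancel_epi (i.map (c a • 𝟙 (D l))), comp_zero]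
        have hx' := hx =≫ t
        simp only [φ, Preadditive.comp_sum, Preadditive.sum_comp, zero_comp, Category.assoc] at hx'
        rw [Finset.sum_eq_single a] at hx'
        · rwa [← Category.assoc, ← i.map_comp, hc] at hx'
        · intro b' hb' hne
          rw [ht b' (Finset.mem_erase.2 ⟨hne, hb'⟩), comp_zero, comp_zero]
        · exact fun hb' => absurd hb hb'
      · exact ht a (Finset.mem_erase.2 ⟨hab, ha⟩)
    rw [← Category.comp_id x, ← hpq, Preadditive.comp_sum]
    refine Finset.sum_eq_zero fun a ha => ?_
    rw [← Category.assoc, hc, hc0 a ha, zero_smul, zero_comp]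
  have hJ' : ({l} : Set L) ⊆ insert l I := by simp
  have hker := isConf_ofAbelian φ
  obtain ⟨V', hV', r, _⟩ := h.exists_epi_of_gen hi hI hl
    (hM.gen_kernel (h.isProjClass hi hJ) hker (h.pres_map hi hJ (filt_mono hJ' _ hW)).gen)
    (fun f hP => (cancel_mono (kernel.ι φ)).1 (by
      rw [h.hom_eq_zero hi (hI.not_le_of_notMem hl) hP hW (f ≫ kernel.ι φ), zero_comp]))
  obtain ⟨x, hx⟩ := i.map_surjective (r ≫ kernel.ι φ)
  obtain ⟨N', _, p', q', hpq'⟩ := h.inAdd_of_filt_singleton hV'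
  have hx0 : x = 0 := by
    rw [← Category.id_comp x, ← hpq', Preadditive.sum_comp]
    refine Finset.sum_eq_zero fun a _ => ?_
    rw [Category.assoc, key (q' a ≫ x) (by
      rw [i.map_comp, hx, Category.assoc, Category.assoc, kernel.condition, comp_zero, comp_zero]),
      comp_zero]
  have hι : kernel.ι φ = 0 := by
    rw [← cancel_epi r, ← hx, hx0, i.map_zero, comp_zero]
  have : Mono φ := Preadditive.mono_of_kernel_zero hι
  have : IsIso φ := isIso_of_mono_of_epi φ
  exact ⟨W, hW, ⟨asIso φ⟩⟩

variable {Y Z : A} {f : Y ⟶ Z} (hf : IsCoref (projClass S D i I) f)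
  (hZ : Pres (projClass S D i (insert l I)) Z)
include hf hZ

/-- Let `Z` be presented by `I` and `l`, and let `f : Y ⟶ Z` be its coreflection along `I`. The
cokernel of `f` is a sum of copies of `D l`: it is presented by `I` and `l`, and receives no morphism from the
projective objects generated by `I`, because all such morphisms to `Z` factor through `f`. -/
lemma exists_iso_cokernel : ∃ V : C, S.filt D {l} V ∧ Nonempty (i.obj V ≅ cokernel f) := by
  have hIJ : projClass S D i I ≤ projClass S D i (insert l I) :=
    projClass_mono (Set.subset_insert l I)
  refine h.exists_iso_of_pres hi hI hl hJ
    ((h.isProjClass hi hJ).pres_cokernel f (hf.pres.gen.mono hIJ) hZ) fun g hP => ?_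
  obtain ⟨g', rfl⟩ := (h.isProjClass hi hI).exists_lift hP (cokernel.π f) g
  obtain ⟨g'', rfl⟩ := hf.exists_fac g' hP
  rw [Category.assoc, cokernel.condition, comp_zero]

/-- In the situation of `exists_iso_cokernel`, the kernel of `f` is a quotient of a sum of copies of
`D l`. If a projective object `P` covers the cokernel `V` of `f`, with kernel `N`, then the kernel of
`Y ⊞ P ⟶ Z` is an extension of `N` by the kernel of `f`, so that two applications of Schanuel's lemma
show that the latter is generated by `I` and `l`. -/
lemma exists_epi_kernel : ∃ (V : C) (_ : S.filt D {l} V) (p : i.obj V ⟶ kernel f), Epi p := by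
  refine h.exists_epi_of_gen hi hI hl ?_ fun x hP => (cancel_mono (kernel.ι f)).1 ((hf.eq_zero _ hP
    (by rw [Category.assoc, kernel.condition, comp_zero])).trans zero_comp.symm)
  have hIJ : projClass S D i I ≤ projClass S D i (insert l I) :=
    projClass_mono (Set.subset_insert l I)
  have hJ' : ({l} : Set L) ⊆ insert l I := by simp
  obtain ⟨V, hV, ⟨e⟩⟩ := h.exists_iso_cokernel hi hI hl hJ hf hZ
  obtain ⟨N, P, n, d, hc, hN, hP, hP'⟩ := h.exists_proj hJ (filt_mono hJ' _ hV)
  have hc := hi.isConf_map hc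
  have := hc.epi
  have := hi.projective P hP'
  let H : i.obj P ⟶ Z := Projective.factorThru (i.map d ≫ e.hom) (cokernel.π f)
  have hH : H ≫ cokernel.π f = i.map d ≫ e.hom := Projective.factorThru_comp _ _
  have him {B : A} (t : B ⟶ Z) (ht : t ≫ cokernel.π f = 0) :
      ∃ (B' : A) (π : B' ⟶ B) (_ : Epi π) (x : B' ⟶ Y), π ≫ t = x ≫ f := by
    obtain ⟨s, hs⟩ := (isConf_ofAbelian (cokernel.π f)).lift t ht
    obtain ⟨B', π, hπ, x, hx⟩ := exists_refinement (Abelian.factorThruImage f) s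
    refine ⟨B', π, hπ, x, ?_⟩
    rw [← hs, ← Category.assoc, hx, Category.assoc]
    exact congrArg (x ≫ ·) (Abelian.image.fac f)
  let q : Y ⊞ i.obj P ⟶ Z := biprod.desc f H
  have hq : Epi q := epi_of_forall _ fun {B} z => by
    obtain ⟨B₁, π₁, _, x, hx⟩ := exists_refinement (i.map d ≫ e.hom) (z ≫ cokernel.π f)
    obtain ⟨B₂, π₂, _, y, hy⟩ := him (π₁ ≫ z - x ≫ H) (by
      rw [Preadditive.sub_comp, Category.assoc, Category.assoc, hx, hH, sub_self])
    refine ⟨B₂, π₂ ≫ π₁, epi_comp _ _, biprod.lift y (π₂ ≫ x), ?_⟩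
    rw [biprod.lift_desc, ← hy]
    simp
  have hgen : Gen (projClass S D i (insert l I)) (kernel q) :=
    hZ.gen_kernel (h.isProjClass hi hJ) (isConf_ofAbelian q)
      (Gen.extension (h.isProjClass hi hJ) (isConf_inl_snd (ofAbelian A) Y (i.obj P))
        (hf.pres.gen.mono hIJ) (h.pres_map hi hJ hP).gen)
  have hκ : kernel.ι q ≫ biprod.fst ≫ f + kernel.ι q ≫ biprod.snd ≫ H = 0 := by
    rw [← Preadditive.comp_add, ← biprod.desc_eq, kernel.condition]
  -- the kernel of the epimorphism `kernel q ⟶ i N` is `kernel f`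
  obtain ⟨r, hr⟩ := hc.lift (kernel.ι q ≫ biprod.snd) (by
    have := hκ =≫ cokernel.π f
    simp only [Preadditive.add_comp, Category.assoc, cokernel.condition, comp_zero, zero_add, hH,
      zero_comp] at this
    rw [← cancel_mono e.hom, zero_comp, ← this]
    simp)
  have := hc.mono
  have : Epi r := epi_of_forall _ fun {B} y => by
    obtain ⟨B', π, hπ, x, hx⟩ := him (y ≫ i.map n ≫ H) (by
      rw [Category.assoc, Category.assoc, hH, reassoc_of% hc.w, zero_comp, comp_zero])
    refine ⟨B', π, hπ, kernel.lift q (biprod.lift (-x) (π ≫ y ≫ i.map n)) ?_, ?_⟩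
    · rw [biprod.lift_desc]
      simp [hx]
    · rw [← cancel_mono (i.map n), Category.assoc, Category.assoc, hr, kernel.lift_ι_assoc,
        biprod.lift_snd]
  have hw : kernel.lift q (biprod.lift (kernel.ι f) 0) (by simp [q]) ≫ r = 0 := by
    rw [← cancel_mono (i.map n), Category.assoc, hr]
    simp
  refine Pres.gen_kernel (h.isProjClass hi hJ) (isConf_of_deflation (S := ofAbelian A)
    (isConf_ofAbelian r).deflation hw ⟨fun a b hab => ?_⟩ fun T t ht => ?_) hgen
    (h.pres_map hi hJ hN)
  · have := hab =≫ (kernel.ι q ≫ biprod.fst)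
    rw [← cancel_mono (kernel.ι f)]
    simpa using this
  · have h₁ : t ≫ kernel.ι q ≫ biprod.snd = 0 := by
      rw [← hr, ← Category.assoc, ht, zero_comp]
    have h₂ : (t ≫ kernel.ι q ≫ biprod.fst) ≫ f = 0 := by
      have := t ≫= hκ
      simp only [Preadditive.comp_add, reassoc_of% h₁, zero_comp, add_zero, comp_zero] at this
      simpa using this
    refine ⟨kernel.lift f _ h₂, ?_⟩
    rw [← cancel_mono (kernel.ι q)]
    apply biprod.hom_ext
    · simp
    · simp [h₁]

end

end IsExceptional

end

/-! ### The image of the exact category in its envelope -/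

section

variable {C : Type u} [Category.{v} C] [Preadditive C] {L : Type w} {S : ExactStructure C}
  {D : L → C} {A : Type u'} [Category.{v'} A] [Abelian A] {i : C ⥤ A} {k : Type*} [Field k] [Linear k C]
  [PartialOrder L] [Finite L] (h : S.IsExceptional k D) (hi : S.IsProjectiveModel i)

omit [Finite L] in
lemma isLowerSet_insert {I : Set L} (hI : IsLowerSet I) {l : L} (hl : Minimal (· ∈ Iᶜ) l) :
    IsLowerSet (insert l I) := by
  rintro a b hba (rfl | ha)
  · by_cases hb : b ∈ I
    · exact .inr hb
    · exact .inl (le_antisymm hba (hl.2 hb hba))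
  · exact .inr (hI hba ha)

namespace IsExceptional

include h hi

omit [Finite L] in
lemma isCoref_id (X : A) : IsCoref (projClass S D i Set.univ) (𝟙 X) where
  pres := by
    obtain ⟨P, hP, p, _⟩ := hi.exists_epi X
    obtain ⟨Q, hQ, q, _⟩ := hi.exists_epi (kernel p)
    exact ⟨_, _, _, p, projClass_map (h.filt_univ P) hP,
      ⟨_, projClass_map (h.filt_univ Q) hQ, q, inferInstance⟩, isConf_ofAbelian p⟩
  eq_zero f _ hf := by simpa using hf
  exists_fac f _ := ⟨f, by simp⟩

/-- Only the zero object is a quotient of sums of copies of both `D l` and `D m`, if `m ≰ l`: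
a projective object generated by the `D a` with `a ≤ l` has no morphisms to `D m`. -/
lemma isZero_of_epi {l m : L} (hlm : ¬ m ≤ l) {K : A} {V W : C} (hV : S.filt D {l} V)
    (hW : S.filt D {m} W) (p : i.obj V ⟶ K) [Epi p] (q : i.obj W ⟶ K) [Epi q] : IsZero K := by
  have hI : IsLowerSet {a | a ≤ l} := fun a b hba ha => hba.trans ha
  obtain ⟨P, ⟨Q, hQ, hQ', ⟨e⟩⟩, r, _⟩ :=
    (h.pres_map hi hI (filt_mono (by simp) _ hV)).gen
  have := (Projective.of_iso e (hi.projective Q hQ'))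
  have h0 : Projective.factorThru (r ≫ p) q = 0 :=
    h.hom_eq_zero hi (J := {m}) (by rintro a ha b rfl hba; exact hlm (hba.trans ha))
      ⟨Q, hQ, hQ', ⟨e⟩⟩ hW _
  have h1 : r ≫ p = 0 := by
    rw [← Projective.factorThru_comp (r ≫ p) q, h0, zero_comp]
  exact IsZero.of_epi_eq_zero (r ≫ p) h1

/-- If the coreflections of `X` along the lower sets `{m | ¬ l ≤ m}` are monomorphisms, the same
holds for all lower sets `I`. If the complement of `I` has two minimal elements `l` and `m`, then the
kernel of the coreflection is a quotient of sums of copies of both `D l` and `D m`. -/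
lemma mono_of_isCoref {X : A} (hX : ∀ (l : L) {Y : A} (ε : Y ⟶ X),
      IsCoref (projClass S D i {m | ¬ l ≤ m}) ε → Mono ε)
    {I : Set L} (hI : IsLowerSet I) {Y : A} {ε : Y ⟶ X} (hε : IsCoref (projClass S D i I) ε) :
    Mono ε := by
  induction I using WellFoundedGT.induction generalizing Y with
  | ind I ih =>
    rcases (Iᶜ).eq_empty_or_nonempty with hne | hne
    · obtain rfl : I = Set.univ := Set.compl_empty_iff.1 hne
      exact (h.isCoref_id hi X).mono hε
    obtain ⟨l, hl⟩ := (Iᶜ).toFinite.exists_minimal hne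
    by_cases huniq : ∃ m, Minimal (· ∈ Iᶜ) m ∧ m ≠ l
    · obtain ⟨m, hm, hml⟩ := huniq
      have key {l : L} (hl : Minimal (· ∈ Iᶜ) l) :
          ∃ (V : C) (_ : S.filt D {l} V) (p : i.obj V ⟶ kernel ε), Epi p := by
        have hJ := isLowerSet_insert hI hl
        obtain ⟨Z, ζ, hζ⟩ := (h.isProjClass hi hJ).exists_isCoref X
        have := ih _ (Set.ssubset_insert hl.1) hJ hζ
        obtain ⟨f, rfl, hf⟩ := hζ.exists_factor (projClass_mono (Set.subset_insert l I)) hε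
        obtain ⟨V, hV, p, _⟩ := h.exists_epi_kernel hi hI hl.1 hJ hf hζ.pres
        exact ⟨V, hV, p ≫ (kernelCompMono f ζ).inv, inferInstance⟩
      obtain ⟨V, hV, p, _⟩ := key hl
      obtain ⟨W, hW, q, _⟩ := key hm
      have hK := h.isZero_of_epi hi (fun hml' => hml (le_antisymm hml' (hl.2 hm.1 hml'))) hV hW p q
      exact Preadditive.mono_of_kernel_zero (hK.eq_of_src _ _)
    · -- if `l` is the only minimal element of the complement, then `I = {m | ¬ l ≤ m}`
      refine hX l ε ?_
      convert hε using 2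
      ext m
      refine ⟨fun hlm => by_contra fun hm => hlm ?_, fun hm hlm => hl.1 (hI hlm hm)⟩
      obtain ⟨m', hm', hmin⟩ := (Iᶜ).toFinite.exists_le_minimal hm
      by_contra hlm
      exact huniq ⟨m', hmin, fun e => hlm (e ▸ hm')⟩

/-- If the coreflections of `X` along lower sets are monomorphisms, they are iterated extensions of
sums of copies of the objects `D l`, and hence come from the exact category. -/
lemma essImage_of_isCoref {X : A} (hX : ∀ {I : Set L} (_ : IsLowerSet I) {Y : A} (ε : Y ⟶ X),
      IsCoref (projClass S D i I) ε → Mono ε)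
    {I : Set L} (hI : IsLowerSet I) {Y : A} {ε : Y ⟶ X} (hε : IsCoref (projClass S D i I) ε) :
    i.essImage Y := by
  induction I using WellFoundedLT.induction generalizing Y with
  | ind I ih =>
    rcases I.eq_empty_or_nonempty with rfl | hne
    · obtain ⟨P, ⟨Q, hQ, -, ⟨e⟩⟩, p, _⟩ := hε.pres.gen
      have := hi.rightExact.1
      have hQ := i.map_isZero (filt_empty hQ)
      exact ⟨Q, ⟨hQ.iso ((hQ.of_iso e.symm).of_epi p)⟩⟩
    obtain ⟨l, hl⟩ := I.toFinite.exists_maximal hne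
    have hI' : IsLowerSet (I \ {l}) := fun a b hba ha => ⟨hI hba ha.1, by
      rintro rfl
      exact ha.2 (le_antisymm (hl.2 ha.1 hba) hba)⟩
    have hl' : l ∉ I \ {l} := fun h => h.2 rfl
    have hIl : insert l (I \ {l}) = I := Set.insert_sdiff_self_of_mem hl.1
    obtain ⟨Y', ε', hε'⟩ := (h.isProjClass hi hI').exists_isCoref X
    have := hX hI' ε' hε'
    obtain ⟨f, hf, hf'⟩ := hε.exists_factor (projClass_mono Set.sdiff_subset) hε'
    have : Mono f := mono_of_mono_fac hf
    obtain ⟨E, ⟨e⟩⟩ := ih _ (Set.sdiff_singleton_ssubset.2 hl.1) hI' hε'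
    obtain ⟨V, -, ⟨e'⟩⟩ := h.exists_iso_cokernel hi hI' hl' (by rwa [hIl]) hf' (by
      rw [hIl]; exact hε.pres)
    have hc : (ofAbelian A).IsConf f (cokernel.π f) :=
      ⟨cokernel.condition f, ShortComplex.ShortExact.mk' (ShortComplex.exact_cokernel f)
        inferInstance (inferInstanceAs (Epi (cokernel.π f)))⟩
    obtain ⟨E', -, -, -, ⟨e''⟩⟩ := hi.exists_extension h.hasEnoughProj
      (hc.of_iso (i' := e.hom ≫ f) (d' := cokernel.π f ≫ e'.inv) e.symm (Iso.refl _) e'.symm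
        (by simp) (by simp))
    exact ⟨E', ⟨e''⟩⟩

/-- The image of the exact category consists of the objects whose coreflections along the lower sets
`{m | ¬ l ≤ m}` are monomorphisms. -/
lemma essImage_iff (X : A) : i.essImage X ↔
    ∀ (l : L) {Y : A} (ε : Y ⟶ X), IsCoref (projClass S D i {m | ¬ l ≤ m}) ε → Mono ε := by
  refine ⟨?_, fun hX => h.essImage_of_isCoref hi (fun hI _ _ => h.mono_of_isCoref hi hX hI)
    isLowerSet_univ (h.isCoref_id hi X)⟩
  rintro ⟨E, ⟨e⟩⟩ l Y ε hε
  have hI : IsLowerSet {m | ¬ l ≤ m} := fun a b hba ha hb => ha (hb.trans hba)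
  obtain ⟨T, F, a, b, hc, hT, hF⟩ := h.star_filt (X := E) (I := {m | ¬ l ≤ m})
    (J := {m | ¬ l ≤ m}ᶜ) (fun x hx y hy hyx => hy (hI hyx hx)) (by
      rw [Set.union_compl_self]; exact h.filt_univ E)
  have ha := h.isCoref_map hi hI hc hT hF
  have := (hi.isConf_map hc).mono
  exact (ha.comp_iso e).mono hε

end IsExceptional

end

/-! ### Functors between envelopes which preserve projective objects -/

section

variable {C : Type u} [Category.{v} C] [Preadditive C] {S : ExactStructure C}
  {A : Type u'} [Category.{v'} A] [Abelian A] {B : Type*} [Category* B] [Abelian B]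
  {i : C ⥤ A} (hi : S.IsProjectiveModel i) {β : A ⥤ B} (hβ : (ofAbelian A).rightExact B β)
  (hproj : ∀ P, S.IsProj P → Projective (β.obj (i.obj P)))

include hβ in
lemma rightExact.preservesFiniteColimits : PreservesFiniteColimits β := by
  obtain ⟨_, h⟩ := hβ
  obtain ⟨h⟩ := ((Functor.preservesFiniteColimits_tfae β).out 0 3).1 h
  exact ⟨h⟩

include hi hβ hproj

lemma IsProjectiveModel.exists_map_eq [(i ⋙ β).Full] {P : C} (hP : S.IsProj P) {M : A}
    (f : β.obj (i.obj P) ⟶ β.obj M) : ∃ g : i.obj P ⟶ M, β.map g = f := by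
  obtain ⟨Q, -, p, _⟩ := hi.exists_epi M
  have := hproj P hP
  have := hβ.map_epi (isConf_ofAbelian p).deflation
  let u : β.obj (i.obj P) ⟶ β.obj (i.obj Q) := Projective.factorThru f (β.map p)
  obtain ⟨g, hg⟩ := (i ⋙ β).map_surjective (X := P) (Y := Q) u
  refine ⟨i.map g ≫ p, ?_⟩
  rw [β.map_comp]
  exact (congrArg (· ≫ β.map p) hg).trans (Projective.factorThru_comp f (β.map p))

lemma IsProjectiveModel.eq_zero_of_map [(i ⋙ β).Full] [(i ⋙ β).Faithful] {P : C}
    (hP : S.IsProj P) {M : A} (f : i.obj P ⟶ M) (hf : β.map f = 0) : f = 0 := by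
  have := hi.full
  obtain ⟨Q, -, p, _⟩ := hi.exists_epi M
  obtain ⟨R, -, r, _⟩ := hi.exists_epi (kernel p)
  have := hi.projective P hP
  have := hproj P hP
  obtain ⟨x, hx⟩ := i.map_surjective (Projective.factorThru f p)
  obtain ⟨y, hy⟩ := i.map_surjective (r ≫ kernel.ι p)
  have hp := isConf_ofAbelian p
  obtain ⟨h₁, -⟩ := hβ.2 _ hp.2
  have := hβ.map_epi (isConf_ofAbelian r).deflation
  have h0 : β.map (i.map x) ≫ β.map p = 0 := by
    rw [← β.map_comp, hx, Projective.factorThru_comp, hf]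
  let u : β.obj (i.obj P) ⟶ β.obj (kernel p) := h₁.liftFromProjective (β.map (i.map x)) h0
  have hu : u ≫ β.map (kernel.ι p) = β.map (i.map x) := h₁.liftFromProjective_comp _ h0
  let t : β.obj (i.obj P) ⟶ β.obj (i.obj R) := Projective.factorThru u (β.map r)
  obtain ⟨z, hz⟩ := (i ⋙ β).map_surjective (X := P) (Y := R) t
  have : x = z ≫ y := (i ⋙ β).map_injective (by
    rw [(i ⋙ β).map_comp, hz]
    change β.map (i.map x) = t ≫ β.map (i.map y)
    rw [hy, β.map_comp, Projective.factorThru_comp_assoc, hu])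
  rw [← Projective.factorThru_comp f p, ← hx, this, i.map_comp, hy]
  simp

/-- A right exact functor is fully faithful if it is so on projective generators, and sends them to
projective objects. -/
lemma IsProjectiveModel.full_and_faithful [(i ⋙ β).Full] [(i ⋙ β).Faithful] :
    β.Full ∧ β.Faithful := by
  have := hβ.1
  refine ⟨⟨fun {N M} f => ?_⟩, ⟨fun {N M} f g hfg => ?_⟩⟩
  · obtain ⟨P, hP, p, _⟩ := hi.exists_epi N
    obtain ⟨R, hR, r, _⟩ := hi.exists_epi (kernel p)
    have hc := isConf_ofAbelian p
    have := hβ.map_epi hc.deflation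
    obtain ⟨g, hg⟩ := hi.exists_map_eq hβ hproj hP (β.map p ≫ f)
    obtain ⟨s, hs⟩ := hc.desc g (by
      rw [← cancel_epi r, comp_zero]
      have h0 := hi.eq_zero_of_map hβ hproj hR (r ≫ kernel.ι p ≫ g) (by
        rw [β.map_comp, β.map_comp, hg, ← Category.assoc (β.map (kernel.ι p)), ← β.map_comp,
          kernel.condition, β.map_zero, zero_comp, comp_zero])
      exact h0)
    refine ⟨s, ?_⟩
    rw [← cancel_epi (β.map p), ← β.map_comp, hs, hg]
  · obtain ⟨P, hP, p, _⟩ := hi.exists_epi N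
    rw [← sub_eq_zero, ← cancel_epi p, comp_zero]
    refine hi.eq_zero_of_map hβ hproj hP _ ?_
    rw [β.map_comp, β.map_sub, hfg, sub_self, comp_zero]

variable {Q : ObjectProperty B} (hQ : IsProjClass Q)
  (hPQ : ∀ P, S.IsProj P → Q (β.obj (i.obj P)))
  (hQP : ∀ M, Q M → ∃ P, S.IsProj P ∧ Nonempty (β.obj (i.obj P) ≅ M))

omit hproj in
include hPQ in
lemma IsProjectiveModel.pres_obj (M : A) : Pres Q (β.obj M) := by
  obtain ⟨P, hP, p, _⟩ := hi.exists_epi M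
  obtain ⟨R, hR, r, _⟩ := hi.exists_epi (kernel p)
  have hc := isConf_ofAbelian p
  have := hβ.map_epi hc.deflation
  have := hβ.map_epi (isConf_ofAbelian r).deflation
  obtain ⟨h₁, -⟩ := hβ.2 _ hc.2
  have := hβ.1
  have h₀ : β.map (kernel.ι p) ≫ β.map p = 0 := by
    rw [← β.map_comp, kernel.condition, β.map_zero]
  have : Epi (kernel.lift (β.map p) (β.map (kernel.ι p)) h₀) := h₁.epi_kernelLift
  exact ⟨_, _, _, β.map p, hPQ P hP, Gen.of_epi ⟨_, hPQ R hR, β.map r, inferInstance⟩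
    (kernel.lift (β.map p) (β.map (kernel.ι p)) h₀), isConf_ofAbelian (β.map p)⟩

omit hproj hi in
include hQP in
lemma rightExact.exists_iso_of_pres [(i ⋙ β).Full] {Y : B} (hY : Pres Q Y) :
    ∃ M, Nonempty (β.obj M ≅ Y) := by
  obtain ⟨P, K, j, p, hP, ⟨P', hP', r, _⟩, hc⟩ := hY
  obtain ⟨X, hX, ⟨e⟩⟩ := hQP P hP
  obtain ⟨X', hX', ⟨e'⟩⟩ := hQP P' hP'
  obtain ⟨x, hx⟩ := (i ⋙ β).map_surjective
    (e'.hom ≫ (r ≫ j) ≫ e.inv : (i ⋙ β).obj X' ⟶ (i ⋙ β).obj X)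
  have := hβ.1
  have := hβ.preservesFiniteColimits
  have hx : β.map (i.map x) = e'.hom ≫ (r ≫ j) ≫ e.inv := hx
  let e₁ := PreservesCokernel.iso β (i.map x)
  let e₂ : cokernel (β.map (i.map x)) ≅ cokernel (r ≫ j) :=
    cokernel.mapIso _ _ e' e (by rw [hx]; simp)
  let e₃ : cokernel j ≅ Y := (cokernelIsCokernel j).coconePointUniqueUpToIso hc.2.gIsCokernel
  exact ⟨_, ⟨e₁ ≪≫ e₂ ≪≫ cokernelEpiComp r j ≪≫ e₃⟩⟩

include hQ hPQ hQP

omit hproj in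
/-- A right exact functor `β`, fully faithful on projective generators, whose images form a
contravariantly finite class `Q` of projective objects, is left adjoint to the coreflection along
`Q`. -/
lemma IsProjectiveModel.isLeftAdjoint [(i ⋙ β).Full] [(i ⋙ β).Faithful] : β.IsLeftAdjoint := by
  obtain ⟨_, _⟩ := hi.full_and_faithful hβ fun P hP => hQ.projective _ (hPQ P hP)
  rw [isLeftAdjoint_iff_hasTerminal_costructuredArrow]
  intro X
  obtain ⟨Y, ε, hε⟩ := hQ.exists_isCoref X
  obtain ⟨M, ⟨e⟩⟩ := hβ.exists_iso_of_pres hQP hε.pres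
  refine IsTerminal.hasTerminal (X := CostructuredArrow.mk (e.hom ≫ ε)) ?_
  have hlift (a : CostructuredArrow β X) : ∃ f : a.left ⟶ M, β.map f ≫ e.hom ≫ ε = a.hom := by
    obtain ⟨g, hg⟩ := hε.exists_lift (hi.pres_obj hβ hPQ a.left) a.hom
    obtain ⟨f, hf⟩ := β.map_surjective (g ≫ e.inv)
    exact ⟨f, by rw [hf]; simp [hg]⟩
  choose f hf using hlift
  refine IsTerminal.ofUniqueHom (fun a => CostructuredArrow.homMk (f a) (hf a)) fun a m => ?_
  ext
  refine β.map_injective ((cancel_mono e.hom).1 (hε.hom_ext (hi.pres_obj hβ hPQ a.left).gen ?_))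
  rw [Category.assoc, Category.assoc]
  exact (CostructuredArrow.w m).trans (hf a).symm

omit hproj in
/-- In the situation of `isLeftAdjoint`, the adjunction counit is the coreflection along `Q`. -/
lemma IsProjectiveModel.isCoref_counit [(i ⋙ β).Full] [(i ⋙ β).Faithful] {βr : B ⥤ A}
    (adj : β ⊣ βr) (X : B) : IsCoref Q (adj.counit.app X) := by
  obtain ⟨_, _⟩ := hi.full_and_faithful hβ fun P hP => hQ.projective _ (hPQ P hP)
  refine ⟨hi.pres_obj hβ hPQ _, fun {M} f hM hf => ?_, fun {M} f hM => ?_⟩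
  · obtain ⟨P, hP, ⟨e⟩⟩ := hQP M hM
    have := hβ.1
    obtain ⟨g, hg⟩ := β.map_surjective (e.hom ≫ f)
    have h0 : (adj.homEquiv _ _).symm g = (adj.homEquiv _ _).symm 0 := by
      rw [adj.homEquiv_counit, adj.homEquiv_counit, hg, β.map_zero, Category.assoc, hf, zero_comp,
        comp_zero]
    rw [← cancel_epi e.hom, ← hg, (adj.homEquiv _ _).symm.injective h0, β.map_zero, comp_zero]
  · obtain ⟨P, hP, ⟨e⟩⟩ := hQP M hM
    refine ⟨e.inv ≫ β.map (adj.homEquiv _ _ (e.hom ≫ f)), ?_⟩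
    have := adj.homEquiv_counit (g := adj.homEquiv _ _ (e.hom ≫ f))
    rw [Equiv.symm_apply_apply] at this
    rw [Category.assoc]
    exact (congrArg (e.inv ≫ ·) this.symm).trans (e.inv_hom_id_assoc f)

end

/-! ### Subcategories generated by lower sets -/

section

variable {C : Type u} [Category.{v} C] [Preadditive C] {S : ExactStructure C} {T : ObjectProperty C}
  {hT : S.IsFullyExact T}

lemma isConf_induced_iff {X Y Z : T.FullSubcategory} {f : X ⟶ Y} {d : Y ⟶ Z} :
    (S.induced T hT).IsConf f d ↔ S.IsConf f.hom d.hom :=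
  ⟨fun ⟨w, hw⟩ => ⟨congrArg (·.hom) w, hw⟩, fun ⟨w, hw⟩ => ⟨T.hom_ext w, hw⟩⟩

lemma IsProj.induced {P : T.FullSubcategory} (hP : S.IsProj P.obj) : (S.induced T hT).IsProj P := by
  refine fun Y => extZero_iff_section.2 fun M i d hc => ?_
  obtain ⟨s, hs⟩ := hP.exists_lift (isConf_induced_iff.1 hc).deflation (𝟙 P.obj)
  exact ⟨T.homMk s, T.hom_ext hs⟩

lemma InAdd.fullSubcategory {P X : T.FullSubcategory} (h : InAdd P.obj X.obj) : InAdd P X := by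
  obtain ⟨J, _, p, q, hpq⟩ := h
  refine ⟨J, inferInstance, fun a => T.homMk (p a), fun a => T.homMk (q a), T.hom_ext ?_⟩
  refine Eq.trans ?_ hpq
  exact map_sum (T.ι.mapAddHom (X := X) (Y := X)) _ _

variable {L : Type u'} {D : L → C} {k : Type w} [Field k] [Linear k C] [PartialOrder L] [Finite L]
  (h : S.IsExceptional k D) {I : Set L} (hI : IsLowerSet I) (hTI : T = S.filt D I)
include h hI hTI

lemma IsExceptional.isProj_induced_iff {P : T.FullSubcategory} :
    (S.induced T hT).IsProj P ↔ S.IsProj P.obj := by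
  subst hTI
  refine ⟨fun hP => ?_, fun hP => hP.induced⟩
  obtain ⟨K, Q, f, d, hc, hK, hQ, hQ'⟩ := h.exists_proj hI P.property
  have hc' : (S.induced _ hT).IsConf (ObjectProperty.homMk f : ⟨K, hK⟩ ⟶ ⟨Q, hQ⟩)
    (ObjectProperty.homMk d : _ ⟶ P) := isConf_induced_iff.2 hc
  obtain ⟨s, hs⟩ := hP.exists_lift hc'.deflation (𝟙 P)
  exact hQ'.of_inAdd (.of_retract s.hom d (congrArg (·.hom) hs))

lemma IsExceptional.exists_isProjGenerator_induced :
    ∃ P : T.FullSubcategory, (S.induced T hT).IsProjGenerator P ∧ Module.Finite k (P ⟶ P) := by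
  subst hTI
  obtain ⟨P, hP, hP', hgen⟩ := h.exists_proj_generator hI
  refine ⟨⟨P, hP⟩, ⟨IsProj.induced hP', fun X => ?_⟩, ?_⟩
  · obtain ⟨K, Y, f, d, hc, hK, hY, hPY⟩ := hgen X.obj X.property
    have hc' : (S.induced _ hT).IsConf (ObjectProperty.homMk f : ⟨K, hK⟩ ⟶ ⟨Y, hY⟩)
      (ObjectProperty.homMk d : _ ⟶ X) := isConf_induced_iff.2 hc
    exact ⟨_, _, hc'.deflation, InAdd.fullSubcategory hPY⟩
  · have := h.hom_finite P P
    have : Module.Finite k ((S.filt D I).ι.obj ⟨P, hP⟩ ⟶ (S.filt D I).ι.obj ⟨P, hP⟩) := this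
    exact Module.Finite.of_injective
      ((S.filt D I).ι.mapLinearMap k (X := ⟨P, hP⟩) (Y := ⟨P, hP⟩)) (S.filt D I).ι.map_injective

end

end ExactStructure

theorem mainTheorem9 {k : Type w} [Field k] [IsAlgClosed k]
    {E : Type u} [Category.{v} E] [Preadditive E] [Linear k E]
    (S : ExactStructure E) (hE : S.IsThin k) :
    -- the canonical relation on the set of classes of irreducible objects is a partial order
    (∀ l m : S.Irr, S.canonicalLE l m → S.canonicalLE m l → l = m) ∧
    -- the subcategories `T_l` are right admissible, and all the envelopes exist
    (∀ l : S.Irr, S.IsRightAdmissible (S.torsion l)) ∧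
    ExactStructure.HasRightEnvelope.{v, max u v} S ∧
    (∀ l : S.Irr, ExactStructure.HasRightEnvelope.{v, max u v}
      (S.induced (S.torsion l) (S.isFullyExact_torsion l))) ∧
    -- for any choice of the envelopes `iR : E ⥤ A` and `iT l : T_l ⥤ AT l`, and of right exact
    -- functors `β l : AT l ⥤ A` induced by the inclusions of the `T_l`:
    ∀ (A : Type (max u v)) [Category.{v} A] [Abelian A] (iR : E ⥤ A) (_ : S.IsRightEnvelope iR)
      (AT : S.Irr → Type (max u v)) [∀ l, Category.{v} (AT l)] [∀ l, Abelian (AT l)]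
      (iT : ∀ l, (S.torsion l).FullSubcategory ⥤ AT l)
      (_ : ∀ l, (S.induced (S.torsion l) (S.isFullyExact_torsion l)).IsRightEnvelope (iT l))
      (β : ∀ l, AT l ⥤ A)
      (_ : ∀ l, (ExactStructure.ofAbelian (AT l)).rightExact A (β l))
      (_ : ∀ l, Nonempty (iT l ⋙ β l ≅ (S.torsion l).ι ⋙ iR)),
      -- `E` is a full subcategory of `A`, each `β l` has a right adjoint, and an object of `A` lies
      -- in `E` if and only if the adjunction counits at this object are monomorphisms
      iR.Full ∧ iR.Faithful ∧ (∀ l, (β l).IsLeftAdjoint) ∧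
      ∀ (βr : ∀ l, A ⥤ AT l) (adj : ∀ l, β l ⊣ βr l) (X : A),
        iR.essImage X ↔ ∀ l, Mono ((adj l).counit.app X) := by
  obtain ⟨n, r, hr, hle⟩ := hE.exists_rank
  have hanti (l m : S.Irr) (hlm : S.canonicalLE l m) (hml : S.canonicalLE m l) : l = m :=
    hr (le_antisymm (hle l m hlm) (hle m l hml))
  have : Finite S.Irr := Finite.of_injective r hr
  let := ExactStructure.canonicalPartialOrder hanti
  have h : S.IsExceptional k S.irrObj := hE.isExceptional hanti
  have hT (l : S.Irr) : S.torsion l = S.filt S.irrObj {m | ¬ l ≤ m} :=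
    ExactStructure.generatedBy_eq_filt _
  have hI (l : S.Irr) : IsLowerSet {m | ¬ l ≤ m} := fun a b hba ha hb => ha (hb.trans hba)
  obtain ⟨P, -, hP, hgen⟩ := h.exists_proj_generator isLowerSet_univ
  have hP : S.IsProjGenerator P := ⟨hP, fun X => by
    obtain ⟨K, Y, f, d, hc, -, -, hY⟩ := hgen X (h.filt_univ X)
    exact ⟨Y, d, hc.deflation, hY⟩⟩
  have := hE.hom_finite P P
  have := ExactStructure.isNoetherianRing_end (k := k) P
  choose Q hQ hfin using fun l =>
    h.exists_isProjGenerator_induced (hT := S.isFullyExact_torsion l) (hI l) (hT l)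
  have (l : S.Irr) := ExactStructure.isNoetherianRing_end (k := k) (Q l)
  refine ⟨hanti, fun l => by rw [hT]; exact h.isRightAdmissible_filt (hI l), hP.hasRightEnvelope,
    fun l => (hQ l).hasRightEnvelope, fun A _ _ iR hiR AT _ _ iT hiT β hβ hβι => ?_⟩
  have hi := hP.isProjectiveModel_of_isRightEnvelope hiR
  have hi' (l : S.Irr) := (hQ l).isProjectiveModel_of_isRightEnvelope (hiT l)
  have := hi.full
  have := hi.faithful
  have e (l : S.Irr) := (hβι l).some
  have hfull (l : S.Irr) : (iT l ⋙ β l).Full := .of_iso (e l).symm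
  have hfaith (l : S.Irr) : (iT l ⋙ β l).Faithful := .of_iso (e l).symm
  have hproj (l : S.Irr) {R : (S.torsion l).FullSubcategory} :
      (S.induced _ (S.isFullyExact_torsion l)).IsProj R ↔ S.IsProj R.obj :=
    h.isProj_induced_iff (hI l) (hT l)
  -- the projective objects of `AT l`, viewed in `A`
  have hPQ (l : S.Irr) (R) (hR : (S.induced _ (S.isFullyExact_torsion l)).IsProj R) :
      ExactStructure.projClass S S.irrObj iR {m | ¬ l ≤ m} ((β l).obj ((iT l).obj R)) :=
    ⟨R.obj, hT l ▸ R.property, (hproj l).1 hR, ⟨((e l).app R).symm⟩⟩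
  have hQP (l : S.Irr) (M : A) (hM : ExactStructure.projClass S S.irrObj iR {m | ¬ l ≤ m} M) :
      ∃ R, (S.induced _ (S.isFullyExact_torsion l)).IsProj R ∧
        Nonempty ((β l).obj ((iT l).obj R) ≅ M) := by
    obtain ⟨R, hR, hR', ⟨e'⟩⟩ := hM
    exact ⟨⟨R, (hT l).symm ▸ hR⟩, (hproj l).2 hR', ⟨(e l).app _ ≪≫ e'⟩⟩
  refine ⟨hi.full, hi.faithful,
    fun l => (hi' l).isLeftAdjoint (hβ l) (h.isProjClass hi (hI l)) (hPQ l) (hQP l),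
    fun βr adj X => (h.essImage_iff hi X).trans (forall_congr' fun l => ?_)⟩
  have hcounit := (hi' l).isCoref_counit (hβ l) (h.isProjClass hi (hI l)) (hPQ l) (hQP l) (adj l) X
  refine ⟨fun hX => hX _ hcounit, fun hX Y ε hε => ?_⟩
  have : Mono ((adj l).counit.app X) := hX
  exact hcounit.mono hε
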